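/- **Setting.** Let $(X_t)_{t\ge 0}$ be a strictly stationary time-homogeneous Markov process in discrete time with values in $\mathbb R^d$, with transition kernel $\kappa_{\theta_0}$, where $(\kappa_\theta)_{\theta\in\Theta}$, $\Theta\subset\mathbb R^p$, is a parametric family of Markov transition kernels on $\mathbb R^d$ (for example, $\kappa_\theta$ is the transition law over a fixed sampling interval $\delta$ of the solution of a Lévy-driven equation $dX_t=\mu(X_t;\theta)\,dt+\sigma(X_t;\theta)\,dL_{t;\theta}$). Let $\psi(u;\theta,x)=\int e^{iu^Ty}\kappa_\theta(x,dy)$ be the conditional characteristic function (CCF). Let $S\subset\mathbb R^{2d}$ be compact and let $\pi$ be a bounded probability density on $\mathbb R^{2d}$ that vanishes outside $S$. Let $w(\tau;x)$, $\tau=(u,r)\in\mathbb R^{d}\times\mathbb R^d$, be a measurable complex weight with $|w|=1$ and $\overline{w(\tau;x)}=w(-\tau;x)$, continuous in $\tau\in S$ for every $x$. Put $$\varepsilon_t(\tau;\theta)=w(\tau;X_t)\{e^{iu^TX_{t+1}}-\psi(u;\theta,X_t)\},\quad \vec\varepsilon_t=(\operatorname{Re}\varepsilon_t,\operatorname{Im}\varepsilon_t)^T,\quad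 \tilde\varepsilon_t(\tau;\theta)=(\varepsilon_t(\tau;\theta),\varepsilon_t(-\tau;\theta))^T .$$ Write $\ell_n(\tau;\theta)=-2\log\{n^nL_n(\tau,\theta)\}\in[0,\infty]$, where $L_n(\tau,\theta)$ is the maximum of $\prod_t p_t$ over $p_t\ge 0$, $\sum_t p_t=1$, $\sum_t p_t\vec\varepsilon_t(\tau;\theta)=0$, the sums and product being over the $n$ residuals ($L_n=0$ if there are no such $p_t$), and $\ell_n(\theta)=\int\ell_n(\tau;\theta)\pi(\tau)\,d\tau$. Let $A(\tau_1,\tau_2)=\operatorname{Cov}\{\tilde\varepsilon_0(\tau_1;\theta_0),\tilde\varepsilon_0(\tau_2;\theta_0)\}$, $D(\tau)=E\{\partial\tilde\varepsilon_0(\tau;\theta_0)/\partial\theta\}$ (a $2\times p$ matrix), ${}^\star$ the conjugate transpose, $$\Gamma=\int D(\tau)^\star A(\tau,\tau)^{-1}D(\tau)\pi(\tau)\,d\tau,$$ $$V=\iint D(\tau_1)^\star A(\tau_1,\tau_1)^{-1}A(\tau_1,\tau_2)\{A(\tau_2,\tau_2)^{\star}\}^{-1}D(\tau_2)\pi(\tau_1)\pi(\tau_2)\,d\tau_1d\tau_2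 .$$ **Conditions.** C1 (mixing). There are $C,\lambda>0$ with $|P(A\cap B)-P(A)P(B)|\le Ce^{-\lambda t}$ for all $s\ge 0$, $t\ge1$, $A\in\sigma(X_i:i\le s)$, $B\in\sigma(X_i:i\ge s+t)$. C2 (smoothness). There is an open neighbourhood $U\subset\Theta$ of $\theta_0$ such that, for all $\tau=(u,r)\in S$, the maps $\theta\mapsto\psi(u;\theta,x)$ (for almost every $x$ under the law of $X_0$) and $\theta\mapsto E\,\varepsilon_0(\tau;\theta)$ are three times continuously differentiable on $U$; moreover, for almost every $x$, $\partial\psi(u;\theta,x)/\partial\theta$ is jointly continuous in $(\tau,\theta)\in S\times U$ and bounded in norm there by $M(x)$, where $E|M(X_0)|<\infty$. C3 (identification). $\Theta$ is open; $\theta_0\in\Theta$ is the unique $\theta\in\Theta$ with $E\,\varepsilon_0(\tau;\theta)=0$ for all $\tau\in S$; and $P\{\psi(\cdot;\theta_1,X_0)\ne\psi(\cdot;\theta_2,X_0)\}>0$ for all $\theta_1\ne\theta_2$ in $\Theta$. C4 (invertibility). The Hermitian matrix $A(\tau,\tau)$ is positive definite for every $\tau\in S$, and $\Gamma$ is invertible.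 **Theorem.** Assume C1–C4. Let $K>0$ and let $\hat\theta_n$ be random vectors such that, with probability one, for all large $n$, $\hat\theta_n$ minimises $\ell_n(\theta)$ over the ball $\|\theta-\theta_0\|\le Kn^{-1/3}$ (the maximum integrated empirical likelihood estimator). Then $\Sigma=\Gamma^{-1}V\Gamma^{-1}$ is a real positive semidefinite matrix and $$\sqrt n\,(\hat\theta_n-\theta_0)\ \xrightarrow{d}\ N(0,\Sigma).$$ -/

import Mathlib

open MeasureTheory ProbabilityTheory Filter Topology
open scoped ENNReal ComplexConjugate ComplexOrder

noncomputable section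

namespace CCFEL

/-- `ℝ^d` with its Euclidean norm. -/
abbrev Vec (d : ℕ) := EuclideanSpace ℝ (Fin d)

/-- Frequencies `τ = (u, r) ∈ ℝ^d × ℝ^d = ℝ^{2d}`. -/
abbrev Freq (d : ℕ) := Vec d × Vec d

/-! ### The Markov process and its mixing condition -/

/-- The `σ`-field generated by `X_0, …, X_s`. -/
abbrev pastField {Ω : Type*} {d : ℕ} (X : ℕ → Ω → Vec d) (s : ℕ) : MeasurableSpace Ω :=
  ⨆ i ∈ Set.Iic s, MeasurableSpace.comap (X i) inferInstance

/-- The `σ`-field generated by `X_s, X_{s+1}, …`. -/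
abbrev futureField {Ω : Type*} {d : ℕ} (X : ℕ → Ω → Vec d) (s : ℕ) : MeasurableSpace Ω :=
  ⨆ i ∈ Set.Ici s, MeasurableSpace.comap (X i) inferInstance

/-- `X` is a stationary time-homogeneous Markov process with transition kernel `κ`
(all `X_t` have the same law, which together with the Markov property makes the
process strictly stationary). -/
structure IsStationaryMarkov {Ω : Type*} [MeasurableSpace Ω] {d : ℕ} (P : Measure Ω)
    (X : ℕ → Ω → Vec d) (κ : Kernel (Vec d) (Vec d)) : Prop where
  measurable : ∀ t, Measurable (X t)
  stationary : ∀ t, P.map (X t) = P.map (X 0)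
  markov : ∀ (t : ℕ) (B : Set (Vec d)), MeasurableSet B →
    P[(X (t + 1) ⁻¹' B).indicator (fun _ => (1 : ℝ)) | pastField X t]
      =ᵐ[P] fun ω => (κ (X t ω)).real B

/-- Exponentially decaying `α`-mixing coefficients. -/
def ExpAlphaMixing {Ω : Type*} [MeasurableSpace Ω] {d : ℕ} (P : Measure Ω)
    (X : ℕ → Ω → Vec d) : Prop :=
  ∃ C > (0 : ℝ), ∃ rate > (0 : ℝ), ∀ s t : ℕ, 1 ≤ t → ∀ A B : Set Ω,
    MeasurableSet[pastField X s] A → MeasurableSet[futureField X (s + t)] B →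
      |P.real (A ∩ B) - P.real A * P.real B| ≤ C * Real.exp (-rate * t)

/-! ### CCF residuals -/

/-- The conditional characteristic function
`ψ(u; θ, x) = E_θ (exp (i uᵀ X_{t+1}) | X_t = x)` of the parametric family of transition
kernels `κ`. -/
def ccf {d p : ℕ} (κ : Vec p → Kernel (Vec d) (Vec d)) (u : Vec d) (θ : Vec p) (x : Vec d) : ℂ :=
  charFun (κ θ x) u

/-- The residual `ε(τ; θ) = w(τ; x) (exp (i uᵀ y) - ψ(u; θ, x))` of a transition from `x` to `y`,
where `τ = (u, r)`. -/
def residual {d p : ℕ} (κ : Vec p → Kernel (Vec d) (Vec d)) (w : Freq d → Vec d → ℂ)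
    (τ : Freq d) (θ : Vec p) (x y : Vec d) : ℂ :=
  w τ x * (Complex.exp ((inner ℝ τ.1 y : ℝ) * Complex.I) - ccf κ τ.1 θ x)

/-- The real bivariate residual (real part, imaginary part). -/
def residualVec {d p : ℕ} (κ : Vec p → Kernel (Vec d) (Vec d)) (w : Freq d → Vec d → ℂ)
    (τ : Freq d) (θ : Vec p) (x y : Vec d) : Fin 2 → ℝ :=
  ![(residual κ w τ θ x y).re, (residual κ w τ θ x y).im]

/-- The complex bivariate residual `(ε(τ; θ), ε(-τ; θ))ᵀ`. -/
def residualPair {d p : ℕ} (κ : Vec p → Kernel (Vec d) (Vec d)) (w : Freq d → Vec d → ℂ)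
    (τ : Freq d) (θ : Vec p) (x y : Vec d) : Fin 2 → ℂ :=
  ![residual κ w τ θ x y, residual κ w (-τ) θ x y]

/-- Complex weight factors on the frequency set `S`. -/
structure IsWeight {d : ℕ} (S : Set (Freq d)) (w : Freq d → Vec d → ℂ) : Prop where
  measurable : Measurable (Function.uncurry w)
  norm_eq_one : ∀ τ x, ‖w τ x‖ = 1
  conj_symm : ∀ τ x, conj (w τ x) = w (-τ) x
  continuousOn : ∀ x, ContinuousOn (fun τ => w τ x) S

/-! ### Empirical likelihood -/

/-- Probability weights on `n` points satisfying the constraint `∑ p_t g_t = 0`. -/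
def elWeights {n : ℕ} (g : Fin n → Fin 2 → ℝ) : Set (Fin n → ℝ) :=
  {q | (∀ t, 0 ≤ q t) ∧ ∑ t, q t = 1 ∧ ∀ k, ∑ t, q t * g t k = 0}

/-- The empirical likelihood `max ∏ p_t` over the feasible weights (`0` if there are none). -/
def el {n : ℕ} (g : Fin n → Fin 2 → ℝ) : ℝ :=
  sSup ((fun q : Fin n → ℝ => ∏ t, q t) '' elWeights g)

/-- The log empirical likelihood ratio `-2 log (L / n^{-n}) ∈ [0, ∞]`, with the value `∞` if the
empirical likelihood vanishes. -/
def elLogRatio {n : ℕ} (g : Fin n → Fin 2 → ℝ) : ℝ≥0∞ :=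
  if el g = 0 then ∞ else ENNReal.ofReal (-2 * Real.log (el g / ((n : ℝ) ^ n)⁻¹))

/-- The integrated empirical likelihood ratio `ℓ_n(θ) = ∫ ℓ_n(τ; θ) π(τ) dτ` computed from the
observed path `x` (the `n` residuals of the transitions `x_t → x_{t+1}`, `t < n`). -/
def integratedEL {d p : ℕ} (κ : Vec p → Kernel (Vec d) (Vec d)) (w : Freq d → Vec d → ℂ)
    (dens : Freq d → ℝ) (x : ℕ → Vec d) (n : ℕ) (θ : Vec p) : ℝ≥0∞ :=
  ∫⁻ τ : Freq d, elLogRatio (fun t : Fin n => residualVec κ w τ θ (x t) (x (t + 1)))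
    * ENNReal.ofReal (dens τ)

/-- `est` is a maximum integrated empirical likelihood estimator in the
`O(n^{-1/3})`-neighbourhood of `θ₀`: almost surely, for all large `n`, `est n` minimises `ℓ_n` over
the closed ball of radius `K n^{-1/3}` about `θ₀`. -/
def IsLocalMELE {Ω : Type*} [MeasurableSpace Ω] {d p : ℕ} (P : Measure Ω) (X : ℕ → Ω → Vec d)
    (κ : Vec p → Kernel (Vec d) (Vec d)) (w : Freq d → Vec d → ℂ) (dens : Freq d → ℝ)
    (θ₀ : Vec p) (K : ℝ) (est : ℕ → Ω → Vec p) : Prop :=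
  ∀ᵐ ω ∂P, ∀ᶠ n : ℕ in atTop,
    est n ω ∈ Metric.closedBall θ₀ (K * (n : ℝ) ^ (-(1 / 3) : ℝ)) ∧
      IsMinOn (integratedEL κ w dens (fun t => X t ω) n)
        (Metric.closedBall θ₀ (K * (n : ℝ) ^ (-(1 / 3) : ℝ))) (est n ω)

/-! ### The matrices of the limit law -/

/-- `E ε̃(τ; θ)`. -/
def meanPair {Ω : Type*} [MeasurableSpace Ω] {d p : ℕ} (P : Measure Ω) (X : ℕ → Ω → Vec d)
    (κ : Vec p → Kernel (Vec d) (Vec d)) (w : Freq d → Vec d → ℂ) (θ : Vec p) (τ : Freq d) :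
    Fin 2 → ℂ :=
  fun i => ∫ ω, residualPair κ w τ θ (X 0 ω) (X 1 ω) i ∂P

/-- The complex `2 × 2` covariance matrix
`A(τ₁, τ₂) = E [(ε̃(τ₁; θ) - E ε̃(τ₁; θ)) (ε̃(τ₂; θ) - E ε̃(τ₂; θ))⋆]`. -/
def covPair {Ω : Type*} [MeasurableSpace Ω] {d p : ℕ} (P : Measure Ω) (X : ℕ → Ω → Vec d)
    (κ : Vec p → Kernel (Vec d) (Vec d)) (w : Freq d → Vec d → ℂ) (θ : Vec p) (τ₁ τ₂ : Freq d) :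
    Matrix (Fin 2) (Fin 2) ℂ :=
  Matrix.of fun i j => ∫ ω,
    (residualPair κ w τ₁ θ (X 0 ω) (X 1 ω) i - meanPair P X κ w θ τ₁ i) *
      conj (residualPair κ w τ₂ θ (X 0 ω) (X 1 ω) j - meanPair P X κ w θ τ₂ j) ∂P

/-- The `2 × p` matrix `E (∂ε̃(τ; θ) / ∂θ)`. -/
def gradPair {Ω : Type*} [MeasurableSpace Ω] {d p : ℕ} (P : Measure Ω) (X : ℕ → Ω → Vec d)
    (κ : Vec p → Kernel (Vec d) (Vec d)) (w : Freq d → Vec d → ℂ) (θ : Vec p) (τ : Freq d) :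
    Matrix (Fin 2) (Fin p) ℂ :=
  Matrix.of fun i j => ∫ ω,
    fderiv ℝ (fun η : Vec p => residualPair κ w τ η (X 0 ω) (X 1 ω) i) θ
      (EuclideanSpace.single j 1) ∂P

/-- `Γ(θ) = ∫ E(∂ε̃⋆/∂θ) A⁻¹(τ, τ) E(∂ε̃/∂θ) π(τ) dτ`. -/
def Gam {Ω : Type*} [MeasurableSpace Ω] {d p : ℕ} (P : Measure Ω) (X : ℕ → Ω → Vec d)
    (κ : Vec p → Kernel (Vec d) (Vec d)) (w : Freq d → Vec d → ℂ) (dens : Freq d → ℝ)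
    (θ : Vec p) : Matrix (Fin p) (Fin p) ℂ :=
  Matrix.of fun j k => ∫ τ : Freq d,
    ((gradPair P X κ w θ τ).conjTranspose * (covPair P X κ w θ τ τ)⁻¹ *
      gradPair P X κ w θ τ) j k * (dens τ : ℂ)

/-- `V(θ) = ∬ E(∂ε̃⋆(τ₁)/∂θ) A⁻¹(τ₁, τ₁) A(τ₁, τ₂) A⋆⁻¹(τ₂, τ₂) E(∂ε̃(τ₂)/∂θ)
π(τ₁) π(τ₂) dτ₁ dτ₂`. -/
def Vmat {Ω : Type*} [MeasurableSpace Ω] {d p : ℕ} (P : Measure Ω) (X : ℕ → Ω → Vec d)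
    (κ : Vec p → Kernel (Vec d) (Vec d)) (w : Freq d → Vec d → ℂ) (dens : Freq d → ℝ)
    (θ : Vec p) : Matrix (Fin p) (Fin p) ℂ :=
  Matrix.of fun j k => ∫ τ₁ : Freq d, ∫ τ₂ : Freq d,
    ((gradPair P X κ w θ τ₁).conjTranspose * (covPair P X κ w θ τ₁ τ₁)⁻¹ *
      covPair P X κ w θ τ₁ τ₂ * ((covPair P X κ w θ τ₂ τ₂).conjTranspose)⁻¹ *
      gradPair P X κ w θ τ₂) j k * (dens τ₁ : ℂ) * (dens τ₂ : ℂ)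

/-! ### The remaining conditions -/

/-- `dens` is a bounded probability density on `ℝ^{2d}` that vanishes outside the compact set
`S`. -/
structure IsFreqDensity {d : ℕ} (S : Set (Freq d)) (dens : Freq d → ℝ) : Prop where
  compact : IsCompact S
  measurable : Measurable dens
  nonneg : ∀ τ, 0 ≤ dens τ
  bounded : ∃ b : ℝ, ∀ τ, dens τ ≤ b
  support : ∀ τ, τ ∉ S → dens τ = 0
  integral_eq_one : ∫ τ : Freq d, dens τ = 1

/-- Smoothness: on a neighbourhood of `θ₀`, the CCF and the mean residual are three times
continuously differentiable in `θ`; the gradient of the CCF is jointly continuous in frequency and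
parameter, and dominated by an integrable function of `X_t`. -/
def SmoothCCF {Ω : Type*} [MeasurableSpace Ω] {d p : ℕ} (P : Measure Ω) (X : ℕ → Ω → Vec d)
    (κ : Vec p → Kernel (Vec d) (Vec d)) (w : Freq d → Vec d → ℂ) (S : Set (Freq d))
    (Θ : Set (Vec p)) (θ₀ : Vec p) : Prop :=
  ∃ U : Set (Vec p), IsOpen U ∧ θ₀ ∈ U ∧ U ⊆ Θ ∧
    (∀ᵐ x ∂(P.map (X 0)), ∀ τ ∈ S, ContDiffOn ℝ 3 (fun θ => ccf κ τ.1 θ x) U) ∧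
    (∀ τ ∈ S, ContDiffOn ℝ 3 (fun θ => ∫ ω, residual κ w τ θ (X 0 ω) (X 1 ω) ∂P) U) ∧
    (∀ᵐ x ∂(P.map (X 0)), ContinuousOn
      (fun q : Freq d × Vec p => fderiv ℝ (fun θ => ccf κ q.1.1 θ x) q.2) (S ×ˢ U)) ∧
    ∃ M : Vec d → ℝ, Integrable M (P.map (X 0)) ∧
      ∀ᵐ x ∂(P.map (X 0)), ∀ τ ∈ S, ∀ θ ∈ U, ‖fderiv ℝ (fun θ' => ccf κ τ.1 θ' x) θ‖ ≤ M x

/-- Identification: the parameter space is open, `θ₀` is the unique root of the moment conditions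
indexed by `S`, and different parameters have different CCFs with positive probability. -/
structure Identified {Ω : Type*} [MeasurableSpace Ω] {d p : ℕ} (P : Measure Ω)
    (X : ℕ → Ω → Vec d) (κ : Vec p → Kernel (Vec d) (Vec d)) (w : Freq d → Vec d → ℂ)
    (S : Set (Freq d)) (Θ : Set (Vec p)) (θ₀ : Vec p) : Prop where
  isOpen : IsOpen Θ
  mem : θ₀ ∈ Θ
  unique_root : ∀ θ ∈ Θ,
    (∀ τ ∈ S, ∫ ω, residual κ w τ θ (X 0 ω) (X 1 ω) ∂P = 0) ↔ θ = θ₀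
  separated : ∀ θ₁ ∈ Θ, ∀ θ₂ ∈ Θ, θ₁ ≠ θ₂ →
    0 < P {ω | (fun u => ccf κ u θ₁ (X 0 ω)) ≠ fun u => ccf κ u θ₂ (X 0 ω)}

/-- Invertibility of the residual covariance matrices on `S`, and of `Γ(θ₀)`. -/
structure Invertibility {Ω : Type*} [MeasurableSpace Ω] {d p : ℕ} (P : Measure Ω)
    (X : ℕ → Ω → Vec d) (κ : Vec p → Kernel (Vec d) (Vec d)) (w : Freq d → Vec d → ℂ)
    (S : Set (Freq d)) (dens : Freq d → ℝ) (θ₀ : Vec p) : Prop where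
  posDef : ∀ τ ∈ S, (covPair P X κ w θ₀ τ τ).PosDef
  gam : IsUnit (Gam P X κ w dens θ₀)

end CCFEL

end

noncomputable section

namespace CCFEL

/-! ### Transitions of a Markov process -/

/-! Fix a frequency `τ`. The two real constraints of the empirical likelihood say that one complex
sum vanishes, and the second entry of the residual pair is the conjugate of the first. The whole
bivariate problem therefore lives in the real Euclidean plane `ℂ`, where the covariance of the
residual is the operator `z ↦ (a z + b z̄) / 2` with `a = E|ε|²` and `b = E ε²`; positive
definiteness of `A(τ, τ)` becomes `a > |b|`, and compactness of `S` makes the gap uniform.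

Let `y` be the sample mean of `n` residuals and `T` the inverse of that operator. Convex duality
with multiplier `T y` bounds the log ratio below, and explicit feasible weights bound it above
(`le_elLogRatio`, `elLogRatio_le`). Both bounds equal `n ⟪y, T y⟫` up to an error `C n η ‖y‖²`,
where `η` controls both `‖y‖` and the deviation of the empirical second moments
(`elLogRatio_expansion`). Near `θ₀` the mean `y` is affine in `θ` up to a small multiple of `‖θ -
θ₀‖`, with slope the mean gradient `D(τ)`. Integrated over `π`, the criterion is thus nearly `n`
times a quadratic function of `θ - θ₀` with curvature matrix `Γ`. The exact minimiser of that
quadratic is `linearEstimator`, which is `-Γ⁻¹` times the average of the scores `∫ ⟪D, T ε_t⟫ π`.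

Since `Γ` is positive definite, a minimiser of the perturbed criterion differs from the linear
estimator by at most a constant times `√(η W)`, where `W` is the integrated squared mean residual at
`θ₀` (`IsQuadModel.norm_sub_sq_le`). As `n W` is bounded in probability and `η` is arbitrary, the
difference is negligible on the scale `√n`. The linear estimator is of order `n^{-1/2}`, so it lies
in the ball of radius `K n^{-1/3}` with probability close to one for large `n` and is an admissible
competitor there.

Three probabilistic facts feed this argument. The sample moments converge uniformly in the
frequency, and for gradients also in the parameter, because a law of large numbers holds for Banach
space valued functions of the transitions and can be applied in a space of continuous functions
(`exists_uniform_lln`). The quantity `n W` has bounded expectation because centred residuals at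
different times are orthogonal. Finally, the scores are bounded martingale differences, so McLeish's
product argument gives their central limit theorem (`tendsto_integral_exp_sum`). The lemmas `gam_eq`
and `vmat_eq` identify the real matrices of the proof with the complex `Γ` and `V`, and Slutsky's
theorem concludes. -/

lemma map_prodMk_eq_compProd {Ω Ω' E : Type*} [MeasurableSpace Ω] [MeasurableSpace Ω']
    [MeasurableSpace E] (P : Measure Ω) [IsProbabilityMeasure P] {Y : Ω → Ω'} (hY : Measurable Y)
    {Z : Ω → E} (hZ : Measurable Z) (κ : Kernel Ω' E) [IsMarkovKernel κ]
    (h : ∀ A B, MeasurableSet A → MeasurableSet B →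
      P (Y ⁻¹' A ∩ Z ⁻¹' B) = ∫⁻ ω in Y ⁻¹' A, κ (Y ω) B ∂P) :
    P.map (fun ω => (Y ω, Z ω)) = (P.map Y) ⊗ₘ κ := by
  have : IsProbabilityMeasure (P.map Y) := Measure.isProbabilityMeasure_map hY.aemeasurable
  have : IsProbabilityMeasure (P.map (fun ω => (Y ω, Z ω))) :=
    Measure.isProbabilityMeasure_map (hY.prodMk hZ).aemeasurable
  refine Measure.ext_prod fun {A B} hA hB => ?_
  rw [Measure.map_apply (hY.prodMk hZ) (hA.prod hB), Measure.compProd_apply_prod hA hB,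
    setLIntegral_map hA (κ.measurable_coe hB) hY, ← h A B hA hB]
  rfl

lemma pastField_le {Ω : Type*} [mΩ : MeasurableSpace Ω] {d : ℕ} {X : ℕ → Ω → Vec d}
    (hX : ∀ t, Measurable (X t)) (s : ℕ) : pastField X s ≤ mΩ :=
  iSup₂_le fun i _ => (hX i).comap_le

lemma measurable_pastField {Ω : Type*} {d : ℕ} (X : ℕ → Ω → Vec d) {i s : ℕ} (h : i ≤ s) :
    Measurable[pastField X s] (X i) :=
  Measurable.mono (comap_measurable (X i))
    (le_iSup₂ (f := fun i (_ : i ∈ Set.Iic s) => MeasurableSpace.comap (X i) inferInstance) i h)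
    le_rfl

lemma measurable_futureField {Ω : Type*} {d : ℕ} (X : ℕ → Ω → Vec d) {i s : ℕ} (h : s ≤ i) :
    Measurable[futureField X s] (X i) :=
  Measurable.mono (comap_measurable (X i))
    (le_iSup₂ (f := fun i (_ : i ∈ Set.Ici s) => MeasurableSpace.comap (X i) inferInstance) i h)
    le_rfl

/-- Disintegrate the joint law of `(Y, Z)` along the kernel; the inner integral of `f` vanishes. The
space `Ω'` and the statistic `T` are kept abstract so that `Ω'` may be `Ω` itself with a smaller
`σ`-field. This turns the martingale difference property into Fubini's theorem, without conditional
expectations of complex functions. -/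
lemma integral_mul_eq_zero_of_kernel {Ω Ω' E G : Type*} [MeasurableSpace Ω] [MeasurableSpace Ω']
    [MeasurableSpace E] [MeasurableSpace G] (P : Measure Ω) [IsProbabilityMeasure P] {Y : Ω → Ω'}
    (hY : Measurable Y) {Z : Ω → E} (hZ : Measurable Z) {T : Ω' → G} (hT : Measurable T)
    (κ : Kernel G E) [IsMarkovKernel κ]
    (h : ∀ A B, MeasurableSet A → MeasurableSet B →
      P (Y ⁻¹' A ∩ Z ⁻¹' B) = ∫⁻ ω in Y ⁻¹' A, κ (T (Y ω)) B ∂P)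
    {W : Ω' → ℂ} (hW : Measurable W) {b : ℝ} (hWb : ∀ y, ‖W y‖ ≤ b)
    {f : G × E → ℂ} (hf : Measurable f) {b' : ℝ} (hfb : ∀ z, ‖f z‖ ≤ b')
    (h0 : ∀ x, ∫ y, f (x, y) ∂(κ x) = 0) :
    ∫ ω, W (Y ω) * f (T (Y ω), Z ω) ∂P = 0 := by
  have key := map_prodMk_eq_compProd P hY hZ (κ.comap T hT) h
  have : IsProbabilityMeasure (P.map Y) := Measure.isProbabilityMeasure_map hY.aemeasurable
  let F : Ω' × E → ℂ := fun q => W q.1 * f (T q.1, q.2)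
  have hF : Measurable F := by fun_prop
  have e1 : ∫ ω, W (Y ω) * f (T (Y ω), Z ω) ∂P = ∫ q, F q ∂(P.map fun ω => (Y ω, Z ω)) :=
    (integral_map (hY.prodMk hZ).aemeasurable hF.stronglyMeasurable.aestronglyMeasurable).symm
  rw [e1, key, Measure.integral_compProd]
  · simp [F, integral_const_mul, h0]
  · refine ⟨hF.stronglyMeasurable.aestronglyMeasurable,
      HasFiniteIntegral.of_bounded (C := b * b') (ae_of_all _ fun q => ?_)⟩
    simp only [F, norm_mul]
    exact mul_le_mul (hWb _) (hfb _) (norm_nonneg _) ((norm_nonneg _).trans (hWb q.1))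

variable {Ω : Type*} [mΩ : MeasurableSpace Ω] {P : Measure Ω} [IsProbabilityMeasure P] {d : ℕ}
  {X : ℕ → Ω → Vec d} {κ : Kernel (Vec d) (Vec d)} [IsMarkovKernel κ]

/-- The Markov property integrated over an event of the past, moved from real numbers to `ℝ≥0∞`.
This is the rectangle identity that determines the joint law of the past and the next state. -/
lemma IsStationaryMarkov.measure_inter (hX : IsStationaryMarkov P X κ) (t : ℕ) {A : Set Ω}
    (hA : MeasurableSet[pastField X t] A) {B : Set (Vec d)} (hB : MeasurableSet B) :
    P (A ∩ X (t + 1) ⁻¹' B) = ∫⁻ ω in A, κ (X t ω) B ∂P := by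
  have hle := pastField_le hX.measurable t
  have hA' := hle _ hA
  have hBm : MeasurableSet (X (t + 1) ⁻¹' B) := hX.measurable _ hB
  have hint : Integrable ((X (t + 1) ⁻¹' B).indicator (fun _ => (1 : ℝ))) P :=
    (integrable_const 1).indicator hBm
  have h1 := setIntegral_condExp hle hint hA
  rw [setIntegral_congr_ae hA' ((hX.markov t B hB).mono fun ω h _ => h),
    setIntegral_indicator hBm] at h1
  simp only [integral_const, smul_eq_mul, mul_one, measureReal_restrict_apply MeasurableSet.univ,
    Set.univ_inter] at h1
  have hm : Measurable fun ω => κ (X t ω) B := (κ.measurable_coe hB).comp (hX.measurable t)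
  have h2 : ∫ ω in A, (κ (X t ω)).real B ∂P = (∫⁻ ω in A, κ (X t ω) B ∂P).toReal :=
    integral_toReal hm.aemeasurable (ae_of_all _ fun ω => measure_lt_top _ _)
  rw [h2, measureReal_def] at h1
  refine ((ENNReal.toReal_eq_toReal_iff' ?_ (measure_ne_top _ _)).1 h1).symm
  refine ((lintegral_mono (fun ω => prob_le_one)).trans_lt ?_).ne
  · simp

lemma IsStationaryMarkov.map_pair (hX : IsStationaryMarkov P X κ) (t : ℕ) :
    P.map (fun ω => (X t ω, X (t + 1) ω)) = (P.map (X 0)) ⊗ₘ κ := by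
  rw [← hX.stationary t]
  exact map_prodMk_eq_compProd P (hX.measurable t) (hX.measurable (t + 1)) κ
    fun A B hA hB => hX.measure_inter t (measurable_pastField X le_rfl hA) hB

omit [IsProbabilityMeasure P] [IsMarkovKernel κ] in
lemma IsStationaryMarkov.measurable_pair (hX : IsStationaryMarkov P X κ) (t : ℕ) :
    Measurable (fun ω => (X t ω, X (t + 1) ω)) :=
  (hX.measurable t).prodMk (hX.measurable (t + 1))

lemma IsStationaryMarkov.measurePreserving_pair (hX : IsStationaryMarkov P X κ) (t : ℕ) :
    MeasurePreserving (fun ω => (X t ω, X (t + 1) ω)) P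
      (P.map (fun ω => (X 0 ω, X 1 ω))) :=
  ⟨hX.measurable_pair t, by rw [hX.map_pair t, ← hX.map_pair 0]⟩

/-- Transitions centred under the kernel are martingale differences. -/
lemma IsStationaryMarkov.integral_mul_eq_zero (hX : IsStationaryMarkov P X κ) (t : ℕ)
    {W : Ω → ℂ} (hW : Measurable[pastField X t] W) {b : ℝ} (hWb : ∀ ω, ‖W ω‖ ≤ b)
    {h : Vec d × Vec d → ℂ} (hh : Measurable h) {b' : ℝ} (hhb : ∀ z, ‖h z‖ ≤ b')
    (h0 : ∀ x, ∫ y, h (x, y) ∂(κ x) = 0) :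
    ∫ ω, W ω * h (X t ω, X (t + 1) ω) ∂P = 0 := by
  have hle := pastField_le hX.measurable t
  have hXt : Measurable[pastField X t] (X t) := measurable_pastField X le_rfl
  -- The statistic is the identity from `Ω` with its full `σ`-field to `Ω` with the past `σ`-field;
  -- the explicit instances keep the two `σ`-fields apart.
  exact @integral_mul_eq_zero_of_kernel Ω Ω (Vec d) (Vec d) mΩ (pastField X t) _ _ P _ id
    (fun s hs => hle _ hs) (X (t + 1)) (hX.measurable _) (X t) hXt κ _
    (fun A B hA hB => hX.measure_inter t hA hB) W hW b hWb h hh b' hhb h0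

/-! ### The weak law of large numbers for transitions -/

/-- With truncated subtraction the exponent is `|t - s|`. The sum is covered by two geometric
series, one on each side of `t`; the term `s = t` is counted twice. -/
lemma sum_range_pow_sub_le {r : ℝ} (h0 : 0 ≤ r) (h1 : r < 1) (t n : ℕ) :
    ∑ s ∈ Finset.range n, r ^ ((t - s) + (s - t)) ≤ 2 / (1 - r) := by
  have hg : ∀ m, ∑ j ∈ Finset.range m, r ^ j ≤ (1 - r)⁻¹ := fun m => by
    rw [← tsum_geometric_of_lt_one h0 h1]
    exact (summable_geometric_of_lt_one h0 h1).sum_le_tsum _ fun j _ => pow_nonneg h0 j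
  calc ∑ s ∈ Finset.range n, r ^ ((t - s) + (s - t))
      ≤ ∑ s ∈ Finset.range (t + 1) ∪ Finset.Ico t n, r ^ ((t - s) + (s - t)) := by
        refine Finset.sum_le_sum_of_subset_of_nonneg (fun s hs => ?_) fun _ _ _ => pow_nonneg h0 _
        simp only [Finset.mem_union, Finset.mem_range, Finset.mem_Ico] at *
        omega
    _ ≤ ∑ s ∈ Finset.range (t + 1), r ^ ((t - s) + (s - t)) +
          ∑ s ∈ Finset.Ico t n, r ^ ((t - s) + (s - t)) := by
        rw [← Finset.sum_union_inter]
        exact le_add_of_nonneg_right (Finset.sum_nonneg fun _ _ => pow_nonneg h0 _)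
    _ = ∑ j ∈ Finset.range (t + 1), r ^ j + ∑ j ∈ Finset.range (n - t), r ^ j := by
        congr 1
        · rw [← Finset.sum_range_reflect]
          refine Finset.sum_congr rfl fun s hs => ?_
          rw [Finset.mem_range] at hs
          congr 1
          omega
        · rw [Finset.sum_Ico_eq_sum_range]
          refine Finset.sum_congr rfl fun s hs => ?_
          congr 1
          omega
    _ ≤ 2 / (1 - r) := by
        rw [div_eq_mul_inv, two_mul]
        exact add_le_add (hg _) (hg _)

/-- The transitions at times `t` and `t + k` with `k ≥ 2` are separated by a gap of `k - 1`, since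
the first already involves `X (t + 1)`; this costs the factor `exp l`. For `k ≤ 1` there is no gap,
and the trivial bound `1 ≤ exp (l - k l)` is absorbed by replacing `C` with `C + 1`. The constants
do not depend on the set `A`. -/
lemma exists_cov_bound (hX : IsStationaryMarkov P X κ) (hmix : ExpAlphaMixing P X) :
    ∃ C > (0 : ℝ), ∃ r : ℝ, 0 < r ∧ r < 1 ∧ ∀ A : Set (Vec d × Vec d), MeasurableSet A → ∀ t s : ℕ,
      |P.real ((fun ω => (X t ω, X (t + 1) ω)) ⁻¹' A ∩ (fun ω => (X s ω, X (s + 1) ω)) ⁻¹' A) -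
        (P.map (fun ω => (X 0 ω, X 1 ω))).real A ^ 2| ≤ C * r ^ ((t - s) + (s - t)) := by
  obtain ⟨C, hC, l, hl, H⟩ := hmix
  refine ⟨(C + 1) * Real.exp l, by positivity, Real.exp (-l), Real.exp_pos _, by simpa using hl,
    fun A hA => ?_⟩
  have hreal : ∀ t, P.real ((fun ω => (X t ω, X (t + 1) ω)) ⁻¹' A) =
      (P.map (fun ω => (X 0 ω, X 1 ω))).real A := fun t => by
    rw [← (hX.measurePreserving_pair t).map_eq, map_measureReal_apply (hX.measurable_pair t) hA]
  have main : ∀ t k : ℕ,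
      |P.real ((fun ω => (X t ω, X (t + 1) ω)) ⁻¹' A ∩
        (fun ω => (X (t + k) ω, X (t + k + 1) ω)) ⁻¹' A) -
        (P.map (fun ω => (X 0 ω, X 1 ω))).real A ^ 2| ≤
        (C + 1) * Real.exp l * Real.exp (-l) ^ k := by
    intro t k
    rw [← Real.exp_nat_mul, mul_assoc, ← Real.exp_add]
    rcases Nat.lt_or_ge k 2 with hk | hk
    · have : |P.real ((fun ω => (X t ω, X (t + 1) ω)) ⁻¹' A ∩
          (fun ω => (X (t + k) ω, X (t + k + 1) ω)) ⁻¹' A) -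
          (P.map (fun ω => (X 0 ω, X 1 ω))).real A ^ 2| ≤ 1 := by
        have : IsProbabilityMeasure (P.map (fun ω => (X 0 ω, X 1 ω))) :=
          Measure.isProbabilityMeasure_map (hX.measurable_pair 0).aemeasurable
        rw [abs_le]
        have h1 := measureReal_nonneg (μ := P.map (fun ω => (X 0 ω, X 1 ω))) (s := A)
        have h2 := measureReal_le_one (μ := P.map (fun ω => (X 0 ω, X 1 ω))) (s := A)
        have h3 := measureReal_nonneg (μ := P) (s := (fun ω => (X t ω, X (t + 1) ω)) ⁻¹' A ∩
          (fun ω => (X (t + k) ω, X (t + k + 1) ω)) ⁻¹' A)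
        have h4 := measureReal_le_one (μ := P) (s := (fun ω => (X t ω, X (t + 1) ω)) ⁻¹' A ∩
          (fun ω => (X (t + k) ω, X (t + k + 1) ω)) ⁻¹' A)
        constructor <;> nlinarith
      refine this.trans ?_
      have hk' : (k : ℝ) ≤ 1 := by exact_mod_cast Nat.lt_succ_iff.1 hk
      have : 1 ≤ Real.exp (l + k * -l) := Real.one_le_exp (by nlinarith)
      nlinarith
    · obtain ⟨j, rfl⟩ := Nat.exists_eq_add_of_le hk
      have := H (t + 1) (1 + j) (by omega) ((fun ω => (X t ω, X (t + 1) ω)) ⁻¹' A)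
        ((fun ω => (X (t + (2 + j)) ω, X (t + (2 + j) + 1) ω)) ⁻¹' A)
        (((measurable_pastField X (Nat.le_succ t)).prodMk (measurable_pastField X le_rfl)) hA)
        (((measurable_futureField X (by omega)).prodMk (measurable_futureField X (by omega))) hA)
      rw [hreal, hreal, ← sq] at this
      refine this.trans ?_
      have e : l + ((2 + j : ℕ) : ℝ) * -l = -l * ((1 + j : ℕ) : ℝ) := by push_cast; ring
      rw [e]
      nlinarith [Real.exp_pos (-l * ((1 + j : ℕ) : ℝ))]
  intro t s
  rcases le_total t s with h | h
  · obtain ⟨k, rfl⟩ := Nat.exists_eq_add_of_le h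
    have := main t k
    rwa [show t - (t + k) + (t + k - t) = k by omega]
  · obtain ⟨k, rfl⟩ := Nat.exists_eq_add_of_le h
    have := main s k
    rwa [Set.inter_comm, show s + k - s + (s - (s + k)) = k by omega]

/-- The sample mean of `F` over the first `n` transitions of the path `x`. -/
def avg {d : ℕ} {E : Type*} [AddCommMonoid E] [Module ℝ E] (n : ℕ) (F : Vec d × Vec d → E)
    (x : ℕ → Vec d) : E :=
  (n : ℝ)⁻¹ • ∑ t ∈ Finset.range n, F (x t, x (t + 1))

omit [IsProbabilityMeasure P] in
lemma integral_sub_mul_sub [IsProbabilityMeasure P] {f g : Ω → ℝ} (hf : Integrable f P)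
    (hg : Integrable g P) (hfg : Integrable (fun ω => f ω * g ω) P) (p : ℝ) :
    ∫ ω, (f ω - p) * (g ω - p) ∂P =
      ∫ ω, f ω * g ω ∂P - p * ∫ ω, f ω ∂P - p * ∫ ω, g ω ∂P + p ^ 2 := by
  have e : (fun ω => (f ω - p) * (g ω - p)) =
      fun ω => f ω * g ω - (p * f ω + p * g ω - p ^ 2) := by
    ext ω; ring
  have h1 : Integrable (fun ω => p * f ω + p * g ω) P := (hf.const_mul p).add (hg.const_mul p)
  have h2 : Integrable (fun ω => p * f ω + p * g ω - p ^ 2) P := h1.sub (integrable_const _)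
  rw [e, integral_sub hfg h2, integral_sub h1 (integrable_const _),
    integral_add (hf.const_mul p) (hg.const_mul p), integral_const_mul, integral_const_mul]
  simp
  ring

/-- Expanding the square gives a double sum of covariances. Each of the `n` rows is dominated by a
two-sided geometric series, so the variance grows at most linearly. -/
lemma integral_sq_sum_indicator_le (hX : IsStationaryMarkov P X κ) (hmix : ExpAlphaMixing P X) :
    ∃ C > (0 : ℝ), ∀ A : Set (Vec d × Vec d), MeasurableSet A → ∀ n : ℕ,
      ∫ ω, (∑ t ∈ Finset.range n, (((fun ω => (X t ω, X (t + 1) ω)) ⁻¹' A).indicator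
        (fun _ => (1 : ℝ)) ω - (P.map (fun ω => (X 0 ω, X 1 ω))).real A)) ^ 2 ∂P ≤ C * n := by
  obtain ⟨C, hC, r, hr0, hr1, H⟩ := exists_cov_bound hX hmix
  refine ⟨C * (2 / (1 - r)), mul_pos hC (div_pos two_pos (sub_pos.2 hr1)), fun A hA n => ?_⟩
  set p := (P.map (fun ω => (X 0 ω, X 1 ω))).real A with hp
  have hreal : ∀ t, P.real ((fun ω => (X t ω, X (t + 1) ω)) ⁻¹' A) = p := fun t => by
    rw [hp, ← (hX.measurePreserving_pair t).map_eq,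
      map_measureReal_apply (hX.measurable_pair t) hA]
  have hm : ∀ t, MeasurableSet ((fun ω => (X t ω, X (t + 1) ω)) ⁻¹' A) :=
    fun t => hX.measurable_pair t hA
  have hi : ∀ t, Integrable (((fun ω => (X t ω, X (t + 1) ω)) ⁻¹' A).indicator
      (fun _ => (1 : ℝ))) P := fun t => (integrable_const 1).indicator (hm t)
  have hcov : ∀ t s, ∫ ω, (((fun ω => (X t ω, X (t + 1) ω)) ⁻¹' A).indicator (fun _ => (1 : ℝ)) ω - p)
      * (((fun ω => (X s ω, X (s + 1) ω)) ⁻¹' A).indicator (fun _ => (1 : ℝ)) ω - p) ∂P =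
      P.real ((fun ω => (X t ω, X (t + 1) ω)) ⁻¹' A ∩ (fun ω => (X s ω, X (s + 1) ω)) ⁻¹' A)
        - p ^ 2 := fun t s => by
    have hmul : ∀ ω, ((fun ω => (X t ω, X (t + 1) ω)) ⁻¹' A).indicator (fun _ => (1 : ℝ)) ω *
        ((fun ω => (X s ω, X (s + 1) ω)) ⁻¹' A).indicator (fun _ => (1 : ℝ)) ω =
        ((fun ω => (X t ω, X (t + 1) ω)) ⁻¹' A ∩
          (fun ω => (X s ω, X (s + 1) ω)) ⁻¹' A).indicator (fun _ => (1 : ℝ)) ω := fun ω => by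
      rw [← Set.inter_indicator_mul]; simp
    have hi2 : Integrable (((fun ω => (X t ω, X (t + 1) ω)) ⁻¹' A ∩
        (fun ω => (X s ω, X (s + 1) ω)) ⁻¹' A).indicator (fun _ => (1 : ℝ))) P :=
      (integrable_const 1).indicator ((hm t).inter (hm s))
    rw [integral_sub_mul_sub (hi t) (hi s) (hi2.congr (ae_of_all _ fun ω => (hmul ω).symm))]
    simp_rw [hmul]
    rw [integral_indicator_const _ (hm t), integral_indicator_const _ (hm s),
      integral_indicator_const _ ((hm t).inter (hm s)), hreal, hreal]
    simp
    ring
  have hint : ∀ t s, Integrable (fun ω =>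
      (((fun ω => (X t ω, X (t + 1) ω)) ⁻¹' A).indicator (fun _ => (1 : ℝ)) ω - p)
      * (((fun ω => (X s ω, X (s + 1) ω)) ⁻¹' A).indicator (fun _ => (1 : ℝ)) ω - p)) P := by
    intro t s
    refine Integrable.bdd_mul (c := 1 + |p|) ((hi s).sub (integrable_const p))
      ((hi t).sub (integrable_const p)).aestronglyMeasurable (ae_of_all _ fun ω => ?_)
    refine (norm_sub_le _ _).trans (add_le_add ?_ le_rfl)
    exact (norm_indicator_le_norm_self _ _).trans (by simp)
  simp_rw [sq (∑ t ∈ Finset.range n, _), Finset.sum_mul_sum]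
  rw [integral_finsetSum _ fun t _ => integrable_finsetSum _ fun s _ => hint t s]
  calc _ ≤ ∑ t ∈ Finset.range n, ∑ s ∈ Finset.range n, C * r ^ ((t - s) + (s - t)) := by
        refine Finset.sum_le_sum fun t _ => ?_
        rw [integral_finsetSum _ fun s _ => hint t s]
        refine Finset.sum_le_sum fun s _ => ?_
        rw [hcov]
        exact (le_abs_self _).trans (H A hA t s)
    _ ≤ ∑ t ∈ Finset.range n, C * (2 / (1 - r)) := by
        refine Finset.sum_le_sum fun t _ => ?_
        rw [← Finset.mul_sum]
        exact mul_le_mul_of_nonneg_left (sum_range_pow_sub_le hr0.le hr1 t n) hC.le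
    _ = _ := by simp; ring

/-! ### Banach space valued averages: from indicators to integrable functions. -/

variable {E : Type*} [NormedAddCommGroup E] [NormedSpace ℝ E]

/-- By stationarity every summand has the same `L¹` norm, so averaging along the path is a
contraction of `L¹`. -/
lemma lintegral_enorm_avg_le (hX : IsStationaryMarkov P X κ) {F : Vec d × Vec d → E}
    (hF : AEStronglyMeasurable F (P.map (fun ω => (X 0 ω, X 1 ω)))) (n : ℕ) :
    ∫⁻ ω, ‖avg n F (fun t => X t ω)‖ₑ ∂P ≤
      ∫⁻ z, ‖F z‖ₑ ∂(P.map (fun ω => (X 0 ω, X 1 ω))) := by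
  have hm : ∀ t, AEMeasurable (fun ω => ‖F (X t ω, X (t + 1) ω)‖ₑ) P := fun t =>
    (hF.comp_measurePreserving (hX.measurePreserving_pair t)).enorm
  have ht : ∀ t, ∫⁻ ω, ‖F (X t ω, X (t + 1) ω)‖ₑ ∂P =
      ∫⁻ z, ‖F z‖ₑ ∂(P.map (fun ω => (X 0 ω, X 1 ω))) := fun t => by
    rw [← (hX.measurePreserving_pair t).map_eq, lintegral_map' _
      (hX.measurable_pair t).aemeasurable]
    rw [(hX.measurePreserving_pair t).map_eq]
    exact hF.enorm
  calc ∫⁻ ω, ‖avg n F (fun t => X t ω)‖ₑ ∂P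
      ≤ ∫⁻ ω, ‖(n : ℝ)⁻¹‖ₑ * ∑ t ∈ Finset.range n, ‖F (X t ω, X (t + 1) ω)‖ₑ ∂P := by
        refine lintegral_mono fun ω => ?_
        rw [avg, enorm_smul]
        gcongr
        exact enorm_sum_le _ _
    _ = ‖(n : ℝ)⁻¹‖ₑ * (n * ∫⁻ z, ‖F z‖ₑ ∂(P.map (fun ω => (X 0 ω, X 1 ω)))) := by
        rw [lintegral_const_mul'' _ (Finset.aemeasurable_fun_sum _ fun t _ => hm t),
          lintegral_finsetSum' _ fun t _ => hm t]
        simp [ht]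
    _ ≤ _ := by
        rw [← mul_assoc]
        refine mul_le_of_le_one_left zero_le ?_
        rcases Nat.eq_zero_or_pos n with rfl | hn
        · simp
        · rw [enorm_inv (by positivity)]
          simp [ENNReal.inv_mul_cancel, hn.ne']

/-- The contraction property makes the `L¹` deviation from the mean stable under perturbation of the
function: one copy of the distance comes from the averages and one from the means. This is what
closes the law of large numbers under `L¹` limits. -/
lemma lintegral_avg_sub_le (hX : IsStationaryMarkov P X κ) {F G : Vec d × Vec d → E}
    (hF : Integrable F (P.map (fun ω => (X 0 ω, X 1 ω))))
    (hG : Integrable G (P.map (fun ω => (X 0 ω, X 1 ω)))) (n : ℕ) :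
    ∫⁻ ω, ‖avg n F (fun t => X t ω) - ∫ z, F z ∂(P.map (fun ω => (X 0 ω, X 1 ω)))‖ₑ ∂P ≤
      ∫⁻ ω, ‖avg n G (fun t => X t ω) - ∫ z, G z ∂(P.map (fun ω => (X 0 ω, X 1 ω)))‖ₑ ∂P +
      2 * ∫⁻ z, ‖F z - G z‖ₑ ∂(P.map (fun ω => (X 0 ω, X 1 ω))) := by
  have : IsProbabilityMeasure (P.map (fun ω => (X 0 ω, X 1 ω))) :=
    Measure.isProbabilityMeasure_map (hX.measurable_pair 0).aemeasurable
  have hm : AEMeasurable (fun ω => ‖avg n (F - G) (fun t => X t ω)‖ₑ) P := by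
    refine AEStronglyMeasurable.enorm (AEStronglyMeasurable.const_smul ?_ _)
    exact Finset.aestronglyMeasurable_fun_sum _ fun t _ => 
      ((hF.sub hG).1.comp_measurePreserving (hX.measurePreserving_pair t))
  calc _ ≤ ∫⁻ ω, (‖avg n (F - G) (fun t => X t ω)‖ₑ +
        (‖avg n G (fun t => X t ω) - ∫ z, G z ∂(P.map (fun ω => (X 0 ω, X 1 ω)))‖ₑ +
          ∫⁻ z, ‖F z - G z‖ₑ ∂(P.map (fun ω => (X 0 ω, X 1 ω))))) ∂P := by
        refine lintegral_mono fun ω => ?_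
        have e : avg n F (fun t => X t ω) - ∫ z, F z ∂(P.map (fun ω => (X 0 ω, X 1 ω))) =
            avg n (F - G) (fun t => X t ω) + ((avg n G (fun t => X t ω) -
            ∫ z, G z ∂(P.map (fun ω => (X 0 ω, X 1 ω)))) -
            ∫ z, F z - G z ∂(P.map (fun ω => (X 0 ω, X 1 ω)))) := by
          rw [integral_sub hF hG]
          simp only [avg, Pi.sub_apply, Finset.sum_sub_distrib, smul_sub]
          abel
        rw [e]
        refine (enorm_add_le _ _).trans (add_le_add le_rfl ?_)
        exact enorm_sub_le.trans (add_le_add le_rfl (enorm_integral_le_lintegral_enorm _))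
    _ ≤ _ := by
        rw [lintegral_add_left' hm, lintegral_add_right _ measurable_const, two_mul]
        have := lintegral_enorm_avg_le hX (hF.sub hG).1 n
        simp only [Pi.sub_apply] at this
        simp only [lintegral_const, measure_univ, mul_one]
        rw [add_comm]
        rw [add_assoc]
        gcongr

/-- The law of large numbers in `L¹` for Banach space valued functions of the transitions. -/
theorem tendsto_lintegral_avg_sub (hX : IsStationaryMarkov P X κ) (hmix : ExpAlphaMixing P X)
    [CompleteSpace E] {F : Vec d × Vec d → E}
    (hF : Integrable F (P.map (fun ω => (X 0 ω, X 1 ω)))) :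
    Tendsto (fun n : ℕ => ∫⁻ ω, ‖avg n F (fun t => X t ω) -
      ∫ z, F z ∂(P.map (fun ω => (X 0 ω, X 1 ω)))‖ₑ ∂P) atTop (𝓝 0) := by
  have hprob : IsProbabilityMeasure (P.map (fun ω => (X 0 ω, X 1 ω))) :=
    Measure.isProbabilityMeasure_map (hX.measurable_pair 0).aemeasurable
  refine Integrable.induction (μ := P.map (fun ω => (X 0 ω, X 1 ω))) (fun F : Vec d × Vec d → E =>
    Tendsto (fun n : ℕ => ∫⁻ ω, ‖avg n F (fun t => X t ω) -
      ∫ z, F z ∂(P.map (fun ω => (X 0 ω, X 1 ω)))‖ₑ ∂P) atTop (𝓝 0)) ?_ ?_ ?_ ?_ hF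
  · intro c A hA _
    obtain ⟨C, hC, H⟩ := integral_sq_sum_indicator_le hX hmix
    set p := (P.map (fun ω => (X 0 ω, X 1 ω))).real A with hp
    set S : ℕ → Ω → ℝ := fun n ω => ∑ t ∈ Finset.range n,
      (((fun ω => (X t ω, X (t + 1) ω)) ⁻¹' A).indicator (fun _ => (1 : ℝ)) ω - p) with hS
    have hSm : ∀ n, Measurable (S n) := fun n => Finset.measurable_fun_sum _ fun t _ =>
      (measurable_const.indicator (hX.measurable_pair t hA)).sub measurable_const
    have hSb : ∀ n ω, ‖S n ω‖ ≤ n * (1 + |p|) := fun n ω => by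
      refine (norm_sum_le _ _).trans ?_
      refine (Finset.sum_le_card_nsmul _ _ (1 + |p|) fun t _ => ?_).trans (by simp [mul_add])
      refine (norm_sub_le _ _).trans (add_le_add ?_ le_rfl)
      exact (norm_indicator_le_norm_self _ _).trans (by simp)
    have hSi : ∀ n, Integrable (S n) P := fun n =>
      Integrable.of_bound (hSm n).aestronglyMeasurable _ (ae_of_all _ (hSb n))
    have hSi2 : ∀ n, Integrable (fun ω => S n ω ^ 2) P := fun n =>
      Integrable.of_bound ((hSm n).pow_const 2).aestronglyMeasurable ((n * (1 + |p|)) ^ 2)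
        (ae_of_all _ fun ω => by rw [norm_pow]; gcongr; exact hSb n ω)
    have hbound : ∀ n : ℕ, 1 ≤ n → ∫⁻ ω, ‖avg n (A.indicator fun _ => c) (fun t => X t ω) -
        ∫ z, A.indicator (fun _ => c) z ∂(P.map (fun ω => (X 0 ω, X 1 ω)))‖ₑ ∂P ≤
        ENNReal.ofReal ((1 + C) * (Real.sqrt n)⁻¹ * ‖c‖) := by
      intro n hn
      have hn0 : (0 : ℝ) < n := by exact_mod_cast hn
      have e : ∀ ω, avg n (A.indicator fun _ => c) (fun t => X t ω) -
          ∫ z, A.indicator (fun _ => c) z ∂(P.map (fun ω => (X 0 ω, X 1 ω))) =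
          ((n : ℝ)⁻¹ * S n ω) • c := fun ω => by
        rw [integral_indicator_const _ hA, avg, hS, mul_smul]
        simp only [Finset.sum_sub_distrib, Finset.sum_const, Finset.card_range, sub_smul, smul_sub,
          nsmul_eq_mul]
        rw [smul_smul (n : ℝ)⁻¹ (n * p), inv_mul_cancel_left₀ hn0.ne', Finset.sum_smul]
        congr 2
        refine Finset.sum_congr rfl fun t _ => ?_
        by_cases h : (X t ω, X (t + 1) ω) ∈ A <;> simp [h]
      simp_rw [e]
      have hi : Integrable (fun ω => ((n : ℝ)⁻¹ * S n ω) • c) P :=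
        ((hSi n).const_mul _).smul_const c
      rw [← ofReal_integral_norm_eq_lintegral_enorm hi]
      refine ENNReal.ofReal_le_ofReal ?_
      simp_rw [norm_smul]
      rw [integral_mul_const]
      refine mul_le_mul_of_nonneg_right ?_ (norm_nonneg c)
      have hs : 0 < Real.sqrt n := Real.sqrt_pos.2 hn0
      have hss : Real.sqrt n * Real.sqrt n = n := Real.mul_self_sqrt hn0.le
      -- The inequality `y ≤ 1/√n + √n y²` stands in for Cauchy–Schwarz: it trades the first moment
      -- for the second, which is at most `C / n`.
      calc ∫ ω, ‖(n : ℝ)⁻¹ * S n ω‖ ∂P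
          ≤ ∫ ω, ((Real.sqrt n)⁻¹ + Real.sqrt n * ((n : ℝ)⁻¹ ^ 2 * S n ω ^ 2)) ∂P := by
            refine integral_mono ((hSi n).const_mul _).norm ((integrable_const _).add
              (((hSi2 n).const_mul _).const_mul _)) fun ω => ?_
            dsimp only
            rw [← mul_pow, Real.norm_eq_abs, ← sq_abs]
            set y := |(n : ℝ)⁻¹ * S n ω|
            have h1 : 0 ≤ ((Real.sqrt n)⁻¹ - y) ^ 2 * Real.sqrt n := by positivity
            have h2 : ((Real.sqrt n)⁻¹ - y) ^ 2 * Real.sqrt n =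
              (Real.sqrt n)⁻¹ - 2 * y + Real.sqrt n * y ^ 2 := by field_simp; ring
            have h3 : 0 ≤ y := abs_nonneg _
            linarith
        _ = (Real.sqrt n)⁻¹ + Real.sqrt n * ((n : ℝ)⁻¹ ^ 2 * ∫ ω, S n ω ^ 2 ∂P) := by
            rw [integral_add (integrable_const _) (((hSi2 n).const_mul _).const_mul _),
              integral_const_mul, integral_const_mul]
            simp
        _ ≤ (Real.sqrt n)⁻¹ + Real.sqrt n * ((n : ℝ)⁻¹ ^ 2 * (C * n)) := by
            gcongr
            exact H A hA n
        _ = (1 + C) * (Real.sqrt n)⁻¹ := by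
            rw [add_mul, one_mul]
            congr 1
            nth_rewrite 2 3 [← hss]
            field_simp
    refine tendsto_of_tendsto_of_tendsto_of_le_of_le' tendsto_const_nhds ?_
      (Eventually.of_forall fun _ => zero_le) ((eventually_ge_atTop 1).mono hbound)
    rw [← ENNReal.ofReal_zero]
    refine ENNReal.tendsto_ofReal ?_
    have : Tendsto (fun n : ℕ => (Real.sqrt n)⁻¹) atTop (𝓝 0) :=
      tendsto_inv_atTop_zero.comp (Real.tendsto_sqrt_atTop.comp tendsto_natCast_atTop_atTop)
    simpa using (this.const_mul (1 + C)).mul_const ‖c‖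
  · intro F G _ hF hG h1 h2
    refine tendsto_of_tendsto_of_tendsto_of_le_of_le tendsto_const_nhds
      (by simpa using h1.add h2) (fun _ => zero_le) fun n => ?_
    have hm : AEMeasurable (fun ω => ‖avg n F (fun t => X t ω) -
        ∫ z, F z ∂(P.map (fun ω => (X 0 ω, X 1 ω)))‖ₑ) P := by
      refine AEStronglyMeasurable.enorm (AEStronglyMeasurable.sub
        (AEStronglyMeasurable.const_smul ?_ _) aestronglyMeasurable_const)
      exact Finset.aestronglyMeasurable_fun_sum _ fun t _ =>
        (hF.1.comp_measurePreserving (hX.measurePreserving_pair t))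
    dsimp only
    rw [← lintegral_add_left' hm]
    refine lintegral_mono fun ω => ?_
    rw [integral_add' hF hG]
    refine le_trans (le_of_eq ?_) (enorm_add_le _ _)
    congr 1
    simp only [avg, Pi.add_apply, Finset.sum_add_distrib, smul_add]
    abel
  -- Approximation within `ε / 4` suffices because the perturbation bound doubles the distance: `ε /
  -- 2 + 2 (ε / 4) = ε`.
  · refine isClosed_of_closure_subset fun f hf => ?_
    rw [Set.mem_ofPred_eq, ENNReal.tendsto_nhds_zero]
    intro ε hε
    obtain ⟨g, hg, hfg⟩ := EMetric.mem_closure_iff.1 hf (ε / 4) (ENNReal.div_pos hε.ne' (by simp))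
    rw [Lp.edist_def, eLpNorm_one_eq_lintegral_enorm] at hfg
    have hg' := ENNReal.tendsto_nhds_zero.1 hg (ε / 2) (ENNReal.half_pos hε.ne')
    filter_upwards [hg'] with n hn
    refine (lintegral_avg_sub_le hX (L1.integrable_coeFn f) (L1.integrable_coeFn g) n).trans ?_
    calc _ ≤ ε / 2 + 2 * (ε / 4) := add_le_add hn (mul_le_mul_right (le_of_lt hfg) _)
      _ = ε := by
        rw [show (4 : ℝ≥0∞) = 2 * 2 by norm_num, ENNReal.div_eq_inv_mul (b := 2 * 2),
          ENNReal.mul_inv (by simp) (by simp), ← mul_assoc, ← mul_assoc, ENNReal.mul_inv_cancel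
            (by simp) (by simp), one_mul, ← ENNReal.div_eq_inv_mul, ENNReal.add_halves]
  · intro F G hFG hF h
    refine tendsto_of_tendsto_of_tendsto_of_le_of_le tendsto_const_nhds h (fun _ => zero_le)
      fun n => ?_
    refine (lintegral_avg_sub_le hX (hF.congr hFG) hF n).trans (le_of_eq ?_)
    have : ∫⁻ z, ‖G z - F z‖ₑ ∂(P.map (fun ω => (X 0 ω, X 1 ω))) = 0 := by
      refine lintegral_eq_zero_of_ae_eq_zero (hFG.mono fun z hz => ?_)
      simp [hz]
    rw [this, mul_zero, add_zero]

/-- The weak law of large numbers for Banach space valued functions of the transitions. -/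
theorem tendsto_measure_avg_sub (hX : IsStationaryMarkov P X κ) (hmix : ExpAlphaMixing P X)
    [CompleteSpace E] {F : Vec d × Vec d → E}
    (hF : Integrable F (P.map (fun ω => (X 0 ω, X 1 ω)))) {ε : ℝ}
    (hε : 0 < ε) :
    Tendsto (fun n : ℕ => P {ω | ε ≤ ‖avg n F (fun t => X t ω) -
      ∫ z, F z ∂(P.map (fun ω => (X 0 ω, X 1 ω)))‖}) atTop (𝓝 0) := by
  have h := tendsto_lintegral_avg_sub hX hmix hF
  have h2 : Tendsto (fun n : ℕ => (∫⁻ ω, ‖avg n F (fun t => X t ω) -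
      ∫ z, F z ∂(P.map (fun ω => (X 0 ω, X 1 ω)))‖ₑ ∂P) / ENNReal.ofReal ε) atTop (𝓝 0) := by
    simpa using ENNReal.Tendsto.div_const h (b := ENNReal.ofReal ε) (Or.inr (by simpa using hε))
  refine tendsto_of_tendsto_of_tendsto_of_le_of_le tendsto_const_nhds h2 (fun _ => zero_le)
    fun n => ?_
  have hm : AEMeasurable (fun ω => ‖avg n F (fun t => X t ω) -
      ∫ z, F z ∂(P.map (fun ω => (X 0 ω, X 1 ω)))‖ₑ) P := by
    refine AEStronglyMeasurable.enorm (AEStronglyMeasurable.sub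
      (AEStronglyMeasurable.const_smul ?_ _) aestronglyMeasurable_const)
    exact Finset.aestronglyMeasurable_fun_sum _ fun t _ =>
      (hF.1.comp_measurePreserving (hX.measurePreserving_pair t))
  refine le_trans (measure_mono fun ω hω => ?_) (meas_ge_le_lintegral_div hm
    (by simpa using hε) ENNReal.ofReal_ne_top)
  rw [Set.mem_ofPred_eq] at hω ⊢
  rw [← ofReal_norm]
  exact ENNReal.ofReal_le_ofReal hω

end CCFEL
end

noncomputable section

namespace CCFEL

/-! ### Random continuous functions -/

section ContinuousMapMeasurability

variable {α K E : Type*} [MeasurableSpace α] [TopologicalSpace K] [CompactSpace K]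
  [SecondCountableTopology K] [LocallyCompactSpace K] [NormedAddCommGroup E]
  [SecondCountableTopology E] [MeasurableSpace E] [BorelSpace E]

/-- In a second countable space every open set is a countable union of balls, and the preimage of a
ball is a sublevel set of a distance function. -/
lemma measurable_of_measurable_dist {M : Type*} [PseudoMetricSpace M] [SecondCountableTopology M]
    [MeasurableSpace M] [BorelSpace M] {F : α → M} (h : ∀ y, Measurable fun x => dist (F x) y) :
    Measurable F := by
  refine measurable_of_isOpen fun U hU => ?_
  obtain ⟨T, hT, hTU⟩ := TopologicalSpace.isOpen_iUnion_countable
    (fun p : {p : M × ℝ // Metric.ball p.1 p.2 ⊆ U} => Metric.ball p.1.1 p.1.2)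
    (fun _ => Metric.isOpen_ball)
  have e : U = ⋃ p ∈ T, Metric.ball p.1.1 p.1.2 := by
    rw [hTU]
    refine Set.Subset.antisymm (fun x hx => ?_) (Set.iUnion_subset fun p => p.2)
    obtain ⟨r, hr, hrU⟩ := Metric.isOpen_iff.1 hU x hx
    exact Set.mem_iUnion.2 ⟨⟨(x, r), hrU⟩, Metric.mem_ball_self hr⟩
  rw [e, Set.preimage_iUnion₂]
  refine MeasurableSet.biUnion hT fun p _ => ?_
  exact (h p.1.1) measurableSet_Iio

/-- By continuity, a sup-norm distance is at most `r` as soon as the pointwise distances are at most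
`r` on a countable dense set. -/
lemma ContinuousMap.measurable_of_eval [MeasurableSpace C(K, E)] [BorelSpace C(K, E)]
    {F : α → C(K, E)} {s : Set K} (hs : s.Countable) (hd : Dense s)
    (h : ∀ k ∈ s, Measurable fun x => F x k) : Measurable F := by
  refine measurable_of_measurable_dist fun g => measurable_of_Iic fun r => ?_
  rcases lt_or_ge r 0 with hr | hr
  · convert! MeasurableSet.empty
    ext x
    simpa using hr.trans_le dist_nonneg
  have e : (fun x => dist (F x) g) ⁻¹' Set.Iic r = ⋂ k ∈ s, {x | dist (F x k) (g k) ≤ r} := by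
    ext x
    simp only [Set.mem_preimage, Set.mem_Iic, Set.mem_iInter, Set.mem_ofPred_eq]
    rw [ContinuousMap.dist_le hr]
    refine ⟨fun H k _ => H k, fun H k => ?_⟩
    have hc : IsClosed {k | dist (F x k) (g k) ≤ r} :=
      isClosed_le ((F x).continuous.dist g.continuous) continuous_const
    exact hc.closure_subset_iff.2 (fun k hk => H k hk) (hd k)
  rw [e]
  exact MeasurableSet.biInter hs fun k hk => ((h k hk).dist measurable_const) measurableSet_Iic

/-- Only countably many evaluations matter, so off a single measurable null set all of them agree
with their measurable versions. Setting the random function to zero on that set leaves measurable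
evaluations on the dense set. -/
lemma ContinuousMap.aestronglyMeasurable_of_eval {μ : Measure α} {F : α → C(K, E)}
    (h : ∀ k, AEMeasurable (fun x => F x k) μ) : AEStronglyMeasurable F μ := by
  let _ : MeasurableSpace C(K, E) := borel _
  have : BorelSpace C(K, E) := ⟨rfl⟩
  obtain ⟨s, hs, hd⟩ := TopologicalSpace.exists_countable_dense K
  refine AEMeasurable.aestronglyMeasurable ?_
  have hall : ∀ᵐ x ∂μ, ∀ k ∈ s, F x k = (h k).mk _ x :=
    (ae_ball_iff hs).2 fun k _ => (h k).ae_eq_mk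
  obtain ⟨N, hN, hNm, hN0⟩ := exists_measurable_superset_of_null hall
  refine ⟨Nᶜ.indicator F, ContinuousMap.measurable_of_eval hs hd fun k hk => ?_, ?_⟩
  · have e : (fun x => (Nᶜ.indicator F x) k) = Nᶜ.indicator ((h k).mk _) := by
      ext x
      by_cases hx : x ∈ N
      · simp [hx]
      · rw [Set.indicator_of_mem (by exact hx), Set.indicator_of_mem (by exact hx)]
        by_contra hne
        exact hx (hN (by simpa using ⟨k, hk, hne⟩))
    rw [e]
    exact (h k).measurable_mk.indicator hNm.compl
  · filter_upwards [measure_eq_zero_iff_ae_notMem.1 hN0] with x hx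
    rw [Set.indicator_of_mem (by exact hx)]

end ContinuousMapMeasurability

variable {Ω : Type*} [mΩ : MeasurableSpace Ω] {P : Measure Ω} [IsProbabilityMeasure P] {d : ℕ}
  {X : ℕ → Ω → Vec d} {κ : Kernel (Vec d) (Vec d)} [IsMarkovKernel κ]

/-- The uniform weak law of large numbers over a compact set, for functions of the transitions that
are continuous in the parameter and have an integrable envelope. -/
theorem exists_uniform_lln (hX : IsStationaryMarkov P X κ) (hmix : ExpAlphaMixing P X)
    {T E : Type*} [TopologicalSpace T] [SecondCountableTopology T] [T2Space T]
    [NormedAddCommGroup E] [NormedSpace ℝ E] [CompleteSpace E] [SecondCountableTopology E]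
    [MeasurableSpace E] [BorelSpace E]
    {K : Set T} (hK : IsCompact K) {f : T → Vec d × Vec d → E} {M : Vec d × Vec d → ℝ}
    (hM : Integrable M (P.map (fun ω => (X 0 ω, X 1 ω))))
    (hfm : ∀ k ∈ K, AEMeasurable (f k) (P.map (fun ω => (X 0 ω, X 1 ω))))
    (hfc : ∀ᵐ z ∂(P.map (fun ω => (X 0 ω, X 1 ω))), ContinuousOn (fun k => f k z) K)
    (hfM : ∀ᵐ z ∂(P.map (fun ω => (X 0 ω, X 1 ω))), ∀ k ∈ K, ‖f k z‖ ≤ M z) :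
    ContinuousOn (fun k => ∫ z, f k z ∂(P.map (fun ω => (X 0 ω, X 1 ω)))) K ∧
    ∀ ε > 0, Tendsto (fun n : ℕ => P {ω | ¬ ∀ k ∈ K, ‖avg n (f k) (fun t => X t ω) -
      ∫ z, f k z ∂(P.map (fun ω => (X 0 ω, X 1 ω)))‖ < ε}) atTop (𝓝 0) := by
  have : CompactSpace K := isCompact_iff_compactSpace.1 hK
  -- The map `k ↦ f k z` is one random element of a Banach space of continuous functions, where the
  -- norm law of large numbers is the uniform one. The default value `0` is taken only at the null
  -- set of `z` where continuity on `K` fails.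
  let F : Vec d × Vec d → C(K, E) := fun z => ContinuousMap.mkD (K.domRestrict fun k => f k z) 0
  have hFe : ∀ᵐ z ∂(P.map (fun ω => (X 0 ω, X 1 ω))), ∀ k : K, F z k = f k z := by
    filter_upwards [hfc] with z hz k
    rw [ContinuousMap.mkD_apply_of_continuous (continuousOn_iff_continuous_domRestrict.1 hz)]
    rfl
  have hFi : Integrable F (P.map (fun ω => (X 0 ω, X 1 ω))) := by
    refine ⟨ContinuousMap.aestronglyMeasurable_of_eval fun k => ?_,
      ContinuousMap.hasFiniteIntegral_of_bound _ M hM.2 ?_⟩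
    · exact (hfm k k.2).congr (hFe.mono fun z hz => (hz k).symm)
    · filter_upwards [hFe, hfM] with z h1 h2 k
      rw [h1]
      exact h2 k k.2
  have hint : ∀ k : K, (∫ z, F z ∂(P.map (fun ω => (X 0 ω, X 1 ω)))) k =
      ∫ z, f k z ∂(P.map (fun ω => (X 0 ω, X 1 ω))) := fun k => by
    rw [ContinuousMap.integral_apply hFi]
    exact integral_congr_ae (hFe.mono fun z hz => hz k)
  constructor
  · rw [continuousOn_iff_continuous_domRestrict]
    refine (∫ z, F z ∂(P.map (fun ω => (X 0 ω, X 1 ω)))).continuous.congr fun k => ?_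
    rw [hint]
    rfl
  · intro ε hε
    refine tendsto_of_tendsto_of_tendsto_of_le_of_le tendsto_const_nhds
      (tendsto_measure_avg_sub hX hmix hFi hε) (fun _ => zero_le) fun n => ?_
    refine measure_mono_ae ?_
    -- The exceptional null set concerns one transition; by stationarity it can be excluded for all
    -- times at once.
    have hall : ∀ᵐ ω ∂P, ∀ t : ℕ, ∀ k : K, F (X t ω, X (t + 1) ω) k = f k (X t ω, X (t + 1) ω) :=
      ae_all_iff.2 fun t => (hX.measurePreserving_pair t).quasiMeasurePreserving.ae hFe
    filter_upwards [hall] with ω hω hbad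
    by_contra hlt
    refine hbad fun k hk => ?_
    have hlt' := lt_of_not_ge hlt
    rw [ContinuousMap.norm_lt_iff _ hε] at hlt'
    have := hlt' ⟨k, hk⟩
    rw [ContinuousMap.sub_apply, hint] at this
    have e : (avg n F fun t => X t ω) ⟨k, hk⟩ = avg n (f k) fun t => X t ω := by
      simp only [avg, ContinuousMap.smul_apply, ContinuousMap.sum_apply, hω]
    rwa [e] at this

end CCFEL
end

noncomputable section

namespace CCFEL

/-! ### A martingale central limit theorem -/

/-- The second order expansion of `log (1 + i x)` with a cubic remainder, exponentiated. This is the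
starting point of McLeish's method: the factor `1 + i x` is linear in `x`, so products of such
factors respect the martingale property. -/
lemma exists_exp_I_mul_eq {x : ℝ} (hx : |x| ≤ 1 / 2) :
    ∃ r : ℂ, ‖r‖ ≤ |x| ^ 3 ∧
      Complex.exp (x * Complex.I) = (1 + x * Complex.I) * Complex.exp (-(x ^ 2 : ℝ) / 2 + r) := by
  have hn : ‖(x * Complex.I : ℂ)‖ = |x| := by simp
  have hlt : ‖(x * Complex.I : ℂ)‖ < 1 := by rw [hn]; linarith
  refine ⟨-(Complex.log (1 + x * Complex.I) - Complex.logTaylor 3 (x * Complex.I)), ?_, ?_⟩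
  · rw [norm_neg]
    refine (Complex.norm_log_sub_logTaylor_le 2 hlt).trans ?_
    rw [hn]
    have h1 : (1 - |x|)⁻¹ ≤ 2 := by
      rw [inv_le_comm₀ (by linarith) two_pos]; linarith
    have h2 : 0 ≤ |x| ^ 3 := by positivity
    norm_num
    nlinarith
  · have hne : (1 + x * Complex.I : ℂ) ≠ 0 := fun h => by
      have := congrArg Complex.re h
      simp at this
    rw [← Complex.exp_log hne, ← Complex.exp_add, Complex.exp_log hne]
    congr 1
    simp only [Complex.logTaylor, Finset.sum_range_succ, Finset.sum_range_zero]
    push_cast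
    ring_nf
    rw [Complex.I_sq]
    ring

lemma norm_one_add_mul_I_le (x : ℝ) : ‖(1 + x * Complex.I : ℂ)‖ ≤ Real.exp (x ^ 2 / 2) := by
  refine abs_le_of_sq_le_sq' ?_ (Real.exp_pos _).le |>.2
  rw [← Complex.normSq_eq_norm_sq, ← Real.exp_nat_mul]
  have : Complex.normSq (1 + x * Complex.I) = 1 + x ^ 2 := by
    simp [Complex.normSq_apply]; ring
  rw [this]
  have := Real.add_one_le_exp (x ^ 2)
  rw [show ((2 : ℕ) : ℝ) * (x ^ 2 / 2) = x ^ 2 by push_cast; ring]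
  linarith

lemma norm_exp_sub_exp_le {a b : ℂ} {c : ℝ} (ha : a.re ≤ c) (hb : b.re ≤ c) :
    ‖Complex.exp a - Complex.exp b‖ ≤ Real.exp c * ‖a - b‖ := by
  refine (convex_halfSpace_re_le c).norm_image_sub_le_of_norm_hasDerivWithin_le
    (f' := Complex.exp) (fun z _ => (Complex.hasDerivAt_exp z).hasDerivWithinAt) (fun z hz => ?_)
    hb ha
  rw [Complex.norm_exp]
  exact Real.exp_le_exp.2 hz

variable {Ω : Type*} [mΩ : MeasurableSpace Ω] {P : Measure Ω} [IsProbabilityMeasure P] {d : ℕ}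
  {X : ℕ → Ω → Vec d} {κ : Kernel (Vec d) (Vec d)} [IsMarkovKernel κ]

/-- Splitting off the last factor leaves the shorter product plus a term in which a function of the
past multiplies a centred transition; that term integrates to zero. -/
lemma integral_prod_one_add_eq_one (hX : IsStationaryMarkov P X κ) {g : Vec d × Vec d → ℝ}
    (hg : Measurable g) {B : ℝ} (hB : ∀ z, |g z| ≤ B) (h0 : ∀ x, ∫ y, g (x, y) ∂(κ x) = 0)
    (c : ℂ) (m : ℕ) :
    ∫ ω, ∏ t ∈ Finset.range m, (1 + c * g (X t ω, X (t + 1) ω)) ∂P = 1 := by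
  have hbound : ∀ m ω, ‖∏ t ∈ Finset.range m, (1 + c * (g (X t ω, X (t + 1) ω) : ℂ))‖ ≤
      (1 + ‖c‖ * B) ^ m := fun m ω => by
    rw [norm_prod]
    refine (Finset.prod_le_prod (g := fun _ => 1 + ‖c‖ * B) (fun _ _ => norm_nonneg _)
      fun t _ => ?_).trans (by simp)
    refine (norm_add_le _ _).trans ?_
    rw [norm_one, norm_mul, Complex.norm_real]
    gcongr
    exact hB _
  have hmeas : ∀ m, Measurable[pastField X m]
      fun ω => ∏ t ∈ Finset.range m, (1 + c * (g (X t ω, X (t + 1) ω) : ℂ)) := fun m => by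
    refine Finset.measurable_fun_prod _ fun t ht => ?_
    rw [Finset.mem_range] at ht
    have h1 : Measurable[pastField X m] fun ω => (X t ω, X (t + 1) ω) :=
      (measurable_pastField X ht.le).prodMk (measurable_pastField X ht)
    exact ((Complex.measurable_ofReal.comp (hg.comp h1)).const_mul c).const_add 1
  have hle := pastField_le hX.measurable
  have hint : ∀ m, Integrable
      (fun ω => ∏ t ∈ Finset.range m, (1 + c * (g (X t ω, X (t + 1) ω) : ℂ))) P := fun m =>
    Integrable.of_bound ((hmeas m).mono (hle m) le_rfl).aestronglyMeasurable _
      (ae_of_all _ (hbound m))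
  induction m with
  | zero => simp
  | succ m ih =>
    have hz : ∫ ω, (∏ t ∈ Finset.range m, (1 + c * (g (X t ω, X (t + 1) ω) : ℂ))) *
        (g (X m ω, X (m + 1) ω) : ℂ) ∂P = 0 :=
      hX.integral_mul_eq_zero m (hmeas m) (hbound m) (h := fun z => (g z : ℂ))
        (Complex.measurable_ofReal.comp hg) (b' := B)
        (fun z => by rw [Complex.norm_real]; exact hB z) fun x => by
          rw [integral_complex_ofReal, h0, Complex.ofReal_zero]
    have e : ∀ ω, ∏ t ∈ Finset.range (m + 1), (1 + c * (g (X t ω, X (t + 1) ω) : ℂ)) =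
        ∏ t ∈ Finset.range m, (1 + c * (g (X t ω, X (t + 1) ω) : ℂ)) +
        c * ((∏ t ∈ Finset.range m, (1 + c * (g (X t ω, X (t + 1) ω) : ℂ))) *
          (g (X m ω, X (m + 1) ω) : ℂ)) := fun ω => by
      rw [Finset.prod_range_succ]; ring
    have hi : Integrable (fun ω => (∏ t ∈ Finset.range m, (1 + c * (g (X t ω, X (t + 1) ω) : ℂ))) *
          (g (X m ω, X (m + 1) ω) : ℂ)) P := by
      refine (hint m).mul_bdd (c := B) ?_ (ae_of_all _ fun ω => ?_)
      · exact (Complex.measurable_ofReal.comp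
          (hg.comp (hX.measurable_pair m))).aestronglyMeasurable
      · rw [Complex.norm_real]; exact hB _
    simp_rw [e]
    rw [integral_add (hint m) (hi.const_mul c), ih, integral_const_mul, hz, mul_zero, add_zero]

/-- The central limit theorem for bounded martingale differences that are functions of the
transitions, in terms of characteristic functions. -/
theorem tendsto_integral_exp_sum (hX : IsStationaryMarkov P X κ) (hmix : ExpAlphaMixing P X)
    {g : Vec d × Vec d → ℝ} (hg : Measurable g) {B : ℝ} (hB : ∀ z, |g z| ≤ B)
    (h0 : ∀ x, ∫ y, g (x, y) ∂(κ x) = 0) :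
    Tendsto (fun n : ℕ => ∫ ω, Complex.exp (((Real.sqrt n)⁻¹ *
      ∑ t ∈ Finset.range n, g (X t ω, X (t + 1) ω) : ℝ) * Complex.I) ∂P) atTop
      (𝓝 (Complex.exp (-(∫ z, g z ^ 2 ∂(P.map (fun ω => (X 0 ω, X 1 ω))) : ℝ) / 2))) := by
  have hprob : IsProbabilityMeasure (P.map (fun ω => (X 0 ω, X 1 ω))) :=
    Measure.isProbabilityMeasure_map (hX.measurable_pair 0).aemeasurable
  have hB0 : 0 ≤ B := (abs_nonneg _).trans (hB 0)
  set v := ∫ z, g z ^ 2 ∂(P.map (fun ω => (X 0 ω, X 1 ω))) with hv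
  have hv0 : 0 ≤ v := integral_nonneg fun z => sq_nonneg _
  have hg2 : Integrable (fun z => g z ^ 2) (P.map (fun ω => (X 0 ω, X 1 ω))) :=
    Integrable.of_bound (hg.pow_const 2).aestronglyMeasurable (B ^ 2) (ae_of_all _ fun z => by
      rw [norm_pow, Real.norm_eq_abs]
      exact pow_le_pow_left₀ (abs_nonneg _) (hB z) 2)
  have hlln := tendsto_lintegral_avg_sub hX hmix hg2
  rw [← hv] at hlln
  have hQm : ∀ n : ℕ, Measurable fun ω => avg n (fun z => g z ^ 2) (fun t => X t ω) := fun n => by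
    have : Measurable fun ω => ∑ t ∈ Finset.range n, g (X t ω, X (t + 1) ω) ^ 2 :=
      Finset.measurable_fun_sum _ fun t _ => (hg.comp (hX.measurable_pair t)).pow_const 2
    exact this.const_smul (n : ℝ)⁻¹
  have hQb : ∀ (n : ℕ) ω, ‖avg n (fun z => g z ^ 2) (fun t => X t ω)‖ ≤ B ^ 2 := fun n ω => by
    rw [avg, norm_smul, norm_inv, RCLike.norm_natCast]
    have : ‖∑ t ∈ Finset.range n, g (X t ω, X (t + 1) ω) ^ 2‖ ≤ n * B ^ 2 := by
      refine (norm_sum_le _ _).trans ((Finset.sum_le_card_nsmul _ _ (B ^ 2) fun t _ => ?_).trans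
        (by simp))
      rw [norm_pow, Real.norm_eq_abs]
      exact pow_le_pow_left₀ (abs_nonneg _) (hB _) 2
    rcases Nat.eq_zero_or_pos n with rfl | hn
    · simp; positivity
    · have : (0 : ℝ) < n := by exact_mod_cast hn
      rw [inv_mul_le_iff₀ this]
      assumption
  have hQi : ∀ n : ℕ, Integrable (fun ω => avg n (fun z => g z ^ 2) (fun t => X t ω) - v) P :=
    fun n => (Integrable.of_bound (hQm n).aestronglyMeasurable _ (ae_of_all _ (hQb n))).sub
      (integrable_const v)
  have hlln' : Tendsto (fun n : ℕ => ∫ ω, ‖avg n (fun z => g z ^ 2) (fun t => X t ω) - v‖ ∂P)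
      atTop (𝓝 0) := by
    rw [← ENNReal.toReal_zero]
    refine ((ENNReal.tendsto_toReal ENNReal.zero_ne_top).comp hlln).congr fun n => ?_
    rw [Function.comp_apply, ← ofReal_integral_norm_eq_lintegral_enorm (hQi n),
      ENNReal.toReal_ofReal (integral_nonneg fun _ => norm_nonneg _)]
  have hsq : Tendsto (fun n : ℕ => (Real.sqrt n)⁻¹) atTop (𝓝 0) :=
    tendsto_inv_atTop_zero.comp (Real.tendsto_sqrt_atTop.comp tendsto_natCast_atTop_atTop)
  have hev : ∀ᶠ n : ℕ in atTop, 1 ≤ n ∧ (Real.sqrt n)⁻¹ * B ≤ 1 / 2 ∧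
      (Real.sqrt n)⁻¹ * B ^ 3 ≤ 1 := by
    have h1 : Tendsto (fun n : ℕ => (Real.sqrt n)⁻¹ * B) atTop (𝓝 0) := by
      simpa using hsq.mul_const B
    have h2 : Tendsto (fun n : ℕ => (Real.sqrt n)⁻¹ * B ^ 3) atTop (𝓝 0) := by
      simpa using hsq.mul_const (B ^ 3)
    filter_upwards [eventually_ge_atTop 1, h1.eventually_le_const (by norm_num : (0 : ℝ) < 1 / 2),
      h2.eventually_le_const one_pos] with n a b c using ⟨a, b, c⟩
  rw [tendsto_iff_norm_sub_tendsto_zero]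
  have hlim : Tendsto (fun n : ℕ => Real.exp (B ^ 2 / 2) * (Real.exp 1 *
      (1 / 2 * ∫ ω, ‖avg n (fun z => g z ^ 2) (fun t => X t ω) - v‖ ∂P +
        (Real.sqrt n)⁻¹ * B ^ 3))) atTop (𝓝 0) := by
    have := (((hlln'.const_mul (1 / 2)).add (hsq.mul_const (B ^ 3))).const_mul
      (Real.exp 1)).const_mul (Real.exp (B ^ 2 / 2))
    simpa only [mul_zero, zero_mul, add_zero] using this
  refine tendsto_of_tendsto_of_tendsto_of_le_of_le' tendsto_const_nhds hlim
    (Eventually.of_forall fun _ => norm_nonneg _) ?_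
  filter_upwards [hev] with n ⟨hn1, hnB, hnB3⟩
  have hn0 : (0 : ℝ) < n := by exact_mod_cast hn1
  have hs : 0 < Real.sqrt n := Real.sqrt_pos.2 hn0
  have hss : Real.sqrt n * Real.sqrt n = n := Real.mul_self_sqrt hn0.le
  set s := (Real.sqrt n)⁻¹ with hsdef
  have hs0 : 0 < s := inv_pos.2 hs
  have hs2 : s ^ 2 = (n : ℝ)⁻¹ := by rw [hsdef, inv_pow, sq, hss]
  have hx : ∀ ω t, |s * g (X t ω, X (t + 1) ω)| ≤ s * B := fun ω t => by
    rw [abs_mul, abs_of_pos hs0]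
    exact mul_le_mul_of_nonneg_left (hB _) hs0.le
  choose r hr hre using fun ω t => exists_exp_I_mul_eq ((hx ω t).trans hnB)
  -- McLeish's decomposition writes the exponential as `T exp (-Q/2 + R)`, with `Q` the average of
  -- the squares and `R` a cubic remainder. Because `E T = 1`, the error is `E [T (exp (-Q/2 + R) -
  -- exp (-v/2))]`. Here `T` is bounded by `exp (B²/2)`, `Q` tends to `v` in `L¹`, and `R` is of
  -- order `n^{-1/2}`.
  let T : Ω → ℂ := fun ω => ∏ t ∈ Finset.range n, (1 + (s * Complex.I) * g (X t ω, X (t + 1) ω))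
  have hT1 : ∫ ω, T ω ∂P = 1 := integral_prod_one_add_eq_one hX hg hB h0 _ n
  have hTm : Measurable T := Finset.measurable_fun_prod _ fun t _ =>
    ((Complex.measurable_ofReal.comp (hg.comp (hX.measurable_pair t))).const_mul _).const_add 1
  have hTb : ∀ ω, ‖T ω‖ ≤ Real.exp (B ^ 2 / 2) := fun ω => by
    rw [norm_prod]
    calc _ ≤ ∏ t ∈ Finset.range n, Real.exp ((n : ℝ)⁻¹ * (B ^ 2 / 2)) := by
          refine Finset.prod_le_prod (fun _ _ => norm_nonneg _) fun t _ => ?_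
          have e : (1 + (s * Complex.I) * g (X t ω, X (t + 1) ω) : ℂ) =
            1 + (s * g (X t ω, X (t + 1) ω) : ℝ) * Complex.I := by push_cast; ring
          rw [e]
          refine (norm_one_add_mul_I_le _).trans (Real.exp_le_exp.2 ?_)
          rw [← hs2, ← sq_abs, ← mul_div_assoc, ← mul_pow]
          have := hx ω t
          gcongr
      _ = _ := by
          rw [Finset.prod_const, ← Real.exp_nat_mul, Finset.card_range]
          congr 1
          field_simp
  have hexp : ∀ ω, Complex.exp ((s * ∑ t ∈ Finset.range n, g (X t ω, X (t + 1) ω) : ℝ) *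
      Complex.I) = T ω * Complex.exp (-(avg n (fun z => g z ^ 2) (fun t => X t ω) : ℝ) / 2 +
        ∑ t ∈ Finset.range n, r ω t) := fun ω => by
    have e1 : ((s * ∑ t ∈ Finset.range n, g (X t ω, X (t + 1) ω) : ℝ) * Complex.I : ℂ) =
        ∑ t ∈ Finset.range n, ((s * g (X t ω, X (t + 1) ω) : ℝ) : ℂ) * Complex.I := by
      rw [Finset.mul_sum, Complex.ofReal_sum, Finset.sum_mul]
    have e2 : (-(avg n (fun z => g z ^ 2) (fun t => X t ω) : ℝ) / 2 +
        ∑ t ∈ Finset.range n, r ω t : ℂ) = ∑ t ∈ Finset.range n,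
        (-((s * g (X t ω, X (t + 1) ω)) ^ 2 : ℝ) / 2 + r ω t) := by
      rw [Finset.sum_add_distrib, ← Finset.sum_div, Finset.sum_neg_distrib, avg, ← hs2,
        smul_eq_mul, Finset.mul_sum, Complex.ofReal_sum]
      simp only [mul_pow]
    rw [e1, e2, Complex.exp_sum, Complex.exp_sum, ← Finset.prod_mul_distrib]
    refine Finset.prod_congr rfl fun t _ => ?_
    rw [hre ω t]
    congr 1
    push_cast
    ring
  have hRb : ∀ ω, ‖∑ t ∈ Finset.range n, r ω t‖ ≤ s * B ^ 3 := fun ω => by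
    refine (norm_sum_le _ _).trans ((Finset.sum_le_card_nsmul _ _ ((s * B) ^ 3)
      fun t _ => (hr ω t).trans (by have := hx ω t; gcongr)).trans (le_of_eq ?_))
    rw [Finset.card_range, nsmul_eq_mul, mul_pow, pow_succ s 2, hs2]
    field_simp
  have hEm : Measurable fun ω => Complex.exp ((s * ∑ t ∈ Finset.range n,
      g (X t ω, X (t + 1) ω) : ℝ) * Complex.I) :=
    Complex.measurable_exp.comp ((Complex.measurable_ofReal.comp
      ((Finset.measurable_fun_sum _ fun t _ => hg.comp (hX.measurable_pair t)).const_mul _)).mul_const _)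
  have hEi : Integrable (fun ω => Complex.exp ((s * ∑ t ∈ Finset.range n,
      g (X t ω, X (t + 1) ω) : ℝ) * Complex.I)) P :=
    Integrable.of_bound hEm.aestronglyMeasurable 1 (ae_of_all _ fun ω => by
      rw [Complex.norm_exp_ofReal_mul_I])
  have hTi : Integrable T P :=
    Integrable.of_bound hTm.aestronglyMeasurable _ (ae_of_all _ hTb)
  have hdiff : ∫ ω, Complex.exp ((s * ∑ t ∈ Finset.range n,
      g (X t ω, X (t + 1) ω) : ℝ) * Complex.I) ∂P - Complex.exp (-(v : ℂ) / 2) =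
      ∫ ω, (Complex.exp ((s * ∑ t ∈ Finset.range n,
      g (X t ω, X (t + 1) ω) : ℝ) * Complex.I) - T ω * Complex.exp (-(v : ℂ) / 2)) ∂P := by
    rw [integral_sub hEi (hTi.mul_const _), integral_mul_const, hT1, one_mul]
  rw [hdiff]
  refine (norm_integral_le_integral_norm _).trans ?_
  have hbd : ∀ ω, ‖Complex.exp ((s * ∑ t ∈ Finset.range n, g (X t ω, X (t + 1) ω) : ℝ) * Complex.I)
      - T ω * Complex.exp (-(v : ℂ) / 2)‖ ≤ Real.exp (B ^ 2 / 2) * (Real.exp 1 *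
      (1 / 2 * ‖avg n (fun z => g z ^ 2) (fun t => X t ω) - v‖ + s * B ^ 3)) := fun ω => by
    rw [hexp, ← mul_sub, norm_mul]
    refine mul_le_mul (hTb ω) ?_ (norm_nonneg _) (Real.exp_pos _).le
    have hQ0 : 0 ≤ avg n (fun z => g z ^ 2) (fun t => X t ω) := by
      rw [avg, smul_eq_mul]; positivity
    -- Both exponents have real part at most `1`: `Q` and `v` are nonnegative, and `n` is large
    -- enough that the remainder has norm at most `1`.
    refine (norm_exp_sub_exp_le (c := 1) ?_ ?_).trans ?_
    · have h1 := (Complex.re_le_norm _).trans ((hRb ω).trans hnB3)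
      have h2 : (-((avg n (fun z => g z ^ 2) (fun t => X t ω) : ℝ) : ℂ) / 2).re =
          -(avg n (fun z => g z ^ 2) (fun t => X t ω)) / 2 := by
        rw [← Complex.ofReal_neg, ← Complex.ofReal_ofNat, ← Complex.ofReal_div, Complex.ofReal_re]
      rw [Complex.add_re, h2]
      linarith
    · rw [← Complex.ofReal_neg, ← Complex.ofReal_ofNat, ← Complex.ofReal_div, Complex.ofReal_re]
      linarith
    · refine mul_le_mul_of_nonneg_left ?_ (Real.exp_pos 1).le
      have e : (-((avg n (fun z => g z ^ 2) (fun t => X t ω) : ℝ) : ℂ) / 2 +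
          ∑ t ∈ Finset.range n, r ω t - -(v : ℂ) / 2) =
          -(1 / 2 : ℝ) * ((avg n (fun z => g z ^ 2) (fun t => X t ω) - v : ℝ) : ℂ) +
          ∑ t ∈ Finset.range n, r ω t := by push_cast; ring
      rw [e]
      refine (norm_add_le _ _).trans (add_le_add (le_of_eq ?_) (hRb ω))
      rw [norm_mul, norm_neg, Complex.norm_real, Complex.norm_real]
      norm_num
  have hi1 : Integrable (fun ω => 1 / 2 * ‖avg n (fun z => g z ^ 2) (fun t => X t ω) - v‖) P :=
    (hQi n).norm.const_mul _
  have hi2 : Integrable (fun ω => 1 / 2 * ‖avg n (fun z => g z ^ 2) (fun t => X t ω) - v‖ +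
    s * B ^ 3) P := hi1.add (integrable_const _)
  refine (integral_mono (hEi.sub (hTi.mul_const _)).norm ((hi2.const_mul _).const_mul _)
    hbd).trans (le_of_eq ?_)
  rw [integral_const_mul, integral_const_mul, integral_add hi1 (integrable_const _),
    integral_const_mul]
  simp

end CCFEL
end

noncomputable section

namespace CCFEL

/-! ### Covariance operators on the complex plane -/

/-- The inverse of the real linear operator `z ↦ (a z + b z̄) / 2`, the covariance operator of a
centred complex random variable `ε` with `a = E |ε|²` and `b = E ε²`. -/
def invCov (a : ℝ) (b : ℂ) : ℂ →L[ℝ] ℂ :=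
  (2 / (a ^ 2 - ‖b‖ ^ 2)) •
    (a • ContinuousLinearMap.id ℝ ℂ - b • (Complex.conjCLE : ℂ →L[ℝ] ℂ))

lemma invCov_apply (a : ℝ) (b y : ℂ) :
    invCov a b y = ((2 / (a ^ 2 - ‖b‖ ^ 2) : ℝ) : ℂ) * (a * y - b * conj y) := by
  simp [invCov]

lemma inner_eq_half (l u : ℂ) : ((inner ℝ l u : ℝ) : ℂ) = (conj l * u + l * conj u) / 2 := by
  rw [Complex.inner, Complex.re_eq_add_conj]
  simp
  ring

/-- The rank-one operator `l ↦ ⟪l, u⟫ u` is the covariance operator with parameters `|u|²` and `u²`.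
Averaging over `u` shows that second moments enter only through `a` and `b`. -/
lemma inner_smul_self_eq (l u : ℂ) :
    ((inner ℝ l u : ℝ) : ℂ) * u = ((‖u‖ ^ 2 : ℝ) * l + u ^ 2 * conj l) / 2 := by
  rw [inner_eq_half]
  push_cast
  rw [← Complex.conj_mul']
  ring

lemma invCov_symm (a : ℝ) (b y z : ℂ) :
    (inner ℝ y (invCov a b z) : ℝ) = inner ℝ z (invCov a b y) := by
  apply Complex.ofReal_injective
  simp only [inner_eq_half, invCov_apply, map_mul, map_sub, Complex.conj_ofReal, Complex.conj_conj]
  ring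

section

variable {a c : ℝ} {b : ℂ}

lemma cov_invCov (hc : 0 < c) (h : c ≤ a - ‖b‖) (y : ℂ) :
    (a * invCov a b y + b * conj (invCov a b y)) / 2 = y := by
  have hb := norm_nonneg b
  have hne : a ^ 2 - ‖b‖ ^ 2 ≠ 0 := by nlinarith
  have hne' : (a : ℂ) ^ 2 - ‖b‖ ^ 2 ≠ 0 := by exact_mod_cast hne
  rw [invCov_apply]
  simp only [map_mul, map_sub, Complex.conj_ofReal, Complex.conj_conj]
  push_cast
  field_simp
  rw [← Complex.conj_mul' b]
  ring

/-- The operator `l ↦ (a l + b l̄) / 2` has eigenvalues `(a ± |b|) / 2`, so the gap `c` bounds it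
below by `c / 2`. The reverse triangle inequality gives this without diagonalising. -/
lemma norm_le_of_cov_eq (hc : 0 < c) (h : c ≤ a - ‖b‖) {l y : ℂ}
    (hl : (a * l + b * conj l) / 2 = y) : ‖l‖ ≤ 2 / c * ‖y‖ := by
  have hb := norm_nonneg b
  have ha : 0 ≤ a := by linarith
  have h1 : ‖(a : ℂ) * l‖ - ‖b * conj l‖ ≤ ‖a * l + b * conj l‖ := by
    have := norm_sub_norm_le ((a : ℂ) * l) (-(b * conj l))
    rwa [norm_neg, sub_neg_eq_add] at this
  rw [norm_mul, norm_mul, Complex.norm_real, Real.norm_of_nonneg ha, RCLike.norm_conj] at h1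
  have h2 : ‖a * l + b * conj l‖ = 2 * ‖y‖ := by
    rw [← hl, norm_div]; norm_num; ring
  rw [div_mul_eq_mul_div, le_div_iff₀ hc]
  nlinarith [norm_nonneg l]

lemma norm_invCov_le (hc : 0 < c) (h : c ≤ a - ‖b‖) (y : ℂ) :
    ‖invCov a b y‖ ≤ 2 / c * ‖y‖ :=
  norm_le_of_cov_eq hc h (cov_invCov hc h y)

/-- The resolvent identity: the first operator applied to the difference of the two solutions equals
the difference of the operators applied to the second solution. -/
lemma norm_invCov_sub_le (hc : 0 < c) (h : c ≤ a - ‖b‖) {a' c' : ℝ} {b' : ℂ} (hc' : 0 < c')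
    (h' : c' ≤ a' - ‖b'‖) (y : ℂ) :
    ‖invCov a' b' y - invCov a b y‖ ≤ (|a' - a| + ‖b' - b‖) / c * ‖invCov a' b' y‖ := by
  have e := cov_invCov hc h y
  have e' := cov_invCov hc' h' y
  set l := invCov a b y
  set l' := invCov a' b' y
  have hd : (a * (l' - l) + b * conj (l' - l)) / 2 =
      (((a - a' : ℝ) : ℂ) * l' + (b - b') * conj l') / 2 := by
    rw [map_sub]
    push_cast
    linear_combination e' - e
  refine (norm_le_of_cov_eq hc h hd).trans ?_
  rw [norm_div]
  have h1 : ‖((a - a' : ℝ) : ℂ) * l' + (b - b') * conj l'‖ ≤ (|a' - a| + ‖b' - b‖) * ‖l'‖ := by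
    refine (norm_add_le _ _).trans (le_of_eq ?_)
    rw [norm_mul, norm_mul, Complex.norm_real, RCLike.norm_conj, Real.norm_eq_abs, abs_sub_comm,
      norm_sub_rev, add_mul]
  have h2 : ‖(2 : ℂ)‖ = 2 := by norm_num
  rw [h2]
  calc _ ≤ 2 / c * ((|a' - a| + ‖b' - b‖) * ‖l'‖ / 2) := by gcongr
    _ = _ := by field_simp

/-- The quadratic form `(a |z|² + Re (b̄ z²)) / 2` of a covariance operator. -/
def covQuad (a : ℝ) (b l : ℂ) : ℝ := (a * ‖l‖ ^ 2 + (conj b * l ^ 2).re) / 2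

lemma covQuad_eq_inner (a : ℝ) (b l : ℂ) :
    covQuad a b l = inner ℝ l ((a * l + b * conj l) / 2) := by
  apply Complex.ofReal_injective
  rw [inner_eq_half, covQuad]
  push_cast
  rw [← Complex.conj_mul', Complex.re_eq_add_conj]
  simp only [map_mul, map_add, map_div₀, map_pow, Complex.conj_conj, Complex.conj_ofReal,
    Complex.conj_ofNat]
  ring

lemma covQuad_invCov (hc : 0 < c) (h : c ≤ a - ‖b‖) (y : ℂ) :
    covQuad a b (invCov a b y) = inner ℝ (invCov a b y) y := by
  rw [covQuad_eq_inner, cov_invCov hc h]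

lemma abs_covQuad_sub_le (a a' : ℝ) (b b' l : ℂ) :
    |covQuad a' b' l - covQuad a b l| ≤ (|a' - a| + ‖b' - b‖) / 2 * ‖l‖ ^ 2 := by
  have e : covQuad a' b' l - covQuad a b l =
      ((a' - a) * ‖l‖ ^ 2 + (conj (b' - b) * l ^ 2).re) / 2 := by
    rw [covQuad, covQuad, map_sub, sub_mul (conj b'), Complex.sub_re]; ring
  have h1 : |(conj (b' - b) * l ^ 2).re| ≤ ‖b' - b‖ * ‖l‖ ^ 2 := by
    refine (Complex.abs_re_le_norm _).trans (le_of_eq ?_)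
    rw [norm_mul, RCLike.norm_conj, norm_pow]
  have h2 : |(a' - a) * ‖l‖ ^ 2| = |a' - a| * ‖l‖ ^ 2 := by
    rw [abs_mul, abs_of_nonneg (sq_nonneg ‖l‖)]
  rw [e, abs_div, abs_two]
  have := abs_add_le ((a' - a) * ‖l‖ ^ 2) (conj (b' - b) * l ^ 2).re
  linarith

lemma inner_sq_eq_covQuad (l u : ℂ) : (inner ℝ l u : ℝ) ^ 2 = covQuad (‖u‖ ^ 2) (u ^ 2) l := by
  apply Complex.ofReal_injective
  rw [covQuad_eq_inner, ← inner_smul_self_eq, ← Complex.real_smul, real_inner_smul_right]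
  push_cast
  ring

lemma sum_covQuad {ι : Type*} (s : Finset ι) (a : ι → ℝ) (b : ι → ℂ) (l : ℂ) :
    ∑ t ∈ s, covQuad (a t) (b t) l = covQuad (∑ t ∈ s, a t) (∑ t ∈ s, b t) l := by
  simp only [covQuad, map_sum, Finset.sum_mul, Complex.re_sum, ← Finset.sum_div,
    Finset.sum_add_distrib]

lemma covQuad_smul (r a : ℝ) (b l : ℂ) : covQuad (r * a) (r * b) l = r * covQuad a b l := by
  rw [covQuad, covQuad, map_mul, Complex.conj_ofReal, mul_assoc (r : ℂ), Complex.re_ofReal_mul]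
  ring

lemma inner_invCov_self_nonneg (hc : 0 < c) (h : c ≤ a - ‖b‖) (y : ℂ) :
    0 ≤ (inner ℝ y (invCov a b y) : ℝ) := by
  rw [real_inner_comm, ← covQuad_invCov hc h, covQuad]
  set l := invCov a b y
  have h1 : |(conj b * l ^ 2).re| ≤ ‖b‖ * ‖l‖ ^ 2 := by
    refine (Complex.abs_re_le_norm _).trans (le_of_eq ?_)
    rw [norm_mul, RCLike.norm_conj, norm_pow]
  have := (abs_le.1 h1).1
  have h2 : 0 ≤ ‖l‖ ^ 2 := sq_nonneg _
  have : 0 ≤ a * ‖l‖ ^ 2 + (conj b * l ^ 2).re := by nlinarith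
  linarith

end

/-! ### Expansion of the empirical likelihood ratio -/

lemma abs_log_one_add_sub_le {x : ℝ} (hx : |x| ≤ 1 / 2) :
    |Real.log (1 + x) - (x - x ^ 2 / 2)| ≤ 2 * |x| ^ 3 := by
  have h := Real.abs_log_sub_add_sum_range_le (x := -x) (by rw [abs_neg]; linarith) 2
  rw [abs_neg, sub_neg_eq_add] at h
  simp only [Finset.sum_range_succ, Finset.sum_range_zero] at h
  have e : (0 + (-x) ^ (0 + 1) / (((0 : ℕ) : ℝ) + 1) + (-x) ^ (1 + 1) / (((1 : ℕ) : ℝ) + 1) +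
      Real.log (1 + x)) = Real.log (1 + x) - (x - x ^ 2 / 2) := by
    push_cast; ring
  rw [e] at h
  refine h.trans ?_
  rw [div_le_iff₀ (by linarith)]
  have h3 : 0 ≤ |x| ^ 3 := by positivity
  have h4 : 0 ≤ |x| ^ 3 * (1 - 2 * |x|) := mul_nonneg h3 (by linarith)
  rw [show 2 + 1 = 3 from rfl]
  linarith

lemma sum_mul_residual_eq_zero_iff {n : ℕ} (z : Fin n → ℂ) (q : Fin n → ℝ) :
    (∀ k, ∑ t, q t * (fun t => ![(z t).re, (z t).im]) t k = 0) ↔ ∑ t, (q t : ℂ) * z t = 0 := by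
  rw [Fin.forall_fin_two, Complex.ext_iff]
  simp

lemma prod_le_one_of_mem_elWeights {n : ℕ} {g : Fin n → Fin 2 → ℝ} {q : Fin n → ℝ}
    (hq : q ∈ elWeights g) : ∏ t, q t ≤ 1 := by
  refine Finset.prod_le_one (fun t _ => hq.1 t) fun t _ => ?_
  rw [← hq.2.1]
  exact Finset.single_le_sum (fun s _ => hq.1 s) (Finset.mem_univ t)

lemma el_nonneg {n : ℕ} (g : Fin n → Fin 2 → ℝ) : 0 ≤ el g :=
  Real.sSup_nonneg (by rintro _ ⟨q, hq, rfl⟩; exact Finset.prod_nonneg fun t _ => hq.1 t)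

/-- Convex duality bounds the empirical likelihood ratio from below. -/
lemma le_elLogRatio {n : ℕ} (hn : 1 ≤ n) (z : Fin n → ℂ) (l : ℂ)
    (hl : ∀ t, |(inner ℝ l (z t) : ℝ)| ≤ 1 / 2) :
    ENNReal.ofReal (2 * ∑ t, ((inner ℝ l (z t) : ℝ) - (inner ℝ l (z t) : ℝ) ^ 2 / 2 -
      2 * |(inner ℝ l (z t) : ℝ)| ^ 3)) ≤ elLogRatio (fun t => ![(z t).re, (z t).im]) := by
  rw [elLogRatio]
  split_ifs with h0
  · exact le_top
  refine ENNReal.ofReal_le_ofReal ?_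
  have hpos : 0 < el fun t => ![(z t).re, (z t).im] := lt_of_le_of_ne (el_nonneg _) (Ne.symm h0)
  have hn0 : (0 : ℝ) < n := by exact_mod_cast hn
  set x : Fin n → ℝ := fun t => inner ℝ l (z t) with hx
  have hx1 : ∀ t, 0 < 1 + x t := fun t => by have := (abs_le.1 (hl t)).1; linarith
  have hle : el (fun t => ![(z t).re, (z t).im]) ≤ ((n : ℝ) ^ n)⁻¹ * ∏ t, (1 + x t)⁻¹ := by
    refine Real.sSup_le ?_ (mul_nonneg (by positivity)
      (Finset.prod_nonneg fun t _ => (inv_pos.2 (hx1 t)).le))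
    rintro _ ⟨q, hq, rfl⟩
    -- Apply `s ≤ exp (s - 1)` to each factor. The exponents sum to zero because the weights sum to
    -- one and annihilate the residuals.
    have h1 : ∏ t, (n * q t * (1 + x t)) ≤ 1 := by
      calc ∏ t, (n * q t * (1 + x t)) ≤ ∏ t, Real.exp (n * q t * (1 + x t) - 1) := by
            refine Finset.prod_le_prod (fun t _ => mul_nonneg (mul_nonneg hn0.le (hq.1 t))
              (hx1 t).le) fun t _ => ?_
            have := Real.add_one_le_exp (n * q t * (1 + x t) - 1)
            linarith
        _ = 1 := by
            rw [← Real.exp_sum, Finset.sum_sub_distrib]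
            have e : ∀ t, n * q t * (1 + x t) = n * q t + n * inner ℝ l (((q t : ℂ) * z t)) := by
              intro t
              rw [← Complex.real_smul, real_inner_smul_right]; ring
            simp_rw [e]
            rw [Finset.sum_add_distrib, ← Finset.mul_sum, ← Finset.mul_sum, ← inner_sum,
              (sum_mul_residual_eq_zero_iff z q).1 hq.2.2, hq.2.1]
            simp
    rw [Finset.prod_mul_distrib, Finset.prod_mul_distrib] at h1
    simp only [Finset.prod_const, Finset.card_univ, Fintype.card_fin] at h1
    rw [Finset.prod_inv_distrib, ← mul_inv, ← one_div,
      le_div_iff₀ (mul_pos (by positivity) (Finset.prod_pos fun t _ => hx1 t))]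
    linarith
  have hlog : Real.log (el (fun t => ![(z t).re, (z t).im]) / ((n : ℝ) ^ n)⁻¹) ≤
      -∑ t, Real.log (1 + x t) := by
    rw [← Finset.sum_neg_distrib]
    simp_rw [← Real.log_inv]
    rw [← Real.log_prod fun t _ => (inv_pos.2 (hx1 t)).ne']
    refine Real.log_le_log (by positivity) ?_
    rw [div_le_iff₀ (by positivity), mul_comm]
    exact hle
  have hsum : ∑ t, (x t - x t ^ 2 / 2 - 2 * |x t| ^ 3) ≤ ∑ t, Real.log (1 + x t) := by
    refine Finset.sum_le_sum fun t _ => ?_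
    have := (abs_le.1 (abs_log_one_add_sub_le (hl t))).1
    linarith
  linarith

/-- Explicit weights bound the empirical likelihood ratio from above. -/
lemma elLogRatio_le {n : ℕ} (hn : 1 ≤ n) (z : Fin n → ℂ) (y : Fin n → ℝ)
    (hy : ∀ t, |y t| ≤ 1 / 2) (hy0 : ∑ t, y t = 0) (hyz : ∑ t, ((1 - y t : ℝ) : ℂ) * z t = 0) :
    elLogRatio (fun t => ![(z t).re, (z t).im]) ≤
      ENNReal.ofReal (∑ t, (y t ^ 2 + 4 * |y t| ^ 3)) := by
  have hn0 : (0 : ℝ) < n := by exact_mod_cast hn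
  have hpos : ∀ t, 0 < 1 - y t := fun t => by have := (abs_le.1 (hy t)).2; linarith
  let q : Fin n → ℝ := fun t => (n : ℝ)⁻¹ * (1 - y t)
  have hq : q ∈ elWeights (fun t => ![(z t).re, (z t).im]) := by
    refine ⟨fun t => mul_nonneg (by positivity) (hpos t).le, ?_, ?_⟩
    · simp only [q]
      rw [← Finset.mul_sum, Finset.sum_sub_distrib, hy0]
      simp [hn0.ne']
    · rw [sum_mul_residual_eq_zero_iff]
      have e : ∀ t, ((q t : ℝ) : ℂ) * z t = (n : ℂ)⁻¹ * (((1 - y t : ℝ) : ℂ) * z t) := fun t => by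
        simp only [q]; push_cast; ring
      simp_rw [e]
      rw [← Finset.mul_sum, hyz, mul_zero]
  have hprod : ∏ t, q t = ((n : ℝ) ^ n)⁻¹ * ∏ t, (1 - y t) := by
    simp only [q]
    rw [Finset.prod_mul_distrib]
    simp
  have hP : 0 < ∏ t, (1 - y t) := Finset.prod_pos fun t _ => hpos t
  have hle : ∏ t, q t ≤ el fun t => ![(z t).re, (z t).im] := by
    refine le_csSup ⟨1, ?_⟩ ⟨q, hq, rfl⟩
    rintro _ ⟨q', hq', rfl⟩
    exact prod_le_one_of_mem_elWeights hq'
  rw [hprod] at hle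
  have hel : 0 < el fun t => ![(z t).re, (z t).im] := lt_of_lt_of_le (by positivity) hle
  rw [elLogRatio, if_neg hel.ne']
  refine ENNReal.ofReal_le_ofReal ?_
  have hlog : ∑ t, Real.log (1 - y t) ≤
      Real.log (el (fun t => ![(z t).re, (z t).im]) / ((n : ℝ) ^ n)⁻¹) := by
    rw [← Real.log_prod fun t _ => (hpos t).ne']
    refine Real.log_le_log hP ?_
    rw [le_div_iff₀ (by positivity), mul_comm]
    exact hle
  have hsum : ∑ t, (-y t - y t ^ 2 / 2 - 2 * |y t| ^ 3) ≤ ∑ t, Real.log (1 - y t) := by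
    refine Finset.sum_le_sum fun t _ => ?_
    have := (abs_le.1 (abs_log_one_add_sub_le (x := -y t) (by rw [abs_neg]; exact hy t))).1
    rw [abs_neg, ← sub_eq_add_neg, neg_sq] at this
    linarith
  -- The linear terms cancel since the tilts `y t` sum to zero, leaving a quadratic main term.
  have e : ∑ t, (-y t - y t ^ 2 / 2 - 2 * |y t| ^ 3) =
      -(1 / 2) * ∑ t, (y t ^ 2 + 4 * |y t| ^ 3) := by
    have : ∑ t, (-y t - y t ^ 2 / 2 - 2 * |y t| ^ 3) = ∑ t, (-(1 / 2) * (y t ^ 2 + 4 * |y t| ^ 3)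
        - y t) := Finset.sum_congr rfl fun t _ => by ring
    rw [this, Finset.sum_sub_distrib, hy0, sub_zero, ← Finset.mul_sum]
  linarith

/-- The quadratic expansion of the empirical likelihood ratio of a small sample mean. -/
theorem elLogRatio_expansion {n : ℕ} (hn : 1 ≤ n) (z : Fin n → ℂ) (hz : ∀ t, ‖z t‖ ≤ 2)
    {a c η : ℝ} {b y : ℂ} (hc : 0 < c) (h : c ≤ a - ‖b‖) (hη1 : η ≤ 1) (hηc : 32 * η ≤ c)
    (hy : (n : ℂ)⁻¹ * ∑ t, z t = y) (hyη : ‖y‖ ≤ η)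
    (hab : |(n : ℝ)⁻¹ * ∑ t, ‖z t‖ ^ 2 - a| + ‖(n : ℂ)⁻¹ * ∑ t, z t ^ 2 - b‖ ≤ η) :
    ENNReal.ofReal (n * ((inner ℝ y (invCov a b y) : ℝ) -
        (12 / c ^ 2 + 16384 / c ^ 3) * η * ‖y‖ ^ 2)) ≤
      elLogRatio (fun t => ![(z t).re, (z t).im]) ∧
    elLogRatio (fun t => ![(z t).re, (z t).im]) ≤
      ENNReal.ofReal (n * ((inner ℝ y (invCov a b y) : ℝ) +
        (12 / c ^ 2 + 16384 / c ^ 3) * η * ‖y‖ ^ 2)) := by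
  have hn0 : (0 : ℝ) < n := by exact_mod_cast hn
  have hnC : (n : ℂ) ≠ 0 := by exact_mod_cast hn0.ne'
  have hη0 : 0 ≤ η := (norm_nonneg y).trans hyη
  set an := (n : ℝ)⁻¹ * ∑ t, ‖z t‖ ^ 2 with han
  set bn := (n : ℂ)⁻¹ * ∑ t, z t ^ 2 with hbn
  have hsy : ∑ t, z t = n * y := by rw [← hy, mul_inv_cancel_left₀ hnC]
  have hsa : ∑ t, ‖z t‖ ^ 2 = n * an := by rw [han, mul_inv_cancel_left₀ hn0.ne']
  have hsb : ∑ t, z t ^ 2 = n * bn := by rw [hbn, mul_inv_cancel_left₀ hnC]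
  -- This multiplier maximises the limiting dual function `2 ⟪l, y⟫ - covQuad a b l`, whose maximum
  -- is `⟪y, invCov a b y⟫`.
  set l := invCov a b y with hl
  have hlb : ‖l‖ ≤ 2 / c * ‖y‖ := norm_invCov_le hc h y
  have hly : 2 / c * ‖y‖ ≤ 1 / 16 := by
    rw [div_mul_eq_mul_div, div_le_iff₀ hc]; linarith
  have hcy : ‖y‖ ^ 3 ≤ η * ‖y‖ ^ 2 := by
    rw [pow_succ' ‖y‖ 2]; gcongr
  constructor
  · refine le_trans (ENNReal.ofReal_le_ofReal ?_) (le_elLogRatio hn z l fun t => ?_)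
    · have hbd : ∀ t, |(inner ℝ l (z t) : ℝ)| ≤ 2 * ‖l‖ := fun t =>
        (abs_real_inner_le_norm _ _).trans (by nlinarith [hz t, norm_nonneg l])
      have h3 : ∑ t, |(inner ℝ l (z t) : ℝ)| ^ 3 ≤ n * (8 * ‖l‖ ^ 3) := by
        refine (Finset.sum_le_card_nsmul _ _ (8 * ‖l‖ ^ 3) fun t _ => ?_).trans (by simp)
        calc _ ≤ (2 * ‖l‖) ^ 3 := pow_le_pow_left₀ (abs_nonneg _) (hbd t) 3
          _ = _ := by ring
      have h2 : ∑ t, (inner ℝ l (z t) : ℝ) ^ 2 = n * covQuad an bn l := by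
        simp_rw [inner_sq_eq_covQuad]
        rw [sum_covQuad, hsa, hsb, ← covQuad_smul]
        simp
      have h1 : ∑ t, (inner ℝ l (z t) : ℝ) = n * inner ℝ y l := by
        rw [← inner_sum, hsy, real_inner_comm, ← real_inner_smul_left]
        simp
      have hq := (abs_le.1 (abs_covQuad_sub_le a an b bn l)).2
      rw [hl, covQuad_invCov hc h, ← hl, real_inner_comm] at hq
      have e : 2 * ∑ t, ((inner ℝ l (z t) : ℝ) - (inner ℝ l (z t) : ℝ) ^ 2 / 2 -
          2 * |(inner ℝ l (z t) : ℝ)| ^ 3) = 2 * ∑ t, (inner ℝ l (z t) : ℝ) -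
          ∑ t, (inner ℝ l (z t) : ℝ) ^ 2 - 4 * ∑ t, |(inner ℝ l (z t) : ℝ)| ^ 3 := by
        simp only [Finset.mul_sum, ← Finset.sum_sub_distrib]
        exact Finset.sum_congr rfl fun t _ => by ring
      rw [e, h1, h2]
      have hl2 : ‖l‖ ^ 2 ≤ (2 / c) ^ 2 * ‖y‖ ^ 2 := by
        rw [← mul_pow]; gcongr
      have hl3 : ‖l‖ ^ 3 ≤ (2 / c) ^ 3 * (η * ‖y‖ ^ 2) := by
        calc _ ≤ (2 / c * ‖y‖) ^ 3 := by gcongr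
          _ = (2 / c) ^ 3 * ‖y‖ ^ 3 := by ring
          _ ≤ _ := by gcongr
      have hq2 : (|an - a| + ‖bn - b‖) / 2 * ‖l‖ ^ 2 ≤ η / 2 * ((2 / c) ^ 2 * ‖y‖ ^ 2) := by
        gcongr
      have key : (inner ℝ y l : ℝ) - (12 / c ^ 2 + 16384 / c ^ 3) * η * ‖y‖ ^ 2 ≤
          2 * inner ℝ y l - covQuad an bn l - 32 * ‖l‖ ^ 3 := by
        have p1 : 0 ≤ 1 / c ^ 2 * (η * ‖y‖ ^ 2) := by positivity
        have p2 : 0 ≤ 1 / c ^ 3 * (η * ‖y‖ ^ 2) := by positivity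
        have e1 : (12 / c ^ 2 + 16384 / c ^ 3) * η * ‖y‖ ^ 2 =
          12 * (1 / c ^ 2 * (η * ‖y‖ ^ 2)) + 16384 * (1 / c ^ 3 * (η * ‖y‖ ^ 2)) := by ring
        have e2 : η / 2 * ((2 / c) ^ 2 * ‖y‖ ^ 2) = 2 * (1 / c ^ 2 * (η * ‖y‖ ^ 2)) := by ring
        have e3 : (2 / c) ^ 3 * (η * ‖y‖ ^ 2) = 8 * (1 / c ^ 3 * (η * ‖y‖ ^ 2)) := by ring
        rw [e1]
        rw [e2] at hq2
        rw [e3] at hl3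
        linarith
      calc _ ≤ n * (2 * inner ℝ y l - covQuad an bn l - 32 * ‖l‖ ^ 3) :=
            mul_le_mul_of_nonneg_left key hn0.le
        _ ≤ _ := by linarith
    · refine (abs_real_inner_le_norm _ _).trans ?_
      have := hz t
      nlinarith [norm_nonneg l, norm_nonneg (z t)]
  -- For the upper bound the weights must be exactly feasible, so the tilt uses the centred
  -- empirical moments instead of `a` and `b`. They are within `3 η` of the limits, and `32 η ≤ c`
  -- leaves half of the gap.
  · set a' := an - ‖y‖ ^ 2 with ha'
    set b' := bn - y ^ 2 with hb'
    have hy2 : ‖y‖ ^ 2 ≤ η := by nlinarith [norm_nonneg y]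
    have hab' : |a' - a| + ‖b' - b‖ ≤ 3 * η := by
      have h1 : |a' - a| ≤ |an - a| + ‖y‖ ^ 2 := by
        rw [show a' - a = (an - a) - ‖y‖ ^ 2 by rw [ha']; ring]
        exact (abs_sub _ _).trans (by rw [abs_of_nonneg (sq_nonneg ‖y‖)])
      have h2 : ‖b' - b‖ ≤ ‖bn - b‖ + ‖y‖ ^ 2 := by
        rw [show b' - b = (bn - b) - y ^ 2 by rw [hb']; ring]
        exact (norm_sub_le _ _).trans (by rw [norm_pow])
      linarith
    have h' : c / 2 ≤ a' - ‖b'‖ := by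
      have h1 := neg_abs_le (a' - a)
      have h2 : ‖b'‖ - ‖b‖ ≤ ‖b' - b‖ := norm_sub_norm_le b' b
      linarith
    set m := invCov a' b' y with hm
    have hmb : ‖m‖ ≤ 4 / c * ‖y‖ := by
      refine (norm_invCov_le (half_pos hc) h' y).trans (le_of_eq ?_)
      field_simp; ring
    have hmy : 4 / c * ‖y‖ ≤ 1 / 8 := by
      rw [div_mul_eq_mul_div, div_le_iff₀ hc]; linarith
    have hzy : ∀ t, ‖z t - y‖ ≤ 4 := fun t => (norm_sub_le _ _).trans (by linarith [hz t])
    have hcov := cov_invCov (half_pos hc) h' y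
    rw [← hm] at hcov
    have hsum0 : ∑ t, (inner ℝ m (z t - y) : ℝ) = 0 := by
      rw [← inner_sum, Finset.sum_sub_distrib, hsy]; simp
    have hsa' : ∑ t, ‖z t - y‖ ^ 2 = n * a' := by
      have e : ∀ t, ‖z t - y‖ ^ 2 = ‖z t‖ ^ 2 - 2 * inner ℝ (z t) y + ‖y‖ ^ 2 := fun t =>
        norm_sub_sq_real _ _
      simp_rw [e]
      rw [Finset.sum_add_distrib, Finset.sum_sub_distrib, hsa, ← Finset.mul_sum, ← sum_inner, hsy]
      have : (inner ℝ ((n : ℂ) * y) y : ℝ) = n * ‖y‖ ^ 2 := by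
        rw [← real_inner_self_eq_norm_sq, ← real_inner_smul_left]; simp
      rw [this, ha']
      simp
      ring
    have hsb' : ∑ t, (z t - y) ^ 2 = n * b' := by
      have e : ∀ t, (z t - y) ^ 2 = z t ^ 2 - 2 * y * z t + y ^ 2 := fun t => by ring
      simp_rw [e]
      rw [Finset.sum_add_distrib, Finset.sum_sub_distrib, hsb, ← Finset.mul_sum, hsy, hb']
      simp
      ring
    refine (elLogRatio_le hn z (fun t => inner ℝ m (z t - y)) (fun t => ?_) hsum0 ?_).trans
      (ENNReal.ofReal_le_ofReal ?_)
    · refine (abs_real_inner_le_norm _ _).trans ?_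
      have := hzy t
      nlinarith [norm_nonneg m, norm_nonneg (z t - y)]
    -- Feasibility: summing `⟪m, z t - y⟫ (z t - y)` gives `n` times the centred covariance operator
    -- at `m`, which is `n y` by the choice of `m` and cancels `∑ z t`. The remaining multiple of
    -- `y` vanishes because the tilts sum to zero.
    · have e : ∀ t, ((1 - inner ℝ m (z t - y) : ℝ) : ℂ) * z t = z t -
          ((inner ℝ m (z t - y) : ℝ) : ℂ) * (z t - y) - ((inner ℝ m (z t - y) : ℝ) : ℂ) * y :=
        fun t => by push_cast; ring
      simp_rw [e]
      rw [Finset.sum_sub_distrib, Finset.sum_sub_distrib, hsy, ← Finset.sum_mul,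
        ← Complex.ofReal_sum, hsum0]
      simp_rw [inner_smul_self_eq]
      rw [← Finset.sum_div, Finset.sum_add_distrib, ← Finset.sum_mul, ← Finset.sum_mul,
        ← Complex.ofReal_sum, hsa', hsb']
      push_cast
      linear_combination (-(n : ℂ)) * hcov
    · have hbd : ∀ t, |(inner ℝ m (z t - y) : ℝ)| ≤ 4 * ‖m‖ := fun t =>
        (abs_real_inner_le_norm _ _).trans (by nlinarith [hzy t, norm_nonneg m])
      have h3 : ∑ t, |(inner ℝ m (z t - y) : ℝ)| ^ 3 ≤ n * (64 * ‖m‖ ^ 3) := by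
        refine (Finset.sum_le_card_nsmul _ _ (64 * ‖m‖ ^ 3) fun t _ => ?_).trans (by simp)
        calc _ ≤ (4 * ‖m‖) ^ 3 := pow_le_pow_left₀ (abs_nonneg _) (hbd t) 3
          _ = _ := by ring
      have h2 : ∑ t, (inner ℝ m (z t - y) : ℝ) ^ 2 = n * inner ℝ y m := by
        simp_rw [inner_sq_eq_covQuad]
        rw [sum_covQuad, hsa', hsb', real_inner_comm, hm, ← covQuad_invCov (half_pos hc) h',
          ← covQuad_smul]
        simp
      rw [Finset.sum_add_distrib, ← Finset.mul_sum, h2]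
      have hd : (inner ℝ y m : ℝ) - inner ℝ y l ≤ 12 / c ^ 2 * η * ‖y‖ ^ 2 := by
        rw [← inner_sub_right]
        refine (real_inner_le_norm _ _).trans ?_
        have := norm_invCov_sub_le hc h (half_pos hc) h' y
        rw [← hm, ← hl] at this
        calc ‖y‖ * ‖m - l‖ ≤ ‖y‖ * (3 * η / c * (4 / c * ‖y‖)) := by
              gcongr
              refine this.trans ?_
              gcongr
          _ = _ := by ring
      have hm3 : ‖m‖ ^ 3 ≤ (4 / c) ^ 3 * (η * ‖y‖ ^ 2) := by
        calc _ ≤ (4 / c * ‖y‖) ^ 3 := by gcongr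
          _ = (4 / c) ^ 3 * ‖y‖ ^ 3 := by ring
          _ ≤ _ := by gcongr
      -- The constant `12 = 3 · 4` comes from changing the covariance by `3 η` while `‖m‖ ≤ (4 / c)
      -- ‖y‖`. The constant `16384 = 256 · 4³` comes from the cubic terms, with `256 = 4 · 4³`
      -- because each tilt is at most `4 ‖m‖`. The lower bound needs smaller constants.
      have e1 : (12 / c ^ 2 + 16384 / c ^ 3) * η * ‖y‖ ^ 2 =
          12 / c ^ 2 * η * ‖y‖ ^ 2 + 256 * ((4 / c) ^ 3 * (η * ‖y‖ ^ 2)) := by ring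
      rw [e1]
      have key : (inner ℝ y m : ℝ) + 256 * ‖m‖ ^ 3 ≤ inner ℝ y l +
        (12 / c ^ 2 * η * ‖y‖ ^ 2 + 256 * ((4 / c) ^ 3 * (η * ‖y‖ ^ 2))) := by linarith
      calc _ ≤ n * ((inner ℝ y m : ℝ) + 256 * ‖m‖ ^ 3) := by linarith
        _ ≤ _ := mul_le_mul_of_nonneg_left key hn0.le

end CCFEL
end

noncomputable section

namespace CCFEL

/-! ### Minimisers of an approximately quadratic criterion -/

/-- Measurable and bounded data of an integrated quadratic criterion: covariances `a`, `b` that are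
uniformly nondegenerate on `S`, and bounded gradients `D`. -/
structure IsQuadModel {T H : Type*} [MeasurableSpace T] [NormedAddCommGroup H] [NormedSpace ℝ H]
    (ν : Measure T) (S : Set T) (a : T → ℝ) (b : T → ℂ) (D : T → H →L[ℝ] ℂ) (c Dm : ℝ) :
    Prop where
  c_pos : 0 < c
  ae_mem : ∀ᵐ τ ∂ν, τ ∈ S
  gap : ∀ τ ∈ S, c ≤ a τ - ‖b τ‖
  norm_D_le : ∀ τ ∈ S, ‖D τ‖ ≤ Dm
  Dm_nonneg : 0 ≤ Dm
  aemeasurable_a : AEMeasurable a ν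
  aemeasurable_b : AEMeasurable b ν
  aemeasurable_D : ∀ v, AEMeasurable (fun τ => D τ v) ν

/-- The bilinear form `f, g ↦ ∫ ⟪f, A⁻¹ g⟫ dν`. -/
def invForm {T : Type*} [MeasurableSpace T] (ν : Measure T) (a : T → ℝ) (b : T → ℂ)
    (f g : T → ℂ) : ℝ :=
  ∫ τ, (inner ℝ (f τ) (invCov (a τ) (b τ) (g τ)) : ℝ) ∂ν

section

variable {T H : Type*} [MeasurableSpace T] [NormedAddCommGroup H] [NormedSpace ℝ H]
  {ν : Measure T} [IsProbabilityMeasure ν] {S : Set T} {a : T → ℝ} {b : T → ℂ}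
  {D : T → H →L[ℝ] ℂ} {c Dm : ℝ}

omit [IsProbabilityMeasure ν] in
lemma aemeasurable_inner_invCov {f g : T → ℂ} (ha : AEMeasurable a ν) (hb : AEMeasurable b ν)
    (hf : AEMeasurable f ν) (hg : AEMeasurable g ν) :
    AEMeasurable (fun τ => (inner ℝ (f τ) (invCov (a τ) (b τ) (g τ)) : ℝ)) ν := by
  simp only [invCov_apply]
  refine hf.inner (AEMeasurable.mul ?_ ?_)
  · exact Complex.measurable_ofReal.comp_aemeasurable
      (aemeasurable_const.div ((ha.pow_const 2).sub (hb.norm.pow_const 2)))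
  · exact ((Complex.measurable_ofReal.comp_aemeasurable ha).mul hg).sub
      (hb.mul (Complex.continuous_conj.measurable.comp_aemeasurable hg))

lemma abs_inner_invCov_le (hc : 0 < c) {a : ℝ} {b : ℂ} (h : c ≤ a - ‖b‖) (y z : ℂ) :
    |(inner ℝ y (invCov a b z) : ℝ)| ≤ 2 / c * (‖y‖ * ‖z‖) := by
  refine (abs_real_inner_le_norm _ _).trans ?_
  calc ‖y‖ * ‖invCov a b z‖ ≤ ‖y‖ * (2 / c * ‖z‖) := by gcongr; exact norm_invCov_le hc h z
    _ = _ := by ring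

lemma IsQuadModel.integrable (M : IsQuadModel ν S a b D c Dm) {f g : T → ℂ}
    (hf : AEMeasurable f ν) (hg : AEMeasurable g ν) {Bf Bg : ℝ} (hfB : ∀ τ ∈ S, ‖f τ‖ ≤ Bf)
    (hgB : ∀ τ ∈ S, ‖g τ‖ ≤ Bg) :
    Integrable (fun τ => (inner ℝ (f τ) (invCov (a τ) (b τ) (g τ)) : ℝ)) ν := by
  refine Integrable.of_bound (aemeasurable_inner_invCov M.aemeasurable_a M.aemeasurable_b
    hf hg).aestronglyMeasurable (2 / c * (Bf * Bg)) ?_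
  filter_upwards [M.ae_mem] with τ hτ
  refine (abs_inner_invCov_le M.c_pos (M.gap τ hτ) _ _).trans ?_
  have := M.c_pos
  have h1 := hfB τ hτ
  have h2 := hgB τ hτ
  have h3 : 0 ≤ Bf := (norm_nonneg _).trans h1
  gcongr

omit [IsProbabilityMeasure ν] in
lemma IsQuadModel.norm_D_apply_le (M : IsQuadModel ν S a b D c Dm) (v : H) {τ : T} (hτ : τ ∈ S) :
    ‖D τ v‖ ≤ Dm * ‖v‖ :=
  (D τ).le_of_opNorm_le (M.norm_D_le τ hτ) v

/-- Solving the normal equations completes the square. -/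
lemma IsQuadModel.invForm_sub_eq (M : IsQuadModel ν S a b D c Dm) {g : T → ℂ}
    (hg : AEMeasurable g ν) {Bg : ℝ} (hgB : ∀ τ ∈ S, ‖g τ‖ ≤ Bg) {v₀ : H}
    (hv₀ : ∀ v, invForm ν a b (fun τ => D τ v) g +
      invForm ν a b (fun τ => D τ v) (fun τ => D τ v₀) = 0) (v : H) :
    invForm ν a b (fun τ => g τ + D τ v) (fun τ => g τ + D τ v) =
      invForm ν a b (fun τ => g τ + D τ v₀) (fun τ => g τ + D τ v₀) +
      invForm ν a b (fun τ => D τ (v - v₀)) (fun τ => D τ (v - v₀)) := by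
  have hD := M.aemeasurable_D
  have hDB : ∀ v, ∀ τ ∈ S, ‖D τ v‖ ≤ Dm * ‖v‖ := fun v τ hτ => M.norm_D_apply_le v hτ
  have e : ∀ τ, (inner ℝ (g τ + D τ v) (invCov (a τ) (b τ) (g τ + D τ v)) : ℝ) =
      (inner ℝ (g τ + D τ v₀) (invCov (a τ) (b τ) (g τ + D τ v₀)) +
      inner ℝ (D τ (v - v₀)) (invCov (a τ) (b τ) (D τ (v - v₀)))) +
      2 * (inner ℝ (D τ (v - v₀)) (invCov (a τ) (b τ) (g τ)) +
        inner ℝ (D τ (v - v₀)) (invCov (a τ) (b τ) (D τ v₀))) := fun τ => by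
    have e1 : g τ + D τ v = (g τ + D τ v₀) + D τ (v - v₀) := by rw [map_sub]; ring
    rw [e1]
    simp only [map_add, inner_add_left, inner_add_right]
    rw [invCov_symm _ _ (g τ) (D τ (v - v₀)), invCov_symm _ _ (D τ v₀) (D τ (v - v₀))]
    ring
  have hg0 : ∀ v, ∀ τ ∈ S, ‖g τ + D τ v‖ ≤ Bg + Dm * ‖v‖ := fun v τ hτ =>
    (norm_add_le _ _).trans (add_le_add (hgB τ hτ) (hDB v τ hτ))
  have i1 := M.integrable (hg.add (hD v₀)) (hg.add (hD v₀)) (hg0 v₀) (hg0 v₀)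
  have i2 := M.integrable (hD (v - v₀)) (hD (v - v₀)) (hDB _) (hDB _)
  have i3 := M.integrable (hD (v - v₀)) hg (hDB _) hgB
  have i4 := M.integrable (hD (v - v₀)) (hD v₀) (hDB _) (hDB _)
  have h0 := hv₀ (v - v₀)
  unfold invForm at *
  simp_rw [e]
  have i12 : Integrable (fun τ => (inner ℝ (g τ + D τ v₀) (invCov (a τ) (b τ) (g τ + D τ v₀)) : ℝ) +
      inner ℝ (D τ (v - v₀)) (invCov (a τ) (b τ) (D τ (v - v₀)))) ν := i1.add i2
  have i34 : Integrable (fun τ => (inner ℝ (D τ (v - v₀)) (invCov (a τ) (b τ) (g τ)) : ℝ) +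
        inner ℝ (D τ (v - v₀)) (invCov (a τ) (b τ) (D τ v₀))) ν := i3.add i4
  rw [integral_add i12 (i34.const_mul 2), integral_add (by exact i1) i2, integral_const_mul,
    integral_add i3 i4, h0, mul_zero, add_zero]

lemma sq_integral_norm_le {g : T → ℂ} (hg : AEMeasurable g ν) {Bg : ℝ}
    (hgB : ∀ᵐ τ ∂ν, ‖g τ‖ ≤ Bg) : (∫ τ, ‖g τ‖ ∂ν) ^ 2 ≤ ∫ τ, ‖g τ‖ ^ 2 ∂ν := by
  have h1 : MemLp (fun τ => ‖g τ‖) 2 ν :=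
    MemLp.of_bound hg.norm.aestronglyMeasurable Bg (hgB.mono fun τ h => by rwa [norm_norm])
  have := variance_nonneg (fun τ => ‖g τ‖) ν
  rw [variance_eq_sub h1] at this
  simpa using this

/-- The solution of the normal equations is controlled by the mean square residual. -/
lemma IsQuadModel.norm_solution_le (M : IsQuadModel ν S a b D c Dm) {γ : ℝ} (hγ : 0 < γ)
    (hpos : ∀ v : H, γ * ‖v‖ ^ 2 ≤ invForm ν a b (fun τ => D τ v) (fun τ => D τ v)) {g : T → ℂ}
    (hg : AEMeasurable g ν) {Bg : ℝ} (hgB : ∀ τ ∈ S, ‖g τ‖ ≤ Bg) {v₀ : H}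
    (hv₀ : ∀ v, invForm ν a b (fun τ => D τ v) g +
      invForm ν a b (fun τ => D τ v) (fun τ => D τ v₀) = 0) :
    ‖v₀‖ ^ 2 ≤ (2 * Dm / (c * γ)) ^ 2 * ∫ τ, ‖g τ‖ ^ 2 ∂ν := by
  have hc := M.c_pos
  have hDm := M.Dm_nonneg
  have hgae : ∀ᵐ τ ∂ν, ‖g τ‖ ≤ Bg := M.ae_mem.mono fun τ hτ => hgB τ hτ
  have h1 : |invForm ν a b (fun τ => D τ v₀) g| ≤ 2 / c * (Dm * ‖v₀‖) * ∫ τ, ‖g τ‖ ∂ν := by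
    rw [invForm, ← integral_const_mul, ← Real.norm_eq_abs]
    have hi : Integrable (fun τ => ‖g τ‖) ν := Integrable.of_bound hg.norm.aestronglyMeasurable Bg
      (hgae.mono fun τ h => by rwa [norm_norm])
    refine norm_integral_le_of_norm_le (hi.const_mul _) ?_
    filter_upwards [M.ae_mem] with τ hτ
    refine (abs_inner_invCov_le hc (M.gap τ hτ) _ _).trans ?_
    have := M.norm_D_apply_le v₀ hτ
    calc 2 / c * (‖D τ v₀‖ * ‖g τ‖) ≤ 2 / c * (Dm * ‖v₀‖ * ‖g τ‖) := by gcongr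
      _ = _ := by ring
  have h2 : γ * ‖v₀‖ ^ 2 ≤ 2 / c * (Dm * ‖v₀‖) * ∫ τ, ‖g τ‖ ∂ν := by
    have := hv₀ v₀
    have := hpos v₀
    have := (abs_le.1 h1).1
    linarith
  have hI : 0 ≤ ∫ τ, ‖g τ‖ ∂ν := integral_nonneg fun _ => norm_nonneg _
  have h3 : ‖v₀‖ ≤ 2 * Dm / (c * γ) * ∫ τ, ‖g τ‖ ∂ν := by
    rcases (norm_nonneg v₀).eq_or_lt with h | h
    · rw [← h]; positivity
    · have : γ * ‖v₀‖ ≤ 2 / c * Dm * ∫ τ, ‖g τ‖ ∂ν := by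
        refine le_of_mul_le_mul_right ?_ h
        calc _ = γ * ‖v₀‖ ^ 2 := by ring
          _ ≤ _ := h2
          _ = _ := by ring
      rw [← sub_nonneg] at this ⊢
      have e : 2 * Dm / (c * γ) * ∫ τ, ‖g τ‖ ∂ν - ‖v₀‖ =
        γ⁻¹ * (2 / c * Dm * ∫ τ, ‖g τ‖ ∂ν - γ * ‖v₀‖) := by field_simp
      rw [e]
      positivity
  calc ‖v₀‖ ^ 2 ≤ (2 * Dm / (c * γ) * ∫ τ, ‖g τ‖ ∂ν) ^ 2 := by gcongr
    _ = (2 * Dm / (c * γ)) ^ 2 * (∫ τ, ‖g τ‖ ∂ν) ^ 2 := by ring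
    _ ≤ _ := by gcongr; exact sq_integral_norm_le hg hgae

omit [IsProbabilityMeasure ν] in
-- Replacing the integrand by its positive part can only increase the integral, so no sign is
-- needed. The lower bound on the criterion contains a subtracted error and may be negative at some
-- frequencies.
lemma ofReal_integral_le_lintegral_ofReal {f : T → ℝ} (hf : Integrable f ν) :
    ENNReal.ofReal (∫ τ, f τ ∂ν) ≤ ∫⁻ τ, ENNReal.ofReal (f τ) ∂ν := by
  have h : ∫ τ, f τ ∂ν ≤ ∫ τ, max (f τ) 0 ∂ν :=
    integral_mono hf hf.pos_part fun τ => le_max_left _ _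
  refine (ENNReal.ofReal_le_ofReal h).trans (le_of_eq ?_)
  rw [ofReal_integral_eq_lintegral_ofReal hf.pos_part (ae_of_all _ fun τ => le_max_right _ _)]
  refine lintegral_congr fun τ => ?_
  rw [ENNReal.ofReal_max, ENNReal.ofReal_zero, max_eq_left zero_le]

/-- Perturbing the linearisation changes the quadratic expansion by a small relative amount. -/
lemma abs_inner_invCov_sub_le (hc : 0 < c) {a : ℝ} {b : ℂ} (h : c ≤ a - ‖b‖) {C η r G : ℝ}
    (hC : 0 ≤ C) (hη0 : 0 ≤ η) (hη1 : η ≤ 1) (hr : 0 ≤ r) {y g e : ℂ}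
    (he : ‖e‖ ≤ G * r) (hy : ‖y - (g + e)‖ ≤ 2 * η * r) :
    |(inner ℝ y (invCov a b y) : ℝ) - inner ℝ (g + e) (invCov a b (g + e))| + C * η * ‖y‖ ^ 2 ≤
      (32 / c + 16 * C) * (1 + G ^ 2) * η * (‖g‖ ^ 2 + r ^ 2) := by
  set l := g + e with hl
  have e1 : (inner ℝ y (invCov a b y) : ℝ) - inner ℝ l (invCov a b l) =
      inner ℝ (y - l) (invCov a b (y + l)) := by
    simp only [map_add, inner_sub_left, inner_add_right]
    rw [invCov_symm a b l y]
    ring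
  have hl2 : ‖l‖ ^ 2 ≤ 2 * ‖g‖ ^ 2 + 2 * G ^ 2 * r ^ 2 := by
    have h1 : ‖l‖ ≤ ‖g‖ + G * r := (norm_add_le _ _).trans (by linarith)
    have h2 : ‖l‖ ^ 2 ≤ (‖g‖ + G * r) ^ 2 := by gcongr
    nlinarith [sq_nonneg (‖g‖ - G * r)]
  have hyl : ‖y‖ ≤ ‖l‖ + 2 * η * r := by
    have := norm_sub_norm_le y l
    linarith
  have hyl' : ‖y‖ ≤ ‖l‖ + 2 * r := by nlinarith
  have hy2 : ‖y‖ ^ 2 ≤ 2 * ‖l‖ ^ 2 + 8 * r ^ 2 := by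
    have h2 : ‖y‖ ^ 2 ≤ (‖l‖ + 2 * r) ^ 2 := by gcongr
    nlinarith [sq_nonneg (‖l‖ - 2 * r)]
  have h3 : |(inner ℝ (y - l) (invCov a b (y + l)) : ℝ)| ≤
      2 / c * (2 * η * r * (2 * ‖l‖ + 2 * r)) := by
    refine (abs_inner_invCov_le hc h _ _).trans ?_
    have : ‖y + l‖ ≤ 2 * ‖l‖ + 2 * r := (norm_add_le _ _).trans (by linarith)
    gcongr
  have h4 : r * (2 * ‖l‖ + 2 * r) ≤ ‖l‖ ^ 2 + 3 * r ^ 2 := by nlinarith [sq_nonneg (‖l‖ - r)]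
  have h5 : 2 / c * (2 * η * r * (2 * ‖l‖ + 2 * r)) ≤ 4 / c * η * (‖l‖ ^ 2 + 3 * r ^ 2) := by
    calc _ = 4 / c * η * (r * (2 * ‖l‖ + 2 * r)) := by ring
      _ ≤ _ := by gcongr
  have hQ : ‖l‖ ^ 2 + 4 * r ^ 2 ≤ 8 * ((1 + G ^ 2) * (‖g‖ ^ 2 + r ^ 2)) := by
    nlinarith [sq_nonneg ‖g‖, sq_nonneg (G * ‖g‖), sq_nonneg (G * r), sq_nonneg r]
  rw [e1]
  calc _ ≤ 4 / c * η * (‖l‖ ^ 2 + 4 * r ^ 2) + C * η * (2 * (‖l‖ ^ 2 + 4 * r ^ 2)) := by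
        refine add_le_add (h3.trans (h5.trans ?_)) ?_
        · gcongr; norm_num
        · gcongr; linarith
    _ ≤ 4 / c * η * (8 * ((1 + G ^ 2) * (‖g‖ ^ 2 + r ^ 2))) +
        C * η * (2 * (8 * ((1 + G ^ 2) * (‖g‖ ^ 2 + r ^ 2)))) := by gcongr
    _ = _ := by ring

/-- A minimiser of a criterion that is close to the integrated quadratic one is close to the
solution of the normal equations. -/
theorem IsQuadModel.norm_sub_sq_le (M : IsQuadModel ν S a b D c Dm) {γ : ℝ} (hγ : 0 < γ)
    (hpos : ∀ v : H, γ * ‖v‖ ^ 2 ≤ invForm ν a b (fun τ => D τ v) (fun τ => D τ v))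
    {C : ℝ} (hC : 0 ≤ C) {η : ℝ} (hη0 : 0 ≤ η) (hη1 : η ≤ 1)
    (hηγ : 4 * ((32 / c + 16 * C) * (1 + Dm ^ 2)) * η ≤ γ) {n : ℕ} (hn : 1 ≤ n) {g : T → ℂ}
    (hg : AEMeasurable g ν) {Bg : ℝ} (hgB : ∀ τ ∈ S, ‖g τ‖ ≤ Bg) {v₀ v₁ : H}
    (hv₀ : ∀ v, invForm ν a b (fun τ => D τ v) g +
      invForm ν a b (fun τ => D τ v) (fun τ => D τ v₀) = 0)
    {y : H → T → ℂ} {F : H → T → ℝ≥0∞}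
    (hy : ∀ v ∈ ({v₀, v₁} : Set H), ∀ τ ∈ S, ‖y v τ - (g τ + D τ v)‖ ≤ 2 * η * ‖v‖)
    (hF : ∀ v ∈ ({v₀, v₁} : Set H), ∀ τ ∈ S,
      ENNReal.ofReal (n * ((inner ℝ (y v τ) (invCov (a τ) (b τ) (y v τ)) : ℝ) -
        C * η * ‖y v τ‖ ^ 2)) ≤ F v τ ∧
      F v τ ≤ ENNReal.ofReal (n * ((inner ℝ (y v τ) (invCov (a τ) (b τ) (y v τ)) : ℝ) +
        C * η * ‖y v τ‖ ^ 2)))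
    (hmin : ∫⁻ τ, F v₁ τ ∂ν ≤ ∫⁻ τ, F v₀ τ ∂ν) :
    ‖v₁ - v₀‖ ^ 2 ≤ 2 / γ * ((32 / c + 16 * C) * (1 + Dm ^ 2)) *
      (2 + 3 * (2 * Dm / (c * γ)) ^ 2) * η * ∫ τ, ‖g τ‖ ^ 2 ∂ν := by
  have hc := M.c_pos
  set K := (32 / c + 16 * C) * (1 + Dm ^ 2) with hK
  have hK0 : 0 ≤ K := by positivity
  set W := ∫ τ, ‖g τ‖ ^ 2 ∂ν with hW
  have hW0 : 0 ≤ W := integral_nonneg fun _ => by positivity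
  have hn0 : (0 : ℝ) < n := by exact_mod_cast hn
  have hgae : ∀ᵐ τ ∂ν, ‖g τ‖ ≤ Bg := M.ae_mem.mono fun τ hτ => hgB τ hτ
  have hg2 : Integrable (fun τ => ‖g τ‖ ^ 2) ν :=
    Integrable.of_bound (hg.norm.pow_const 2).aestronglyMeasurable (Bg ^ 2)
      (hgae.mono fun τ h => by rw [norm_pow, norm_norm]; gcongr)
  have hlB : ∀ v, ∀ τ ∈ S, ‖g τ + D τ v‖ ≤ Bg + Dm * ‖v‖ := fun v τ hτ =>
    (norm_add_le _ _).trans (add_le_add (hgB τ hτ) (M.norm_D_apply_le v hτ))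
  have hLi : ∀ v, Integrable (fun τ => (inner ℝ (g τ + D τ v)
      (invCov (a τ) (b τ) (g τ + D τ v)) : ℝ)) ν := fun v =>
    M.integrable (hg.add (M.aemeasurable_D v)) (hg.add (M.aemeasurable_D v)) (hlB v) (hlB v)
  have hEi : ∀ v : H, Integrable (fun τ => K * η * (‖g τ‖ ^ 2 + ‖v‖ ^ 2)) ν := fun v =>
    (hg2.add (integrable_const _)).const_mul _
  have hEint : ∀ v : H, ∫ τ, K * η * (‖g τ‖ ^ 2 + ‖v‖ ^ 2) ∂ν = K * η * (W + ‖v‖ ^ 2) := fun v => by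
    rw [integral_const_mul, integral_add hg2 (integrable_const _)]
    simp [hW]
  set L : H → ℝ := fun v => invForm ν a b (fun τ => g τ + D τ v) (fun τ => g τ + D τ v) with hL
  have hpt : ∀ v ∈ ({v₀, v₁} : Set H), ∀ τ ∈ S, 
      |(inner ℝ (y v τ) (invCov (a τ) (b τ) (y v τ)) : ℝ) -
        inner ℝ (g τ + D τ v) (invCov (a τ) (b τ) (g τ + D τ v))| + C * η * ‖y v τ‖ ^ 2 ≤
      K * η * (‖g τ‖ ^ 2 + ‖v‖ ^ 2) := fun v hv τ hτ =>
    abs_inner_invCov_sub_le hc (M.gap τ hτ) hC hη0 hη1 (norm_nonneg v)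
      (M.norm_D_apply_le v hτ) (hy v hv τ hτ)
  have hlow : ENNReal.ofReal (n * (L v₁ - K * η * (W + ‖v₁‖ ^ 2))) ≤ ∫⁻ τ, F v₁ τ ∂ν := by
    have e : n * (L v₁ - K * η * (W + ‖v₁‖ ^ 2)) = ∫ τ, n * ((inner ℝ (g τ + D τ v₁)
        (invCov (a τ) (b τ) (g τ + D τ v₁)) : ℝ) - K * η * (‖g τ‖ ^ 2 + ‖v₁‖ ^ 2)) ∂ν := by
      rw [integral_const_mul, integral_sub (hLi v₁) (hEi v₁), hEint]
      rfl
    rw [e]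
    have hi : Integrable (fun τ => n * ((inner ℝ (g τ + D τ v₁)
        (invCov (a τ) (b τ) (g τ + D τ v₁)) : ℝ) - K * η * (‖g τ‖ ^ 2 + ‖v₁‖ ^ 2))) ν :=
      ((hLi v₁).sub (hEi v₁)).const_mul _
    refine (ofReal_integral_le_lintegral_ofReal hi).trans (lintegral_mono_ae ?_)
    filter_upwards [M.ae_mem] with τ hτ
    refine le_trans (ENNReal.ofReal_le_ofReal ?_) (hF v₁ (by simp) τ hτ).1
    refine mul_le_mul_of_nonneg_left ?_ hn0.le
    have h1 := hpt v₁ (by simp) τ hτ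
    have h2 := neg_abs_le ((inner ℝ (y v₁ τ) (invCov (a τ) (b τ) (y v₁ τ)) : ℝ) -
        inner ℝ (g τ + D τ v₁) (invCov (a τ) (b τ) (g τ + D τ v₁)))
    linarith
  have hLn : 0 ≤ L v₀ := by
    refine integral_nonneg_of_ae ?_
    filter_upwards [M.ae_mem] with τ hτ using inner_invCov_self_nonneg hc (M.gap τ hτ) _
  have hup : ∫⁻ τ, F v₀ τ ∂ν ≤ ENNReal.ofReal (n * (L v₀ + K * η * (W + ‖v₀‖ ^ 2))) := by
    have e : n * (L v₀ + K * η * (W + ‖v₀‖ ^ 2)) = ∫ τ, n * ((inner ℝ (g τ + D τ v₀)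
        (invCov (a τ) (b τ) (g τ + D τ v₀)) : ℝ) + K * η * (‖g τ‖ ^ 2 + ‖v₀‖ ^ 2)) ∂ν := by
      rw [integral_const_mul, integral_add (hLi v₀) (hEi v₀), hEint]
      rfl
    have hi : Integrable (fun τ => n * ((inner ℝ (g τ + D τ v₀)
        (invCov (a τ) (b τ) (g τ + D τ v₀)) : ℝ) + K * η * (‖g τ‖ ^ 2 + ‖v₀‖ ^ 2))) ν :=
      ((hLi v₀).add (hEi v₀)).const_mul _
    rw [e, ofReal_integral_eq_lintegral_ofReal hi]
    · refine lintegral_mono_ae ?_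
      filter_upwards [M.ae_mem] with τ hτ
      refine le_trans (hF v₀ (by simp) τ hτ).2 (ENNReal.ofReal_le_ofReal ?_)
      refine mul_le_mul_of_nonneg_left ?_ hn0.le
      have h1 := hpt v₀ (by simp) τ hτ
      have h2 := le_abs_self ((inner ℝ (y v₀ τ) (invCov (a τ) (b τ) (y v₀ τ)) : ℝ) -
        inner ℝ (g τ + D τ v₀) (invCov (a τ) (b τ) (g τ + D τ v₀)))
      linarith
    · filter_upwards [M.ae_mem] with τ hτ
      refine mul_nonneg hn0.le (add_nonneg (inner_invCov_self_nonneg hc (M.gap τ hτ) _) ?_)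
      positivity
  -- Nonnegativity of `L v₀` is essential for returning from `ENNReal.ofReal` to real numbers, since
  -- truncation at zero would lose the inequality.
  have hcmp : L v₁ - K * η * (W + ‖v₁‖ ^ 2) ≤ L v₀ + K * η * (W + ‖v₀‖ ^ 2) := by
    have := hlow.trans (hmin.trans hup)
    rw [ENNReal.ofReal_le_ofReal_iff (by positivity)] at this
    exact le_of_mul_le_mul_left this hn0
  have hsq : L v₁ = L v₀ + invForm ν a b (fun τ => D τ (v₁ - v₀)) (fun τ => D τ (v₁ - v₀)) :=
    M.invForm_sub_eq hg hgB hv₀ v₁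
  have hp := hpos (v₁ - v₀)
  have hsol := M.norm_solution_le hγ hpos hg hgB hv₀
  set B := (2 * Dm / (c * γ)) ^ 2
  have hv1 : ‖v₁‖ ^ 2 ≤ 2 * ‖v₁ - v₀‖ ^ 2 + 2 * ‖v₀‖ ^ 2 := by
    have h1 : ‖v₁‖ ≤ ‖v₁ - v₀‖ + ‖v₀‖ := by simpa using norm_add_le (v₁ - v₀) v₀
    have h2 : ‖v₁‖ ^ 2 ≤ (‖v₁ - v₀‖ + ‖v₀‖) ^ 2 := by gcongr
    nlinarith [sq_nonneg (‖v₁ - v₀‖ - ‖v₀‖)]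
  have hKη : 0 ≤ K * η := by positivity
  have h1 : K * η * (W + ‖v₁‖ ^ 2 + (W + ‖v₀‖ ^ 2)) ≤
      K * η * (2 * ‖v₁ - v₀‖ ^ 2 + (2 + 3 * B) * W) := by
    refine mul_le_mul_of_nonneg_left ?_ hKη
    linarith
  -- The hypothesis `4 K η ≤ γ` lets half of the curvature term absorb the part of the error
  -- involving `v₁ - v₀`. What remains is `2 W + 3 ‖v₀‖²`, hence the factor `2 + 3 B`.
  have h2 : 2 * (K * η * (2 * ‖v₁ - v₀‖ ^ 2)) ≤ γ * ‖v₁ - v₀‖ ^ 2 := by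
    calc _ = 4 * K * η * ‖v₁ - v₀‖ ^ 2 := by ring
      _ ≤ _ := by gcongr
  have h3 : γ * ‖v₁ - v₀‖ ^ 2 ≤ 2 * (K * η * ((2 + 3 * B) * W)) := by
    rw [mul_add] at h1
    linarith
  calc ‖v₁ - v₀‖ ^ 2 ≤ γ⁻¹ * (2 * (K * η * ((2 + 3 * B) * W))) := by
        rw [le_inv_mul_iff₀ hγ]; exact h3
    _ = _ := by ring

end

end CCFEL
end

noncomputable section

namespace CCFEL

/-! ### Elementary properties of the residuals -/

section Residual

variable {d p : ℕ} {κ : Vec p → Kernel (Vec d) (Vec d)} {w : Freq d → Vec d → ℂ}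
  {S : Set (Freq d)} {θ : Vec p}

/-- The residual as a function of the transition. -/
def transResidual (κ : Vec p → Kernel (Vec d) (Vec d)) (w : Freq d → Vec d → ℂ) (θ : Vec p)
    (τ : Freq d) (z : Vec d × Vec d) : ℂ :=
  residual κ w τ θ z.1 z.2

/-- The gradient in `θ` of the residual, as a function of the transition. -/
def transGrad (κ : Vec p → Kernel (Vec d) (Vec d)) (w : Freq d → Vec d → ℂ) (θ : Vec p)
    (τ : Freq d) (z : Vec d × Vec d) : Vec p →L[ℝ] ℂ :=
  fderiv ℝ (fun η => transResidual κ w η τ z) θ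

lemma measurable_ccf [IsMarkovKernel (κ θ)] :
    Measurable fun q : Vec d × Vec d => ccf κ q.1 θ q.2 := by
  let κ' : Kernel (Vec d × Vec d) (Vec d) := (κ θ).comap Prod.snd measurable_snd
  have h : StronglyMeasurable fun q : Vec d × Vec d =>
      ∫ y, Complex.exp ((inner ℝ y q.1 : ℝ) * Complex.I) ∂(κ' q) := by
    refine StronglyMeasurable.integral_kernel_prod_right
      (f := fun (q : Vec d × Vec d) y => Complex.exp ((inner ℝ y q.1 : ℝ) * Complex.I)) ?_
    refine Continuous.stronglyMeasurable ?_
    simp only [Function.uncurry_def]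
    fun_prop
  exact h.measurable

lemma measurable_transResidual [IsMarkovKernel (κ θ)] (hw : IsWeight S w) :
    Measurable fun q : Freq d × (Vec d × Vec d) => transResidual κ w θ q.1 q.2 := by
  have h1 : Measurable fun q : Freq d × (Vec d × Vec d) => w q.1 q.2.1 :=
    hw.measurable.comp (measurable_fst.prodMk measurable_snd.fst)
  have h2 : Measurable fun q : Freq d × (Vec d × Vec d) => ccf κ q.1.1 θ q.2.1 :=
    measurable_ccf.comp (measurable_fst.fst.prodMk measurable_snd.fst)
  have h3 : Continuous fun q : Freq d × (Vec d × Vec d) =>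
      Complex.exp ((inner ℝ q.1.1 q.2.2 : ℝ) * Complex.I) := by fun_prop
  exact h1.mul (h3.measurable.sub h2)

lemma norm_transResidual_le [IsMarkovKernel (κ θ)] (hw : IsWeight S w) (τ : Freq d)
    (z : Vec d × Vec d) : ‖transResidual κ w θ τ z‖ ≤ 2 := by
  rw [transResidual, residual, norm_mul, hw.norm_eq_one, one_mul]
  refine (norm_sub_le _ _).trans ?_
  rw [Complex.norm_exp_ofReal_mul_I]
  have := norm_charFun_le_one (μ := κ θ z.1) τ.1
  rw [ccf]
  linarith

lemma continuousOn_transResidual [IsMarkovKernel (κ θ)] (hw : IsWeight S w) (z : Vec d × Vec d) :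
    ContinuousOn (fun τ => transResidual κ w θ τ z) S := by
  refine (hw.continuousOn z.1).mul (Continuous.continuousOn (Continuous.sub (by fun_prop) ?_))
  exact continuous_charFun.comp continuous_fst

lemma integral_transResidual_eq_zero [IsMarkovKernel (κ θ)] (τ : Freq d) (x : Vec d) :
    ∫ y, transResidual κ w θ τ (x, y) ∂(κ θ x) = 0 := by
  have hi : Integrable (fun y => Complex.exp ((inner ℝ τ.1 y : ℝ) * Complex.I)) (κ θ x) := by
    refine Integrable.of_bound (Continuous.aestronglyMeasurable (by fun_prop)) 1
      (ae_of_all _ fun y => ?_)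
    rw [Complex.norm_exp_ofReal_mul_I]
  simp only [transResidual, residual]
  rw [integral_const_mul, integral_sub hi (integrable_const _)]
  simp [ccf, charFun_apply, real_inner_comm]

lemma transResidual_neg (hw : IsWeight S w) (τ : Freq d) (z : Vec d × Vec d) :
    transResidual κ w θ (-τ) z = conj (transResidual κ w θ τ z) := by
  simp only [transResidual, residual, map_mul, map_sub, hw.conj_symm, ccf, Prod.fst_neg,
    charFun_neg, ← Complex.exp_conj, inner_neg_left, Complex.conj_ofReal, Complex.conj_I]
  push_cast
  ring_nf

/-- The symmetry of the weight and of characteristic functions makes the second entry redundant.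
This reduces complex `2 × 2` covariances to the two scalars `E|ε|²` and `E ε²`. -/
lemma residualPair_eq (hw : IsWeight S w) (τ : Freq d) (z : Vec d × Vec d) :
    residualPair κ w τ θ z.1 z.2 =
      ![transResidual κ w θ τ z, conj (transResidual κ w θ τ z)] := by
  rw [← transResidual_neg hw]
  rfl

lemma hasFDerivAt_transResidual {τ : Freq d} {z : Vec d × Vec d}
    (h : DifferentiableAt ℝ (fun η => ccf κ τ.1 η z.1) θ) :
    HasFDerivAt (fun η => transResidual κ w η τ z) (transGrad κ w θ τ z) θ ∧
      transGrad κ w θ τ z = -(w τ z.1 • fderiv ℝ (fun η => ccf κ τ.1 η z.1) θ) := by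
  have h1 : HasFDerivAt (fun η => transResidual κ w η τ z)
      (-(w τ z.1 • fderiv ℝ (fun η => ccf κ τ.1 η z.1) θ)) θ := by
    have := (h.hasFDerivAt.const_sub (Complex.exp ((inner ℝ τ.1 z.2 : ℝ) * Complex.I))).const_mul
      (w τ z.1)
    rwa [smul_neg] at this
  have h2 : transGrad κ w θ τ z = _ := h1.fderiv
  exact ⟨h2 ▸ h1, h2⟩

end Residual

/-- A set of transitions at which the characteristic function is smooth, uniformly in the
frequency. -/
structure IsSmoothAt {d p : ℕ} (κ : Vec p → Kernel (Vec d) (Vec d)) (S : Set (Freq d))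
    (U : Set (Vec p)) (M : Vec d → ℝ) (x : Vec d) : Prop where
  differentiableAt : ∀ τ ∈ S, ∀ θ ∈ U, DifferentiableAt ℝ (fun η => ccf κ τ.1 η x) θ
  continuousOn : ContinuousOn
    (fun q : Freq d × Vec p => fderiv ℝ (fun θ => ccf κ q.1.1 θ x) q.2) (S ×ˢ U)
  norm_fderiv_le : ∀ τ ∈ S, ∀ θ ∈ U, ‖fderiv ℝ (fun θ' => ccf κ τ.1 θ' x) θ‖ ≤ M x

section Grad

variable {d p : ℕ} {κ : Vec p → Kernel (Vec d) (Vec d)} {w : Freq d → Vec d → ℂ}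
  {S : Set (Freq d)} {U : Set (Vec p)} {M : Vec d → ℝ}

lemma IsSmoothAt.norm_transGrad_le {z : Vec d × Vec d} (h : IsSmoothAt κ S U M z.1)
    (hw : IsWeight S w) {τ : Freq d} (hτ : τ ∈ S) {θ : Vec p} (hθ : θ ∈ U) :
    ‖transGrad κ w θ τ z‖ ≤ M z.1 := by
  rw [(hasFDerivAt_transResidual (h.differentiableAt τ hτ θ hθ)).2, norm_neg, norm_smul,
    hw.norm_eq_one, one_mul]
  exact h.norm_fderiv_le τ hτ θ hθ

lemma IsSmoothAt.continuousOn_transGrad {z : Vec d × Vec d} (h : IsSmoothAt κ S U M z.1)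
    (hw : IsWeight S w) :
    ContinuousOn (fun q : Freq d × Vec p => transGrad κ w q.2 q.1 z) (S ×ˢ U) := by
  have h1 : ContinuousOn (fun q : Freq d × Vec p =>
      -(w q.1 z.1 • fderiv ℝ (fun η => ccf κ q.1.1 η z.1) q.2)) (S ×ˢ U) :=
    (((hw.continuousOn z.1).comp continuousOn_fst fun q hq => hq.1).smul h.continuousOn).neg
  exact h1.congr fun q hq => (hasFDerivAt_transResidual (h.differentiableAt _ hq.1 _ hq.2)).2

/-- Directional derivatives are limits of difference quotients with step `1 / (n + 1)`, each
measurable in the transition. The index is shifted by `N` so that the displaced parameter stays in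
`U`, where the kernels are Markov. Finitely many directions determine the linear map. -/
lemma aemeasurable_transGrad {μ : Measure (Vec d × Vec d)} (hU : IsOpen U)
    (hκ : ∀ θ ∈ U, IsMarkovKernel (κ θ)) (hw : IsWeight S w)
    (hsm : ∀ᵐ z ∂μ, IsSmoothAt κ S U M z.1) {τ : Freq d} (hτ : τ ∈ S) {θ : Vec p} (hθ : θ ∈ U) :
    AEMeasurable (transGrad κ w θ τ) μ := by
  have hcomp : ∀ v : Vec p, AEMeasurable (fun z => transGrad κ w θ τ z v) μ := by
    intro v
    have ht : Tendsto (fun n : ℕ => ((n : ℝ) + 1)⁻¹) atTop (𝓝 0) := by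
      simpa using tendsto_one_div_add_atTop_nhds_zero_nat (𝕜 := ℝ)
    have hev : ∀ᶠ n : ℕ in atTop, θ + ((n : ℝ) + 1)⁻¹ • v ∈ U := by
      have : Tendsto (fun n : ℕ => θ + ((n : ℝ) + 1)⁻¹ • v) atTop (𝓝 θ) := by
        simpa using (ht.smul_const v).const_add θ
      exact this.eventually (hU.mem_nhds hθ)
    obtain ⟨N, hN⟩ := eventually_atTop.1 hev
    refine aemeasurable_of_tendsto_metrizable_ae atTop (f := fun n z => (((n + N : ℕ) : ℝ) + 1) •
      (transResidual κ w (θ + (((n + N : ℕ) : ℝ) + 1)⁻¹ • v) τ z - transResidual κ w θ τ z))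
      (fun n => ?_) ?_
    · have := hκ θ hθ
      have := hκ _ (hN (n + N) (Nat.le_add_left N n))
      have h1 : ∀ η, IsMarkovKernel (κ η) → Measurable (transResidual κ w η τ) := fun η _ =>
        (measurable_transResidual hw).comp measurable_prodMk_left
      exact (((h1 _ this).sub (h1 _ (hκ θ hθ))).const_smul (((n + N : ℕ) : ℝ) + 1)).aemeasurable
    · filter_upwards [hsm] with z hz
      have hd := (hasFDerivAt_transResidual (w := w) (hz.differentiableAt τ hτ θ hθ)).1
      have := hd.lim v (c := fun n : ℕ => (((n + N : ℕ) : ℝ) + 1)) (l := atTop) ?_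
      · exact this
      · refine tendsto_norm_atTop_atTop.comp ?_
        exact (tendsto_atTop_add_const_right _ _ (tendsto_natCast_atTop_atTop.comp
          (tendsto_add_atTop_nat N)))
  have e : transGrad κ w θ τ = fun z => ∑ j, (ContinuousLinearMap.smulRightL ℝ (Vec p) ℂ
      (EuclideanSpace.proj j : Vec p →L[ℝ] ℝ))
      (transGrad κ w θ τ z (EuclideanSpace.single j 1)) := by
    ext z v
    have hv : v = ∑ j, v j • EuclideanSpace.single j (1 : ℝ) := by
      ext i
      simp [Finset.sum_apply, Pi.single_apply]
    conv_lhs => rw [hv, map_sum]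
    simp
  rw [e]
  exact Finset.aemeasurable_fun_sum _ fun j _ =>
    (ContinuousLinearMap.continuous _).measurable.comp_aemeasurable (hcomp _)

end Grad

end CCFEL
end

noncomputable section

namespace CCFEL

/-! ### Uniform laws of large numbers for the residuals -/

/-- The law of the first transition. -/
abbrev pairLaw {Ω : Type*} [MeasurableSpace Ω] {d : ℕ} (P : Measure Ω) (X : ℕ → Ω → Vec d) :
    Measure (Vec d × Vec d) :=
  P.map (fun ω => (X 0 ω, X 1 ω))

/-- `E |ε(τ; θ)|²`. -/
def residualVar {Ω : Type*} [MeasurableSpace Ω] {d p : ℕ} (P : Measure Ω) (X : ℕ → Ω → Vec d)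
    (κ : Vec p → Kernel (Vec d) (Vec d)) (w : Freq d → Vec d → ℂ) (θ : Vec p) (τ : Freq d) : ℝ :=
  ∫ z, ‖transResidual κ w θ τ z‖ ^ 2 ∂(pairLaw P X)

/-- `E ε(τ; θ)²`. -/
def residualPseudoVar {Ω : Type*} [MeasurableSpace Ω] {d p : ℕ} (P : Measure Ω)
    (X : ℕ → Ω → Vec d) (κ : Vec p → Kernel (Vec d) (Vec d)) (w : Freq d → Vec d → ℂ)
    (θ : Vec p) (τ : Freq d) : ℂ :=
  ∫ z, transResidual κ w θ τ z ^ 2 ∂(pairLaw P X)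

/-- `E ∂ε(τ; θ)/∂θ`. -/
def meanGrad {Ω : Type*} [MeasurableSpace Ω] {d p : ℕ} (P : Measure Ω)
    (X : ℕ → Ω → Vec d) (κ : Vec p → Kernel (Vec d) (Vec d)) (w : Freq d → Vec d → ℂ)
    (θ : Vec p) (τ : Freq d) : Vec p →L[ℝ] ℂ :=
  ∫ z, transGrad κ w θ τ z ∂(pairLaw P X)

/-- Paths on which the sample moments of the first `n` residuals are `η`-close to their
expectations, uniformly in the frequency. -/
structure IsTypicalPath {Ω : Type*} [MeasurableSpace Ω] {d p : ℕ} (P : Measure Ω)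
    (X : ℕ → Ω → Vec d) (κ : Vec p → Kernel (Vec d) (Vec d)) (w : Freq d → Vec d → ℂ)
    (S : Set (Freq d)) (θ₀ : Vec p) (ρ : ℝ) (M : Vec d → ℝ) (n : ℕ) (η : ℝ) (x : ℕ → Vec d) :
    Prop where
  mean : ∀ τ ∈ S, ‖avg n (transResidual κ w θ₀ τ) x‖ < η
  var : ∀ τ ∈ S,
    |avg n (fun z => ‖transResidual κ w θ₀ τ z‖ ^ 2) x - residualVar P X κ w θ₀ τ| < η
  pseudoVar : ∀ τ ∈ S,
    ‖avg n (fun z => transResidual κ w θ₀ τ z ^ 2) x - residualPseudoVar P X κ w θ₀ τ‖ < η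
  grad : ∀ τ ∈ S, ∀ θ ∈ Metric.closedBall θ₀ ρ,
    ‖avg n (transGrad κ w θ τ) x - meanGrad P X κ w θ τ‖ < η
  envelope : avg n (fun z => M z.1) x < ∫ x, M x ∂(P.map (X 0)) + 1

section

variable {Ω : Type*} [mΩ : MeasurableSpace Ω] {P : Measure Ω} [IsProbabilityMeasure P] {d p : ℕ}
  {X : ℕ → Ω → Vec d} {κ : Vec p → Kernel (Vec d) (Vec d)} {w : Freq d → Vec d → ℂ}
  {S : Set (Freq d)} {θ₀ : Vec p} {U : Set (Vec p)} {M : Vec d → ℝ}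

omit [IsProbabilityMeasure P] in
lemma measurePreserving_fst_pairLaw [IsMarkovKernel (κ θ₀)]
    (hX : IsStationaryMarkov P X (κ θ₀)) :
    MeasurePreserving Prod.fst (pairLaw P X) (P.map (X 0)) :=
  ⟨measurable_fst, by rw [Measure.map_map measurable_fst (hX.measurable_pair 0)]; rfl⟩

lemma isProbabilityMeasure_pairLaw [IsMarkovKernel (κ θ₀)]
    (hX : IsStationaryMarkov P X (κ θ₀)) : IsProbabilityMeasure (pairLaw P X) :=
  Measure.isProbabilityMeasure_map (hX.measurable_pair 0).aemeasurable

lemma measurable_transResidual_right {θ : Vec p} [IsMarkovKernel (κ θ)] (hw : IsWeight S w)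
    (τ : Freq d) : Measurable (transResidual κ w θ τ) :=
  (measurable_transResidual hw).comp measurable_prodMk_left

lemma integral_pairLaw_transResidual [IsMarkovKernel (κ θ₀)]
    (hX : IsStationaryMarkov P X (κ θ₀)) (hw : IsWeight S w) (τ : Freq d) :
    ∫ z, transResidual κ w θ₀ τ z ∂(pairLaw P X) = 0 := by
  have h := hX.integral_mul_eq_zero 0 (W := fun _ => 1) measurable_const (b := 1)
    (fun _ => by simp) (measurable_transResidual_right hw τ) (norm_transResidual_le hw τ)
    (integral_transResidual_eq_zero τ)
  rw [integral_map (hX.measurable_pair 0).aemeasurable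
    (measurable_transResidual_right hw τ).aestronglyMeasurable]
  simpa using h

lemma continuousOn_residualVar [IsMarkovKernel (κ θ₀)] (hX : IsStationaryMarkov P X (κ θ₀))
    (hmix : ExpAlphaMixing P X) (hw : IsWeight S w) (hS : IsCompact S) :
    ContinuousOn (residualVar P X κ w θ₀) S ∧
    ∀ ε > 0, Tendsto (fun n : ℕ => P {ω | ¬ ∀ τ ∈ S,
      ‖avg n (fun z => ‖transResidual κ w θ₀ τ z‖ ^ 2) (fun t => X t ω) -
        residualVar P X κ w θ₀ τ‖ < ε}) atTop (𝓝 0) := by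
  have := isProbabilityMeasure_pairLaw hX
  refine exists_uniform_lln hX hmix hS (f := fun τ z => ‖transResidual κ w θ₀ τ z‖ ^ 2)
    (M := fun _ => 2 ^ 2) (integrable_const _)
    (fun τ _ => ((measurable_transResidual_right hw τ).norm.pow_const 2).aemeasurable)
    (ae_of_all _ fun z => (continuousOn_transResidual hw z).norm.pow 2)
    (ae_of_all _ fun z τ _ => ?_)
  rw [norm_pow, norm_norm]
  have := norm_transResidual_le (κ := κ) (θ := θ₀) hw τ z
  gcongr

lemma continuousOn_residualPseudoVar [IsMarkovKernel (κ θ₀)]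
    (hX : IsStationaryMarkov P X (κ θ₀)) (hmix : ExpAlphaMixing P X) (hw : IsWeight S w)
    (hS : IsCompact S) :
    ContinuousOn (residualPseudoVar P X κ w θ₀) S ∧
    ∀ ε > 0, Tendsto (fun n : ℕ => P {ω | ¬ ∀ τ ∈ S,
      ‖avg n (fun z => transResidual κ w θ₀ τ z ^ 2) (fun t => X t ω) -
        residualPseudoVar P X κ w θ₀ τ‖ < ε}) atTop (𝓝 0) := by
  have := isProbabilityMeasure_pairLaw hX
  refine exists_uniform_lln hX hmix hS (f := fun τ z => transResidual κ w θ₀ τ z ^ 2)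
    (M := fun _ => 2 ^ 2) (integrable_const _)
    (fun τ _ => ((measurable_transResidual_right hw τ).pow_const 2).aemeasurable)
    (ae_of_all _ fun z => (continuousOn_transResidual hw z).pow 2)
    (ae_of_all _ fun z τ _ => ?_)
  rw [norm_pow]
  have := norm_transResidual_le (κ := κ) (θ := θ₀) hw τ z
  gcongr

lemma tendsto_measure_avg_transResidual [IsMarkovKernel (κ θ₀)]
    (hX : IsStationaryMarkov P X (κ θ₀)) (hmix : ExpAlphaMixing P X) (hw : IsWeight S w)
    (hS : IsCompact S) {ε : ℝ} (hε : 0 < ε) :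
    Tendsto (fun n : ℕ => P {ω | ¬ ∀ τ ∈ S,
      ‖avg n (transResidual κ w θ₀ τ) (fun t => X t ω)‖ < ε}) atTop (𝓝 0) := by
  have := isProbabilityMeasure_pairLaw hX
  have h := (exists_uniform_lln hX hmix hS (f := fun τ z => transResidual κ w θ₀ τ z)
    (M := fun _ => 2) (integrable_const _)
    (fun τ _ => (measurable_transResidual_right hw τ).aemeasurable)
    (ae_of_all _ fun z => continuousOn_transResidual hw z)
    (ae_of_all _ fun z τ _ => norm_transResidual_le hw τ z)).2 ε hε
  simp_rw [integral_pairLaw_transResidual hX hw, sub_zero] at h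
  exact h

omit [IsProbabilityMeasure P] in
lemma ae_pairLaw_isSmoothAt [IsMarkovKernel (κ θ₀)] (hX : IsStationaryMarkov P X (κ θ₀))
    (hsm : ∀ᵐ x ∂(P.map (X 0)), IsSmoothAt κ S U M x) :
    ∀ᵐ z ∂(pairLaw P X), IsSmoothAt κ S U M z.1 :=
  (measurePreserving_fst_pairLaw hX).quasiMeasurePreserving.ae hsm

omit [IsProbabilityMeasure P] in
lemma integrable_transGrad [IsMarkovKernel (κ θ₀)] (hX : IsStationaryMarkov P X (κ θ₀))
    (hw : IsWeight S w) (hU : IsOpen U) (hκ : ∀ θ ∈ U, IsMarkovKernel (κ θ))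
    (hM : Integrable M (P.map (X 0))) (hsm : ∀ᵐ x ∂(P.map (X 0)), IsSmoothAt κ S U M x)
    {τ : Freq d} (hτ : τ ∈ S) {θ : Vec p} (hθ : θ ∈ U) :
    Integrable (transGrad κ w θ τ) (pairLaw P X) := by
  have hae := ae_pairLaw_isSmoothAt hX hsm
  refine Integrable.mono' ((measurePreserving_fst_pairLaw hX).integrable_comp_of_integrable hM)
    (aemeasurable_transGrad hU hκ hw hae hτ hθ).aestronglyMeasurable ?_
  exact hae.mono fun z hz => hz.norm_transGrad_le hw hτ hθ

lemma continuousOn_meanGrad [IsMarkovKernel (κ θ₀)] (hX : IsStationaryMarkov P X (κ θ₀))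
    (hmix : ExpAlphaMixing P X) (hw : IsWeight S w) (hS : IsCompact S) (hU : IsOpen U)
    (hκ : ∀ θ ∈ U, IsMarkovKernel (κ θ))
    (hM : Integrable M (P.map (X 0))) (hsm : ∀ᵐ x ∂(P.map (X 0)), IsSmoothAt κ S U M x)
    {ρ : ℝ} (hρ : Metric.closedBall θ₀ ρ ⊆ U) :
    ContinuousOn (fun q : Freq d × Vec p => meanGrad P X κ w q.2 q.1)
      (S ×ˢ Metric.closedBall θ₀ ρ) ∧
    ∀ ε > 0, Tendsto (fun n : ℕ => P {ω | ¬ ∀ q ∈ S ×ˢ Metric.closedBall θ₀ ρ,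
      ‖avg n (transGrad κ w q.2 q.1) (fun t => X t ω) - meanGrad P X κ w q.2 q.1‖ < ε})
      atTop (𝓝 0) := by
  have hae := ae_pairLaw_isSmoothAt hX hsm
  have hprop : ProperSpace (Vec p →L[ℝ] ℂ) := FiniteDimensional.proper ℝ _
  exact exists_uniform_lln hX hmix (hS.prod (isCompact_closedBall θ₀ ρ))
    (f := fun q z => transGrad κ w q.2 q.1 z) (M := fun z => M z.1)
    ((measurePreserving_fst_pairLaw hX).integrable_comp_of_integrable hM)
    (fun q hq => aemeasurable_transGrad hU hκ hw hae hq.1 (hρ hq.2))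
    (hae.mono fun z hz => (hz.continuousOn_transGrad hw).mono (Set.prod_mono le_rfl hρ))
    (hae.mono fun z hz q hq => hz.norm_transGrad_le hw hq.1 (hρ hq.2))

/-- Paths are typical with probability tending to one. -/
theorem tendsto_measure_not_isTypicalPath [IsMarkovKernel (κ θ₀)]
    (hX : IsStationaryMarkov P X (κ θ₀))
    (hmix : ExpAlphaMixing P X) (hw : IsWeight S w) (hS : IsCompact S) (hU : IsOpen U)
    (hκ : ∀ θ ∈ U, IsMarkovKernel (κ θ))
    (hM : Integrable M (P.map (X 0))) (hsm : ∀ᵐ x ∂(P.map (X 0)), IsSmoothAt κ S U M x)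
    {ρ : ℝ} (hρ : Metric.closedBall θ₀ ρ ⊆ U) {η : ℝ} (hη : 0 < η) :
    Tendsto (fun n : ℕ => P {ω | ¬ IsTypicalPath P X κ w S θ₀ ρ M n η (fun t => X t ω)})
      atTop (𝓝 0) := by
  have hM' := (measurePreserving_fst_pairLaw hX).integrable_comp_of_integrable hM
  have h1 := tendsto_measure_avg_transResidual hX hmix hw hS hη
  have h2 := (continuousOn_residualVar hX hmix hw hS).2 η hη
  have h3 := (continuousOn_residualPseudoVar hX hmix hw hS).2 η hη
  have h4 := (continuousOn_meanGrad hX hmix hw hS hU hκ hM hsm hρ).2 η hη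
  have h5 := tendsto_measure_avg_sub hX hmix hM' one_pos
  have hsum := ((((h1.add h2).add h3).add h4).add h5)
  simp only [add_zero] at hsum
  refine tendsto_of_tendsto_of_tendsto_of_le_of_le tendsto_const_nhds hsum (fun _ => zero_le)
    fun n => ?_
  refine le_trans (measure_mono ?_) ((measure_union_le _ _).trans (add_le_add
    ((measure_union_le _ _).trans (add_le_add ((measure_union_le _ _).trans (add_le_add
      (measure_union_le _ _) le_rfl)) le_rfl)) le_rfl))
  intro ω hω
  by_contra hcon
  simp only [Set.mem_union, Set.mem_ofPred_eq, not_or, not_not] at hcon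
  obtain ⟨⟨⟨⟨c1, c2⟩, c3⟩, c4⟩, c5⟩ := hcon
  refine hω ⟨c1, c2, c3, fun τ hτ θ hθ => c4 (τ, θ) ⟨hτ, hθ⟩, ?_⟩
  have e : ∫ z, (M ∘ Prod.fst) z ∂(pairLaw P X) = ∫ x, M x ∂(P.map (X 0)) := by
    rw [← (measurePreserving_fst_pairLaw hX).map_eq, integral_map measurable_fst.aemeasurable]
    · rfl
    · rw [(measurePreserving_fst_pairLaw hX).map_eq]; exact hM.1
  rw [e] at c5
  have := (abs_lt.1 (lt_of_not_ge c5)).2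
  have h6 : avg n (M ∘ Prod.fst) (fun t => X t ω) = avg n (fun z => M z.1) (fun t => X t ω) := rfl
  linarith

end

/-! ### Expansion of the likelihood on typical paths -/

section

variable {Ω : Type*} [mΩ : MeasurableSpace Ω] {P : Measure Ω} {d p : ℕ}
  {X : ℕ → Ω → Vec d} {κ : Vec p → Kernel (Vec d) (Vec d)} {w : Freq d → Vec d → ℂ}
  {S : Set (Freq d)} {θ₀ : Vec p} {U : Set (Vec p)} {M : Vec d → ℝ}

lemma norm_avg_le {E : Type*} [NormedAddCommGroup E] [NormedSpace ℝ E] {F : Vec d × Vec d → E}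
    {G : Vec d × Vec d → ℝ} {x : ℕ → Vec d} (h : ∀ t, ‖F (x t, x (t + 1))‖ ≤ G (x t, x (t + 1)))
    (n : ℕ) : ‖avg n F x‖ ≤ avg n G x := by
  rw [avg, avg, norm_smul, norm_inv, RCLike.norm_natCast, smul_eq_mul]
  gcongr
  exact (norm_sum_le _ _).trans (Finset.sum_le_sum fun t _ => h t)

lemma avg_sub {E : Type*} [NormedAddCommGroup E] [NormedSpace ℝ E] (n : ℕ)
    (F G : Vec d × Vec d → E) (x : ℕ → Vec d) :
    avg n (fun z => F z - G z) x = avg n F x - avg n G x := by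
  simp [avg, smul_sub]

lemma avg_mul_const (n : ℕ) (F : Vec d × Vec d → ℝ) (c : ℝ) (x : ℕ → Vec d) :
    avg n (fun z => c * F z) x = c * avg n F x := by
  simp only [avg, smul_eq_mul, ← Finset.mul_sum]
  ring

lemma norm_transResidual_sub_le (hw : IsWeight S w) {r : ℝ} (hr : Metric.closedBall θ₀ r ⊆ U)
    {z : Vec d × Vec d} (hz : IsSmoothAt κ S U M z.1) {τ : Freq d} (hτ : τ ∈ S) {θ : Vec p}
    (hθ : θ ∈ Metric.closedBall θ₀ r) :
    ‖transResidual κ w θ τ z - transResidual κ w θ₀ τ z‖ ≤ M z.1 * ‖θ - θ₀‖ := by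
  have hr0 : 0 ≤ r := dist_nonneg.trans hθ
  exact (convex_closedBall θ₀ r).norm_image_sub_le_of_norm_hasFDerivWithin_le
    (f' := fun η => transGrad κ w η τ z)
    (fun η hη => (hasFDerivAt_transResidual
      (hz.differentiableAt τ hτ η (hr hη))).1.hasFDerivWithinAt)
    (fun η hη => hz.norm_transGrad_le hw hτ (hr hη)) (Metric.mem_closedBall_self hr0) hθ

/-- The mean value inequality for the average minus a fixed linear map. The averaged gradient at a
nearby parameter is within `η` of its mean by typicality, and that mean is within `η` of its value
at `θ₀`; hence `2 η`, without second derivatives. -/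
lemma IsTypicalPath.norm_avg_transResidual_sub_le {ρ r η : ℝ} {n : ℕ} {x : ℕ → Vec d}
    (hx : IsTypicalPath P X κ w S θ₀ ρ M n η x) (hsm : ∀ t, IsSmoothAt κ S U M (x t))
    (hr : r ≤ ρ) (hρ : Metric.closedBall θ₀ ρ ⊆ U) {τ : Freq d} (hτ : τ ∈ S)
    (hD : ∀ θ ∈ Metric.closedBall θ₀ r,
      ‖meanGrad P X κ w θ τ - meanGrad P X κ w θ₀ τ‖ ≤ η)
    {θ : Vec p} (hθ : θ ∈ Metric.closedBall θ₀ r) :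
    ‖avg n (transResidual κ w θ τ) x -
      (avg n (transResidual κ w θ₀ τ) x + meanGrad P X κ w θ₀ τ (θ - θ₀))‖ ≤
      2 * η * ‖θ - θ₀‖ := by
  have hr0 : 0 ≤ r := dist_nonneg.trans hθ
  have hsub : Metric.closedBall θ₀ r ⊆ Metric.closedBall θ₀ ρ :=
    Metric.closedBall_subset_closedBall hr
  have := (convex_closedBall θ₀ r).norm_image_sub_le_of_norm_hasFDerivWithin_le'
    (f := fun η => avg n (transResidual κ w η τ) x) (C := 2 * η)
    (f' := fun η => avg n (transGrad κ w η τ) x) (φ := meanGrad P X κ w θ₀ τ)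
    (fun η hη => ?_) (fun η' hη => ?_) (Metric.mem_closedBall_self hr0) hθ
  · rwa [sub_sub] at this
  · refine HasFDerivAt.hasFDerivWithinAt ?_
    have h1 : HasFDerivAt (fun η => ∑ t ∈ Finset.range n, transResidual κ w η τ (x t, x (t + 1)))
        (∑ t ∈ Finset.range n, transGrad κ w η τ (x t, x (t + 1))) η :=
      HasFDerivAt.fun_sum fun t _ => (hasFDerivAt_transResidual
        ((hsm t).differentiableAt τ hτ η (hρ (hsub hη)))).1
    exact h1.const_smul _
  · have h1 := (hx.grad τ hτ η' (hsub hη)).le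
    have h2 := hD η' hη
    have := norm_add_le (avg n (transGrad κ w η' τ) x - meanGrad P X κ w η' τ)
      (meanGrad P X κ w η' τ - meanGrad P X κ w θ₀ τ)
    rw [sub_add_sub_cancel] at this
    linarith

/-- On a typical path the empirical likelihood ratio is approximately quadratic near `θ₀`. -/
theorem IsTypicalPath.elLogRatio_expansion {ρ r η c Dm : ℝ} {n : ℕ} {x : ℕ → Vec d}
    (hx : IsTypicalPath P X κ w S θ₀ ρ M n η x) (hsm : ∀ t, IsSmoothAt κ S U M (x t))
    (hn : 1 ≤ n) (hw : IsWeight S w) (hκ : ∀ θ ∈ U, IsMarkovKernel (κ θ))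
    (hr : r ≤ ρ) (hρ : Metric.closedBall θ₀ ρ ⊆ U) {τ : Freq d} (hτ : τ ∈ S)
    (hD : ∀ θ ∈ Metric.closedBall θ₀ r,
      ‖meanGrad P X κ w θ τ - meanGrad P X κ w θ₀ τ‖ ≤ η)
    (hDm : ‖meanGrad P X κ w θ₀ τ‖ ≤ Dm) (hc : 0 < c)
    (hgap : c ≤ residualVar P X κ w θ₀ τ - ‖residualPseudoVar P X κ w θ₀ τ‖)
    (hη1 : 3 * η ≤ 1) (hηc : 32 * (3 * η) ≤ c)
    (hrM : 8 * (∫ x, M x ∂(P.map (X 0)) + 1) * r ≤ η) (hrD : (Dm + 1) * r ≤ η)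
    {θ : Vec p} (hθ : θ ∈ Metric.closedBall θ₀ r) :
    let y := avg n (transResidual κ w θ τ) x
    let T := invCov (residualVar P X κ w θ₀ τ) (residualPseudoVar P X κ w θ₀ τ)
    ENNReal.ofReal (n * ((inner ℝ y (T y) : ℝ) -
        (12 / c ^ 2 + 16384 / c ^ 3) * (3 * η) * ‖y‖ ^ 2)) ≤
      elLogRatio (fun t : Fin n => residualVec κ w τ θ (x t) (x (t + 1))) ∧
    elLogRatio (fun t : Fin n => residualVec κ w τ θ (x t) (x (t + 1))) ≤
      ENNReal.ofReal (n * ((inner ℝ y (T y) : ℝ) +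
        (12 / c ^ 2 + 16384 / c ^ 3) * (3 * η) * ‖y‖ ^ 2)) := by
  intro y T
  have hr0 : 0 ≤ r := dist_nonneg.trans hθ
  have hsub : Metric.closedBall θ₀ r ⊆ U := (Metric.closedBall_subset_closedBall hr).trans hρ
  have hθr : ‖θ - θ₀‖ ≤ r := mem_closedBall_iff_norm.1 hθ
  have hη0 : 0 < η := (norm_nonneg _).trans_lt (hx.mean τ hτ)
  have hb0 : ∀ z, ‖transResidual κ w θ₀ τ z‖ ≤ 2 := by
    have := hκ θ₀ (hsub (Metric.mem_closedBall_self hr0))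
    exact norm_transResidual_le hw τ
  have hb : ∀ z, ‖transResidual κ w θ τ z‖ ≤ 2 := by
    have := hκ θ (hsub hθ)
    exact norm_transResidual_le hw τ
  have hcast : ∀ (F : Vec d × Vec d → ℂ), avg n F x =
      (n : ℂ)⁻¹ * ∑ t : Fin n, F (x t, x (t + 1)) := fun F => by
    rw [avg, Complex.real_smul, Fin.sum_univ_eq_sum_range (fun t => F (x t, x (t + 1)))]
    push_cast
    rfl
  have hcast' : ∀ (F : Vec d × Vec d → ℝ), avg n F x =
      (n : ℝ)⁻¹ * ∑ t : Fin n, F (x t, x (t + 1)) := fun F => by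
    rw [avg, smul_eq_mul, Fin.sum_univ_eq_sum_range (fun t => F (x t, x (t + 1)))]
  set m := ∫ x, M x ∂(P.map (X 0)) + 1 with hm
  have hsm' : ∀ t, ‖transResidual κ w θ τ (x t, x (t + 1)) -
      transResidual κ w θ₀ τ (x t, x (t + 1))‖ ≤ M (x t) * r := fun t => by
    have hM0 : 0 ≤ M (x t) := (norm_nonneg _).trans ((hsm t).norm_fderiv_le τ hτ θ₀
      (hsub (Metric.mem_closedBall_self hr0)))
    exact (norm_transResidual_sub_le hw hsub (z := (x t, x (t + 1))) (hsm t) hτ hθ).trans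
      (by gcongr)
  have henv : avg n (fun z => 4 * r * M z.1) x ≤ 4 * r * m := by
    rw [avg_mul_const n (fun z => M z.1)]
    have := hx.envelope.le
    gcongr
  have hvar : |avg n (fun z => ‖transResidual κ w θ τ z‖ ^ 2) x -
      avg n (fun z => ‖transResidual κ w θ₀ τ z‖ ^ 2) x| ≤ 4 * r * m := by
    rw [← avg_sub, ← Real.norm_eq_abs]
    refine (norm_avg_le (G := fun z => 4 * r * M z.1) (fun t => ?_) n).trans henv
    rw [sq_sub_sq, norm_mul, Real.norm_eq_abs, Real.norm_eq_abs]
    set z := (x t, x (t + 1))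
    have h1 : |‖transResidual κ w θ τ z‖ + ‖transResidual κ w θ₀ τ z‖| ≤ 4 := by
      rw [abs_of_nonneg (by positivity)]; linarith [hb z, hb0 z]
    have h2 := (abs_norm_sub_norm_le (transResidual κ w θ τ z) (transResidual κ w θ₀ τ z)).trans
      (hsm' t)
    calc _ ≤ 4 * (M (x t) * r) := by gcongr
      _ = _ := by ring
  have hpseudo : ‖avg n (fun z => transResidual κ w θ τ z ^ 2) x -
      avg n (fun z => transResidual κ w θ₀ τ z ^ 2) x‖ ≤ 4 * r * m := by
    rw [← avg_sub]
    refine (norm_avg_le (G := fun z => 4 * r * M z.1) (fun t => ?_) n).trans henv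
    rw [sq_sub_sq, norm_mul]
    set z := (x t, x (t + 1))
    have h1 : ‖transResidual κ w θ τ z + transResidual κ w θ₀ τ z‖ ≤ 4 :=
      (norm_add_le _ _).trans (by linarith [hb z, hb0 z])
    calc _ ≤ 4 * (M (x t) * r) := by gcongr; exact hsm' t
      _ = _ := by ring
  have hy : ‖y‖ ≤ 3 * η := by
    have h1 := hx.norm_avg_transResidual_sub_le hsm hr hρ hτ hD hθ
    have h2 : ‖meanGrad P X κ w θ₀ τ (θ - θ₀)‖ ≤ Dm * r :=
      ((meanGrad P X κ w θ₀ τ).le_of_opNorm_le hDm _).trans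
        (mul_le_mul_of_nonneg_left hθr ((norm_nonneg _).trans hDm))
    have h3 := (hx.mean τ hτ).le
    have h4 := norm_add_le (avg n (transResidual κ w θ τ) x -
      (avg n (transResidual κ w θ₀ τ) x + meanGrad P X κ w θ₀ τ (θ - θ₀)))
      (avg n (transResidual κ w θ₀ τ) x + meanGrad P X κ w θ₀ τ (θ - θ₀))
    rw [sub_add_cancel] at h4
    have h5 := norm_add_le (avg n (transResidual κ w θ₀ τ) x) (meanGrad P X κ w θ₀ τ (θ - θ₀))
    have h6 : 2 * η * ‖θ - θ₀‖ ≤ 1 * r := by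
      have : 0 ≤ ‖θ - θ₀‖ := norm_nonneg _
      gcongr
      linarith
    have h7 : ‖y‖ ≤ 2 * η := by
      have : ‖y‖ = ‖avg n (transResidual κ w θ τ) x‖ := rfl
      linarith
    linarith
  -- The error budget is `3 η`: each of the two second moments contributes `η` by typicality at `θ₀`
  -- and at most `4 r m` for moving from `θ₀` to `θ`, and `8 m r ≤ η`.
  refine CCFEL.elLogRatio_expansion hn (fun t : Fin n => transResidual κ w θ τ (x t, x (t + 1)))
    (fun t => hb _) hc hgap hη1 hηc (hcast _).symm hy ?_
  rw [← hcast' (fun z => ‖transResidual κ w θ τ z‖ ^ 2),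
    ← hcast (fun z => transResidual κ w θ τ z ^ 2)]
  have h1 := hx.var τ hτ
  have h2 := hx.pseudoVar τ hτ
  have h3 := abs_sub_le (avg n (fun z => ‖transResidual κ w θ τ z‖ ^ 2) x)
    (avg n (fun z => ‖transResidual κ w θ₀ τ z‖ ^ 2) x) (residualVar P X κ w θ₀ τ)
  have h4 := norm_sub_le_norm_sub_add_norm_sub (avg n (fun z => transResidual κ w θ τ z ^ 2) x)
    (avg n (fun z => transResidual κ w θ₀ τ z ^ 2) x) (residualPseudoVar P X κ w θ₀ τ)
  linarith

end

end CCFEL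
end

noncomputable section

namespace CCFEL

/-! ### Mean squares of sample averages -/

section

variable {Ω : Type*} [mΩ : MeasurableSpace Ω] {P : Measure Ω} [IsProbabilityMeasure P] {d : ℕ}
  {X : ℕ → Ω → Vec d} {κ : Kernel (Vec d) (Vec d)} [IsMarkovKernel κ]

/-- Martingale differences are orthogonal: adding one term to the sum creates a cross term that
integrates to zero, so the second moments add. Mixing plays no role. -/
lemma integral_norm_sq_sum_le (hX : IsStationaryMarkov P X κ) {h : Vec d × Vec d → ℂ}
    (hh : Measurable h) {B : ℝ} (hB : ∀ z, ‖h z‖ ≤ B) (h0 : ∀ x, ∫ y, h (x, y) ∂(κ x) = 0)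
    (n : ℕ) :
    ∫ ω, ‖∑ t ∈ Finset.range n, h (X t ω, X (t + 1) ω)‖ ^ 2 ∂P ≤ n * B ^ 2 := by
  have hB0 : 0 ≤ B := (norm_nonneg _).trans (hB 0)
  have hm : ∀ t, Measurable fun ω => h (X t ω, X (t + 1) ω) := fun t =>
    hh.comp (hX.measurable_pair t)
  have hmS : ∀ n, Measurable fun ω => ∑ t ∈ Finset.range n, h (X t ω, X (t + 1) ω) := fun n =>
    Finset.measurable_fun_sum _ fun t _ => hm t
  have hbS : ∀ n ω, ‖∑ t ∈ Finset.range n, h (X t ω, X (t + 1) ω)‖ ≤ n * B := fun n ω => by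
    refine (norm_sum_le _ _).trans ((Finset.sum_le_sum fun t _ => hB _).trans (by simp))
  induction n with
  | zero => simp
  | succ n ih =>
    set s := fun ω => ∑ t ∈ Finset.range n, h (X t ω, X (t + 1) ω) with hs
    have hmp : Measurable[pastField X n] s := by
      refine Finset.measurable_fun_sum _ fun t ht => hh.comp ?_
      have ht' := Finset.mem_range.1 ht
      exact (measurable_pastField X ht'.le).prodMk (measurable_pastField X (by omega))
    have h1 := hX.integral_mul_eq_zero n (W := fun ω => conj (s ω))
      (Complex.continuous_conj.measurable.comp hmp) (b := n * B)
      (fun ω => by rw [RCLike.norm_conj]; exact hbS n ω) hh hB h0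
    have i0 : Integrable (fun ω => conj (s ω) * h (X n ω, X (n + 1) ω)) P :=
      Integrable.of_bound ((Complex.continuous_conj.measurable.comp (hmS n)).mul
        (hm n)).aestronglyMeasurable (n * B * B) (ae_of_all _ fun ω => by
          rw [norm_mul, RCLike.norm_conj]
          have := hbS n ω
          gcongr
          exact hB _)
    have i1 : Integrable (fun ω => ‖s ω‖ ^ 2) P :=
      Integrable.of_bound ((hmS n).norm.pow_const 2).aestronglyMeasurable ((n * B) ^ 2)
        (ae_of_all _ fun ω => by
          rw [norm_pow, norm_norm]
          have := hbS n ω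
          gcongr)
    have i2 : Integrable (fun ω => ‖h (X n ω, X (n + 1) ω)‖ ^ 2) P :=
      Integrable.of_bound ((hm n).norm.pow_const 2).aestronglyMeasurable (B ^ 2)
        (ae_of_all _ fun ω => by
          rw [norm_pow, norm_norm]
          have := hB (X n ω, X (n + 1) ω)
          gcongr)
    have e : ∀ ω, ‖∑ t ∈ Finset.range (n + 1), h (X t ω, X (t + 1) ω)‖ ^ 2 =
        ‖s ω‖ ^ 2 + ‖h (X n ω, X (n + 1) ω)‖ ^ 2 +
          2 * RCLike.re (conj (s ω) * h (X n ω, X (n + 1) ω)) := fun ω => by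
      rw [Finset.sum_range_succ]
      have := norm_add_sq_real (s ω) (h (X n ω, X (n + 1) ω))
      rw [this, Complex.inner]
      simp only [RCLike.re_eq_complex_re]
      ring_nf
    simp_rw [e]
    rw [integral_add (by exact i1.add i2) (i0.re.const_mul 2), integral_add i1 i2,
      integral_const_mul, integral_re i0, h1, map_zero, mul_zero, add_zero]
    have h3 : ∫ ω, ‖h (X n ω, X (n + 1) ω)‖ ^ 2 ∂P ≤ B ^ 2 := by
      refine (integral_mono i2 (integrable_const (B ^ 2)) fun ω => ?_).trans (by simp)
      have := hB (X n ω, X (n + 1) ω)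
      simp only
      gcongr
    push_cast
    linarith

lemma integral_norm_sq_avg_le (hX : IsStationaryMarkov P X κ) {h : Vec d × Vec d → ℂ}
    (hh : Measurable h) {B : ℝ} (hB : ∀ z, ‖h z‖ ≤ B) (h0 : ∀ x, ∫ y, h (x, y) ∂(κ x) = 0)
    {n : ℕ} (hn : 1 ≤ n) :
    ∫ ω, ‖avg n h (fun t => X t ω)‖ ^ 2 ∂P ≤ B ^ 2 / n := by
  have hn0 : (0 : ℝ) < n := by exact_mod_cast hn
  simp_rw [avg, norm_smul, mul_pow]
  rw [integral_const_mul, norm_inv, RCLike.norm_natCast, inv_pow]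
  have := integral_norm_sq_sum_le hX hh hB h0 n
  rw [inv_mul_le_iff₀ (by positivity)]
  refine this.trans (le_of_eq ?_)
  field_simp

lemma measurable_avg_uncurry {T : Type*} [MeasurableSpace T] (hX : ∀ t, Measurable (X t))
    {h : T → Vec d × Vec d → ℂ} (hh : Measurable fun q : T × (Vec d × Vec d) => h q.1 q.2) (n : ℕ) :
    Measurable fun q : T × Ω => avg n (h q.1) (fun t => X t q.2) := by
  unfold avg
  refine Measurable.const_smul (Finset.measurable_fun_sum _ fun t _ => ?_) _
  exact hh.comp (measurable_fst.prodMk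
    (((hX t).comp measurable_snd).prodMk ((hX (t + 1)).comp measurable_snd)))

/-- The integrated mean square of averages of centred residuals is of order `1 / n`. -/
lemma mul_measureReal_le_integral_norm_sq_avg (hX : IsStationaryMarkov P X κ) {T : Type*}
    [MeasurableSpace T] (ν : Measure T) [IsProbabilityMeasure ν] {h : T → Vec d × Vec d → ℂ}
    (hh : Measurable fun q : T × (Vec d × Vec d) => h q.1 q.2) {B : ℝ} (hB : ∀ τ z, ‖h τ z‖ ≤ B)
    (h0 : ∀ τ x, ∫ y, h τ (x, y) ∂(κ x) = 0) {n : ℕ} (hn : 1 ≤ n) (L : ℝ) :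
    L * P.real {ω | L ≤ n * ∫ τ, ‖avg n (h τ) (fun t => X t ω)‖ ^ 2 ∂ν} ≤ B ^ 2 := by
  have hn0 : (0 : ℝ) < n := by exact_mod_cast hn
  have hb : ∀ τ ω, ‖avg n (h τ) (fun t => X t ω)‖ ≤ B := fun τ ω => by
    refine (norm_avg_le (G := fun _ => B) (fun t => hB τ _) n).trans (le_of_eq ?_)
    simp [avg]
    field_simp
  have hi : Integrable (Function.uncurry fun (ω : Ω) (τ : T) =>
      ‖avg n (h τ) (fun t => X t ω)‖ ^ 2) (P.prod ν) := by
    refine Integrable.of_bound (((measurable_avg_uncurry hX.measurable hh n).comp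
      measurable_swap).norm.pow_const 2).aestronglyMeasurable (B ^ 2) (ae_of_all _ fun q => ?_)
    rw [Function.uncurry, norm_pow, norm_norm]
    have := hb q.2 q.1
    gcongr
  have h1 : ∫ ω, (n * ∫ τ, ‖avg n (h τ) (fun t => X t ω)‖ ^ 2 ∂ν) ∂P ≤ B ^ 2 := by
    rw [integral_const_mul, integral_integral_swap hi]
    have h2 : ∫ τ, ∫ ω, ‖avg n (h τ) (fun t => X t ω)‖ ^ 2 ∂P ∂ν ≤ ∫ _, B ^ 2 / n ∂ν :=
      integral_mono hi.swap.integral_prod_left (integrable_const _) fun τ =>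
        integral_norm_sq_avg_le hX (hh.comp measurable_prodMk_left) (hB τ) (h0 τ) hn
    rw [integral_const, probReal_univ, one_smul, le_div_iff₀ hn0] at h2
    linarith
  refine le_trans (mul_meas_ge_le_integral_of_nonneg (ae_of_all _ fun ω => ?_) ?_ L) h1
  · exact mul_nonneg hn0.le (integral_nonneg fun τ => by positivity)
  · exact hi.integral_prod_left.const_mul _

end

/-! ### The distribution of the frequencies -/

/-- The probability measure `π(τ) dτ`. -/
def freqMeasure {d : ℕ} (dens : Freq d → ℝ) : Measure (Freq d) :=
  volume.withDensity fun τ => ENNReal.ofReal (dens τ)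

section

variable {d : ℕ} {S : Set (Freq d)} {dens : Freq d → ℝ}

lemma IsFreqDensity.isProbabilityMeasure (h : IsFreqDensity S dens) :
    IsProbabilityMeasure (freqMeasure dens) := by
  have hi : Integrable dens := by
    by_contra hcon
    have := h.integral_eq_one
    rw [integral_undef hcon] at this
    exact zero_ne_one this
  refine ⟨?_⟩
  rw [freqMeasure, withDensity_apply _ MeasurableSet.univ, Measure.restrict_univ,
    ← ofReal_integral_eq_lintegral_ofReal hi (ae_of_all _ h.nonneg), h.integral_eq_one,
    ENNReal.ofReal_one]

lemma IsFreqDensity.ae_mem (h : IsFreqDensity S dens) : ∀ᵐ τ ∂(freqMeasure dens), τ ∈ S := by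
  rw [freqMeasure, ae_withDensity_iff h.measurable.ennreal_ofReal]
  refine ae_of_all _ fun τ hτ => ?_
  by_contra hcon
  rw [h.support τ hcon, ENNReal.ofReal_zero] at hτ
  exact hτ rfl

lemma IsFreqDensity.integral_eq (h : IsFreqDensity S dens) {E : Type*} [NormedAddCommGroup E]
    [NormedSpace ℝ E] (f : Freq d → E) :
    ∫ τ, f τ ∂(freqMeasure dens) = ∫ τ, dens τ • f τ := by
  rw [freqMeasure, integral_withDensity_eq_integral_toReal_smul h.measurable.ennreal_ofReal
    (ae_of_all _ fun τ => ENNReal.ofReal_lt_top)]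
  simp_rw [ENNReal.toReal_ofReal (h.nonneg _)]

lemma IsFreqDensity.lintegral_eq (h : IsFreqDensity S dens) (f : Freq d → ℝ≥0∞) :
    ∫⁻ τ, f τ ∂(freqMeasure dens) = ∫⁻ τ, f τ * ENNReal.ofReal (dens τ) := by
  rw [freqMeasure, lintegral_withDensity_eq_lintegral_mul_non_measurable₀ _
    h.measurable.ennreal_ofReal.aemeasurable (ae_of_all _ fun τ => ENNReal.ofReal_lt_top)]
  simp_rw [Pi.mul_apply, mul_comm]

end

/-! ### Integrals of the inverse covariance form -/

section

variable {T H Z : Type*} [MeasurableSpace T] [NormedAddCommGroup H] [NormedSpace ℝ H]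
  [MeasurableSpace Z] {ν : Measure T} [IsProbabilityMeasure ν] {S : Set T} {a : T → ℝ} {b : T → ℂ}
  {D : T → H →L[ℝ] ℂ} {c Dm : ℝ}

omit [IsProbabilityMeasure ν] in
lemma integral_inner_invCov (μ : Measure Z) {a : ℝ} {b y : ℂ} {h : Z → ℂ} (hh : Integrable h μ) :
    ∫ z, (inner ℝ y (invCov a b (h z)) : ℝ) ∂μ = inner ℝ y (invCov a b (∫ z, h z ∂μ)) :=
  ((innerSL ℝ y).comp (invCov a b)).integral_comp_comm hh

/-- Integrals with respect to a parameter can be taken inside the inverse covariance form. -/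
lemma IsQuadModel.integral_invForm (M : IsQuadModel ν S a b D c Dm) (μ : Measure Z)
    [IsProbabilityMeasure μ] {f : T → ℂ} (hf : AEMeasurable f ν) {Bf : ℝ}
    (hfB : ∀ τ ∈ S, ‖f τ‖ ≤ Bf) {h : T → Z → ℂ} (hh : Measurable fun q : T × Z => h q.1 q.2) {B : ℝ}
    (hB : ∀ τ ∈ S, ∀ z, ‖h τ z‖ ≤ B) :
    ∫ z, invForm ν a b f (fun τ => h τ z) ∂μ = invForm ν a b f (fun τ => ∫ z, h τ z ∂μ) := by
  have hae : ∀ᵐ q ∂(μ.prod ν), q.2 ∈ S := Measure.quasiMeasurePreserving_snd.ae M.ae_mem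
  have hi : Integrable (Function.uncurry fun (z : Z) (τ : T) =>
      (inner ℝ (f τ) (invCov (a τ) (b τ) (h τ z)) : ℝ)) (μ.prod ν) := by
    refine Integrable.of_bound (AEMeasurable.aestronglyMeasurable ?_) (2 / c * (Bf * B)) ?_
    · exact aemeasurable_inner_invCov (a := fun q : Z × T => a q.2) (b := fun q : Z × T => b q.2)
        (f := fun q : Z × T => f q.2) (g := fun q : Z × T => h q.2 q.1)
        (M.aemeasurable_a.comp_quasiMeasurePreserving Measure.quasiMeasurePreserving_snd)
        (M.aemeasurable_b.comp_quasiMeasurePreserving Measure.quasiMeasurePreserving_snd)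
        (hf.comp_quasiMeasurePreserving Measure.quasiMeasurePreserving_snd)
        (hh.comp measurable_swap).aemeasurable
    · filter_upwards [hae] with q hq
      refine (abs_inner_invCov_le M.c_pos (M.gap _ hq) _ _).trans ?_
      have := M.c_pos
      have h1 := hfB _ hq
      have h2 := hB _ hq q.1
      have h3 : 0 ≤ Bf := (norm_nonneg _).trans h1
      gcongr
  unfold invForm
  rw [integral_integral_swap hi]
  refine integral_congr_ae (M.ae_mem.mono fun τ hτ => ?_)
  exact integral_inner_invCov μ (Integrable.of_bound
    (hh.comp measurable_prodMk_left).aestronglyMeasurable B (ae_of_all _ (hB τ hτ)))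

lemma IsQuadModel.abs_invForm_le (M : IsQuadModel ν S a b D c Dm) {f g : T → ℂ} {Bf Bg : ℝ}
    (hfB : ∀ τ ∈ S, ‖f τ‖ ≤ Bf) (hgB : ∀ τ ∈ S, ‖g τ‖ ≤ Bg) :
    |invForm ν a b f g| ≤ 2 / c * (Bf * Bg) := by
  have := norm_integral_le_of_norm_le_const (μ := ν) (C := 2 / c * (Bf * Bg))
    (f := fun τ => (inner ℝ (f τ) (invCov (a τ) (b τ) (g τ)) : ℝ)) ?_
  · rw [invForm, ← Real.norm_eq_abs]
    simpa only [probReal_univ, mul_one] using this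
  · filter_upwards [M.ae_mem] with τ hτ
    refine (abs_inner_invCov_le M.c_pos (M.gap _ hτ) _ _).trans ?_
    have := M.c_pos
    have h1 := hfB _ hτ
    have h2 := hgB _ hτ
    have h3 : 0 ≤ Bf := (norm_nonneg _).trans h1
    gcongr

omit [IsProbabilityMeasure ν] in
lemma invForm_smul_right (r : ℝ) (f g : T → ℂ) :
    invForm ν a b f (fun τ => r • g τ) = r * invForm ν a b f g := by
  simp only [invForm, map_smul, real_inner_smul_right, integral_const_mul]

lemma IsQuadModel.invForm_sum_right (M : IsQuadModel ν S a b D c Dm) {f : T → ℂ}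
    (hf : AEMeasurable f ν) {Bf : ℝ} (hfB : ∀ τ ∈ S, ‖f τ‖ ≤ Bf) {ι : Type*} (s : Finset ι)
    {g : ι → T → ℂ} (hg : ∀ i, AEMeasurable (g i) ν) {Bg : ι → ℝ}
    (hgB : ∀ i, ∀ τ ∈ S, ‖g i τ‖ ≤ Bg i) :
    invForm ν a b f (fun τ => ∑ i ∈ s, g i τ) = ∑ i ∈ s, invForm ν a b f (g i) := by
  simp only [invForm, map_sum, inner_sum]
  exact integral_finsetSum s fun i _ => M.integrable hf (hg i) hfB (hgB i)

/-- The second moments of integrated scores, as iterated integrals. -/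
lemma IsQuadModel.integral_invForm_mul_invForm (M : IsQuadModel ν S a b D c Dm) (μ : Measure Z)
    [IsProbabilityMeasure μ] {f g : T → ℂ} (hf : AEMeasurable f ν) (hg : AEMeasurable g ν)
    {Bf Bg : ℝ} (hfB : ∀ τ ∈ S, ‖f τ‖ ≤ Bf) (hgB : ∀ τ ∈ S, ‖g τ‖ ≤ Bg) {h : T → Z → ℂ}
    (hh : Measurable fun q : T × Z => h q.1 q.2) {B : ℝ} (hB : ∀ τ ∈ S, ∀ z, ‖h τ z‖ ≤ B)
    (hm : Measurable fun z => invForm ν a b g (fun τ => h τ z)) :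
    ∫ z, invForm ν a b f (fun τ => h τ z) * invForm ν a b g (fun τ => h τ z) ∂μ =
      ∫ τ₁, ∫ τ₂, ∫ z, (inner ℝ (f τ₁) (invCov (a τ₁) (b τ₁) (h τ₁ z)) : ℝ) *
        inner ℝ (g τ₂) (invCov (a τ₂) (b τ₂) (h τ₂ z)) ∂μ ∂ν ∂ν := by
  have hc := M.c_pos
  -- The second score is a real scalar and can be moved onto the residual inside the first form. The
  -- exchange of integrals then applies twice, once for each factor.
  have h1 : ∀ z, invForm ν a b f (fun τ => h τ z) * invForm ν a b g (fun τ => h τ z) =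
      invForm ν a b f (fun τ => invForm ν a b g (fun τ => h τ z) • h τ z) := fun z => by
    rw [invForm_smul_right, mul_comm]
  simp_rw [h1]
  have hbs : ∀ τ ∈ S, ∀ z, ‖invForm ν a b g (fun τ => h τ z) • h τ z‖ ≤
      2 / c * (Bg * B) * B := fun τ hτ z => by
    rw [norm_smul, Real.norm_eq_abs]
    have h3 := hB τ hτ z
    have h4 := M.abs_invForm_le hgB fun τ hτ => hB τ hτ z
    have : 0 ≤ 2 / c * (Bg * B) := (abs_nonneg _).trans h4
    gcongr
  rw [M.integral_invForm μ hf hfB (h := fun τ z => invForm ν a b g (fun τ => h τ z) • h τ z)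
    ((hm.comp measurable_snd).smul hh) hbs, invForm]
  refine integral_congr_ae (M.ae_mem.mono fun τ₁ hτ₁ => ?_)
  have hh1 : Measurable (h τ₁) := hh.comp measurable_prodMk_left
  simp only
  rw [← integral_inner_invCov μ (h := fun z => invForm ν a b g (fun τ => h τ z) • h τ₁ z)
    (Integrable.of_bound (hm.smul hh1).aestronglyMeasurable _
    (ae_of_all _ (hbs τ₁ hτ₁)))]
  have hk : Measurable fun z => (inner ℝ (f τ₁) (invCov (a τ₁) (b τ₁) (h τ₁ z)) : ℝ) :=
    (((innerSL ℝ (f τ₁)).comp (invCov (a τ₁) (b τ₁))).measurable).comp hh1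
  have hkb : ∀ z, |(inner ℝ (f τ₁) (invCov (a τ₁) (b τ₁) (h τ₁ z)) : ℝ)| ≤
      2 / c * (‖f τ₁‖ * B) := fun z => by
    refine (abs_inner_invCov_le hc (M.gap _ hτ₁) _ _).trans ?_
    have := hB τ₁ hτ₁ z
    gcongr
  have h5 : ∀ z, (inner ℝ (f τ₁) (invCov (a τ₁) (b τ₁)
      (invForm ν a b g (fun τ => h τ z) • h τ₁ z)) : ℝ) =
      invForm ν a b g (fun τ => (inner ℝ (f τ₁) (invCov (a τ₁) (b τ₁) (h τ₁ z)) : ℝ) • h τ z) :=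
    fun z => by rw [invForm_smul_right, map_smul, real_inner_smul_right, mul_comm]
  simp_rw [h5]
  have hbs' : ∀ τ ∈ S, ∀ z, ‖(inner ℝ (f τ₁) (invCov (a τ₁) (b τ₁) (h τ₁ z)) : ℝ) • h τ z‖ ≤
      2 / c * (‖f τ₁‖ * B) * B := fun τ hτ z => by
    rw [norm_smul, Real.norm_eq_abs]
    have h3 := hB τ hτ z
    have h4 := hkb z
    have : 0 ≤ 2 / c * (‖f τ₁‖ * B) := (abs_nonneg _).trans h4
    gcongr
  rw [M.integral_invForm μ hg hgB
    (h := fun τ z => (inner ℝ (f τ₁) (invCov (a τ₁) (b τ₁) (h τ₁ z)) : ℝ) • h τ z)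
    ((hk.comp measurable_snd).smul hh) hbs', invForm]
  refine integral_congr_ae (M.ae_mem.mono fun τ₂ hτ₂ => ?_)
  simp only
  rw [← integral_inner_invCov μ (h := fun z =>
    (inner ℝ (f τ₁) (invCov (a τ₁) (b τ₁) (h τ₁ z)) : ℝ) • h τ₂ z) (Integrable.of_bound (hk.smul
    (hh.comp measurable_prodMk_left)).aestronglyMeasurable _ (ae_of_all _ (hbs' τ₂ hτ₂)))]
  simp_rw [map_smul, real_inner_smul_right]

end

end CCFEL
end

noncomputable section

namespace CCFEL

/-! ### The regularity conditions and the quadratic model -/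

/-- The consequences of the assumptions that govern the behaviour of the empirical likelihood near
`θ₀`. -/
structure IsRegularModel {Ω : Type*} [MeasurableSpace Ω] {d p : ℕ} (P : Measure Ω)
    (X : ℕ → Ω → Vec d) (κ : Vec p → Kernel (Vec d) (Vec d)) (w : Freq d → Vec d → ℂ)
    (S : Set (Freq d)) (dens : Freq d → ℝ) (θ₀ : Vec p) (U : Set (Vec p)) (M : Vec d → ℝ) :
    Prop where
  isOpen : IsOpen U
  mem : θ₀ ∈ U
  markovKernel : ∀ θ ∈ U, IsMarkovKernel (κ θ)
  process : IsStationaryMarkov P X (κ θ₀)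
  mixing : ExpAlphaMixing P X
  weight : IsWeight S w
  density : IsFreqDensity S dens
  integrable : Integrable M (P.map (X 0))
  smooth : ∀ᵐ x ∂(P.map (X 0)), IsSmoothAt κ S U M x
  posDef : ∀ τ ∈ S, (covPair P X κ w θ₀ τ τ).PosDef

/-- The score `∫ (∂E ε̃/∂v)⋆ A⁻¹ ε̃ π dτ` in direction `v`, as a function of the transition. -/
def score {Ω : Type*} [MeasurableSpace Ω] {d p : ℕ} (P : Measure Ω) (X : ℕ → Ω → Vec d)
    (κ : Vec p → Kernel (Vec d) (Vec d)) (w : Freq d → Vec d → ℂ) (dens : Freq d → ℝ)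
    (θ : Vec p) (v : Vec p) (z : Vec d × Vec d) : ℝ :=
  invForm (freqMeasure dens) (residualVar P X κ w θ) (residualPseudoVar P X κ w θ)
    (fun τ => meanGrad P X κ w θ τ v) (fun τ => transResidual κ w θ τ z)

/-- The curvature matrix of the quadratic model, in real coordinates. -/
def infoMatrix {Ω : Type*} [MeasurableSpace Ω] {d p : ℕ} (P : Measure Ω) (X : ℕ → Ω → Vec d)
    (κ : Vec p → Kernel (Vec d) (Vec d)) (w : Freq d → Vec d → ℂ) (dens : Freq d → ℝ)
    (θ : Vec p) : Matrix (Fin p) (Fin p) ℝ :=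
  Matrix.of fun j k =>
    invForm (freqMeasure dens) (residualVar P X κ w θ) (residualPseudoVar P X κ w θ)
      (fun τ => meanGrad P X κ w θ τ (EuclideanSpace.single j 1))
      (fun τ => meanGrad P X κ w θ τ (EuclideanSpace.single k 1))

/-- The covariance matrix of the scores. -/
def scoreCov {Ω : Type*} [MeasurableSpace Ω] {d p : ℕ} (P : Measure Ω) (X : ℕ → Ω → Vec d)
    (κ : Vec p → Kernel (Vec d) (Vec d)) (w : Freq d → Vec d → ℂ) (dens : Freq d → ℝ)
    (θ : Vec p) : Matrix (Fin p) (Fin p) ℝ :=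
  Matrix.of fun j k => ∫ z, score P X κ w dens θ (EuclideanSpace.single j 1) z *
    score P X κ w dens θ (EuclideanSpace.single k 1) z ∂(pairLaw P X)

/-- The dictionary between the complex matrices and the real plane: on vectors `(y, ȳ)` and `(z,
z̄)` the inverse of the complex covariance matrix acts as the real inverse covariance operator. The
factor `1/2` in the real inner product cancels the `2` in `invCov`. -/
lemma conj_inv_mul_eq_inner {a c : ℝ} {b : ℂ} (hc : 0 < c) (h : c ≤ a - ‖b‖) (y z : ℂ)
    {N : Matrix (Fin 2) (Fin 2) ℂ} (hN : N = (!![(a : ℂ), b; conj b, (a : ℂ)])⁻¹) :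
    conj y * (N 0 0 * z + N 0 1 * conj z) + y * (N 1 0 * z + N 1 1 * conj z) =
      ((inner ℝ y (invCov a b z) : ℝ) : ℂ) := by
  have hb := norm_nonneg b
  have hne : a ^ 2 - ‖b‖ ^ 2 ≠ 0 := by nlinarith
  have hne' : (a : ℂ) ^ 2 - ‖b‖ ^ 2 ≠ 0 := by exact_mod_cast hne
  have hdet : (!![(a : ℂ), b; conj b, (a : ℂ)]).det = (a : ℂ) ^ 2 - ‖b‖ ^ 2 := by
    rw [Matrix.det_fin_two_of, Complex.mul_conj']
    ring
  rw [inner_eq_half, invCov_apply, hN, Matrix.inv_def, hdet, Ring.inverse_eq_inv',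
    Matrix.adjugate_fin_two_of]
  simp only [Matrix.smul_apply, Matrix.of_apply, Matrix.cons_val', Matrix.cons_val_zero,
    Matrix.cons_val_one, smul_eq_mul, map_mul, map_sub, Complex.conj_ofReal, Complex.conj_conj,
    Matrix.cons_val_fin_one]
  push_cast
  field_simp
  ring

section

variable {Ω : Type*} [mΩ : MeasurableSpace Ω] {P : Measure Ω} [IsProbabilityMeasure P] {d p : ℕ}
  {X : ℕ → Ω → Vec d} {κ : Vec p → Kernel (Vec d) (Vec d)} {w : Freq d → Vec d → ℂ}
  {S : Set (Freq d)} {dens : Freq d → ℝ} {θ₀ : Vec p} {U : Set (Vec p)} {M : Vec d → ℝ}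

lemma IsRegularModel.meanPair_eq_zero (h : IsRegularModel P X κ w S dens θ₀ U M) (τ : Freq d) :
    meanPair P X κ w θ₀ τ = 0 := by
  have := h.markovKernel θ₀ h.mem
  have key := integral_pairLaw_transResidual h.process h.weight τ
  rw [integral_map (h.process.measurable_pair 0).aemeasurable
    (measurable_transResidual_right h.weight τ).aestronglyMeasurable] at key
  ext i
  unfold meanPair
  simp_rw [fun ω => residualPair_eq (κ := κ) (θ := θ₀) h.weight τ (X 0 ω, X 1 ω)]
  fin_cases i
  · exact key
  · have h2 := integral_conj (μ := P) (f := fun ω => transResidual κ w θ₀ τ (X 0 ω, X 1 ω))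
    rw [key, map_zero] at h2
    exact h2

lemma IsRegularModel.covPair_apply (h : IsRegularModel P X κ w S dens θ₀ U M) (τ₁ τ₂ : Freq d)
    (i j : Fin 2) :
    covPair P X κ w θ₀ τ₁ τ₂ i j =
      ∫ z, ![transResidual κ w θ₀ τ₁ z, conj (transResidual κ w θ₀ τ₁ z)] i *
        conj (![transResidual κ w θ₀ τ₂ z, conj (transResidual κ w θ₀ τ₂ z)] j)
          ∂(pairLaw P X) := by
  have := h.markovKernel θ₀ h.mem
  have hm : ∀ τ i, Measurable fun z : Vec d × Vec d =>
      ![transResidual κ w θ₀ τ z, conj (transResidual κ w θ₀ τ z)] i := fun τ i => by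
    have h1 := measurable_transResidual_right (κ := κ) (θ := θ₀) h.weight τ
    fin_cases i
    · exact h1
    · exact Complex.continuous_conj.measurable.comp h1
  have hm2 : Measurable fun z : Vec d × Vec d =>
      ![transResidual κ w θ₀ τ₁ z, conj (transResidual κ w θ₀ τ₁ z)] i *
        conj (![transResidual κ w θ₀ τ₂ z, conj (transResidual κ w θ₀ τ₂ z)] j) :=
    (hm τ₁ i).mul (Complex.continuous_conj.measurable.comp (hm τ₂ j))
  refine Eq.trans ?_ (integral_map (h.process.measurable_pair 0).aemeasurable
    hm2.aestronglyMeasurable).symm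
  simp only [covPair, Matrix.of_apply, h.meanPair_eq_zero, Pi.zero_apply, sub_zero]
  simp_rw [fun τ ω => residualPair_eq (κ := κ) (θ := θ₀) h.weight τ (X 0 ω, X 1 ω)]

lemma IsRegularModel.covPair_self (h : IsRegularModel P X κ w S dens θ₀ U M) (τ : Freq d) :
    covPair P X κ w θ₀ τ τ = !![(residualVar P X κ w θ₀ τ : ℂ), residualPseudoVar P X κ w θ₀ τ;
      conj (residualPseudoVar P X κ w θ₀ τ), (residualVar P X κ w θ₀ τ : ℂ)] := by
  ext i j
  rw [h.covPair_apply]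
  fin_cases i <;> fin_cases j
  · simp only [Fin.zero_eta, Matrix.cons_val_zero, Matrix.of_apply, Matrix.cons_val', residualVar]
    rw [← integral_complex_ofReal]
    simp_rw [Complex.mul_conj']
    push_cast
    rfl
  · simp [residualPseudoVar, pow_two]
  · simp [residualPseudoVar, ← integral_conj, pow_two]
  · simp only [Fin.mk_one, Matrix.cons_val_one, Matrix.of_apply, Matrix.cons_val', residualVar,
      Matrix.cons_val_fin_one, Complex.conj_conj]
    rw [← integral_complex_ofReal]
    simp_rw [Complex.conj_mul']
    push_cast
    rfl

/-- The determinant of the covariance matrix is `a² - |b|²` and its diagonal entry is `a`; both are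
positive. -/
lemma IsRegularModel.norm_residualPseudoVar_lt (h : IsRegularModel P X κ w S dens θ₀ U M)
    {τ : Freq d} (hτ : τ ∈ S) :
    0 < residualVar P X κ w θ₀ τ - ‖residualPseudoVar P X κ w θ₀ τ‖ := by
  have h1 := (h.posDef τ hτ).det_pos
  have h2 := (h.posDef τ hτ).diag_pos (i := 0)
  rw [h.covPair_self] at h1 h2
  rw [Matrix.det_fin_two_of, Complex.mul_conj', ← pow_two] at h1
  have h3 : (0 : ℝ) < residualVar P X κ w θ₀ τ ^ 2 - ‖residualPseudoVar P X κ w θ₀ τ‖ ^ 2 := by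
    exact_mod_cast h1
  have h4 : (0 : ℝ) < residualVar P X κ w θ₀ τ := by
    simpa using h2
  have := norm_nonneg (residualPseudoVar P X κ w θ₀ τ)
  nlinarith

lemma measurable_residualVar [IsMarkovKernel (κ θ₀)] (hX : IsStationaryMarkov P X (κ θ₀))
    (hw : IsWeight S w) : Measurable (residualVar P X κ w θ₀) := by
  have := isProbabilityMeasure_pairLaw hX
  exact (StronglyMeasurable.integral_prod_right' (ν := pairLaw P X)
    (f := fun q : Freq d × (Vec d × Vec d) => ‖transResidual κ w θ₀ q.1 q.2‖ ^ 2)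
    ((measurable_transResidual hw).norm.pow_const 2).stronglyMeasurable).measurable

lemma measurable_residualPseudoVar [IsMarkovKernel (κ θ₀)] (hX : IsStationaryMarkov P X (κ θ₀))
    (hw : IsWeight S w) : Measurable (residualPseudoVar P X κ w θ₀) := by
  have := isProbabilityMeasure_pairLaw hX
  exact (StronglyMeasurable.integral_prod_right' (ν := pairLaw P X)
    (f := fun q : Freq d × (Vec d × Vec d) => transResidual κ w θ₀ q.1 q.2 ^ 2)
    ((measurable_transResidual hw).pow_const 2).stronglyMeasurable).measurable

lemma IsRegularModel.continuousOn_meanGrad (h : IsRegularModel P X κ w S dens θ₀ U M) :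
    ContinuousOn (meanGrad P X κ w θ₀) S := by
  have := h.markovKernel θ₀ h.mem
  -- The ball of radius `0` is the single point `θ₀`.
  have h1 := (CCFEL.continuousOn_meanGrad h.process h.mixing h.weight h.density.compact h.isOpen
    h.markovKernel h.integrable h.smooth (ρ := 0) (by simpa using h.mem)).1
  exact h1.comp (f := fun τ => (τ, θ₀)) (by fun_prop) fun τ hτ => ⟨hτ, by simp⟩

/-- The gap `a - |b|` is continuous and positive on the compact set `S`, so it has a positive
minimum; the mean gradient is bounded there for the same reason. -/
theorem IsRegularModel.exists_isQuadModel (h : IsRegularModel P X κ w S dens θ₀ U M) :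
    ∃ c Dm, IsQuadModel (freqMeasure dens) S (residualVar P X κ w θ₀)
      (residualPseudoVar P X κ w θ₀) (meanGrad P X κ w θ₀) c Dm := by
  have := h.markovKernel θ₀ h.mem
  have hS := h.density.compact
  have ca := (continuousOn_residualVar h.process h.mixing h.weight hS).1
  have cb := (continuousOn_residualPseudoVar h.process h.mixing h.weight hS).1
  have cD := h.continuousOn_meanGrad
  obtain ⟨c, hc, hgap⟩ : ∃ c > 0, ∀ τ ∈ S,
      c ≤ residualVar P X κ w θ₀ τ - ‖residualPseudoVar P X κ w θ₀ τ‖ := by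
    rcases S.eq_empty_or_nonempty with hS0 | hS0
    · exact ⟨1, one_pos, by simp [hS0]⟩
    · obtain ⟨τ, hτ, hmin⟩ := hS.exists_isMinOn hS0 (ca.sub cb.norm)
      exact ⟨_, h.norm_residualPseudoVar_lt hτ, fun τ' hτ' => hmin hτ'⟩
  obtain ⟨Dm, hDm⟩ := hS.exists_bound_of_continuousOn cD
  refine ⟨c, max Dm 0, hc, h.density.ae_mem, hgap, fun τ hτ => (hDm τ hτ).trans (le_max_left _ _),
    le_max_right _ _, (measurable_residualVar h.process h.weight).aemeasurable,
    (measurable_residualPseudoVar h.process h.weight).aemeasurable, fun v => ?_⟩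
  -- Continuity of the mean gradient is available only on `S`, which carries the whole frequency
  -- measure.
  rw [← Measure.restrict_eq_self_of_ae_mem h.density.ae_mem]
  have cDv : ContinuousOn (fun τ => meanGrad P X κ w θ₀ τ v) S :=
    cD.clm_apply continuousOn_const
  exact cDv.aemeasurable hS.measurableSet

/-! ### The scores -/

lemma IsRegularModel.measurable_score (h : IsRegularModel P X κ w S dens θ₀ U M) (v : Vec p) :
    Measurable (score P X κ w dens θ₀ v) := by
  have := h.markovKernel θ₀ h.mem
  have := h.density.isProbabilityMeasure
  have hSm := h.density.compact.measurableSet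
  classical
  -- Extending the mean gradient by zero off `S` makes it genuinely measurable and does not change
  -- the integral, since the frequencies lie in `S` almost surely.
  have hD : Measurable (S.piecewise (fun τ => meanGrad P X κ w θ₀ τ v) 0) :=
    ContinuousOn.measurable_piecewise (h.continuousOn_meanGrad.clm_apply continuousOn_const)
      continuousOn_const hSm
  have e : score P X κ w dens θ₀ v = fun z => ∫ τ, (inner ℝ
      (S.piecewise (fun τ => meanGrad P X κ w θ₀ τ v) 0 τ)
      (invCov (residualVar P X κ w θ₀ τ) (residualPseudoVar P X κ w θ₀ τ)
        (transResidual κ w θ₀ τ z)) : ℝ) ∂(freqMeasure dens) := by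
    ext z
    refine integral_congr_ae (h.density.ae_mem.mono fun τ hτ => ?_)
    simp only [Set.piecewise_eq_of_mem _ _ _ hτ]
  rw [e]
  refine (StronglyMeasurable.integral_prod_right' (ν := freqMeasure dens)
    (f := fun q : (Vec d × Vec d) × Freq d => (inner ℝ
      (S.piecewise (fun τ => meanGrad P X κ w θ₀ τ v) 0 q.2)
      (invCov (residualVar P X κ w θ₀ q.2) (residualPseudoVar P X κ w θ₀ q.2)
        (transResidual κ w θ₀ q.2 q.1)) : ℝ)) (Measurable.stronglyMeasurable ?_)).measurable
  have ma : Measurable fun q : (Vec d × Vec d) × Freq d => residualVar P X κ w θ₀ q.2 :=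
    (measurable_residualVar h.process h.weight).comp measurable_snd
  have mb : Measurable fun q : (Vec d × Vec d) × Freq d => residualPseudoVar P X κ w θ₀ q.2 :=
    (measurable_residualPseudoVar h.process h.weight).comp measurable_snd
  have me : Measurable fun q : (Vec d × Vec d) × Freq d => transResidual κ w θ₀ q.2 q.1 :=
    (measurable_transResidual h.weight).comp measurable_swap
  simp only [invCov_apply]
  refine (hD.comp measurable_snd).inner (Measurable.mul ?_ ?_)
  · exact Complex.measurable_ofReal.comp
      (measurable_const.div ((ma.pow_const 2).sub (mb.norm.pow_const 2)))
  · exact ((Complex.measurable_ofReal.comp ma).mul me).sub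
      (mb.mul (Complex.continuous_conj.measurable.comp me))

/-- The transition integral passes inside the frequency integral and meets a residual centred by the
kernel. This is what makes the scores martingale differences. -/
lemma IsRegularModel.integral_score (h : IsRegularModel P X κ w S dens θ₀ U M) (v : Vec p)
    (x : Vec d) : ∫ y, score P X κ w dens θ₀ v (x, y) ∂(κ θ₀ x) = 0 := by
  have := h.markovKernel θ₀ h.mem
  have := h.density.isProbabilityMeasure
  obtain ⟨c, Dm, hQ⟩ := h.exists_isQuadModel
  have := hQ.integral_invForm (κ θ₀ x) (hQ.aemeasurable_D v) (fun τ hτ => hQ.norm_D_apply_le v hτ)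
    (h := fun τ y => transResidual κ w θ₀ τ (x, y))
    ((measurable_transResidual h.weight).comp
      (measurable_fst.prodMk (measurable_const.prodMk measurable_snd)))
    (fun τ _ y => norm_transResidual_le h.weight τ _)
  simp only [score]
  rw [this]
  simp [integral_transResidual_eq_zero, invForm]

lemma IsRegularModel.exists_abs_score_le (h : IsRegularModel P X κ w S dens θ₀ U M) (v : Vec p) :
    ∃ B, ∀ z, |score P X κ w dens θ₀ v z| ≤ B := by
  have := h.markovKernel θ₀ h.mem
  have := h.density.isProbabilityMeasure
  obtain ⟨c, Dm, hQ⟩ := h.exists_isQuadModel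
  exact ⟨_, fun z => hQ.abs_invForm_le (fun τ hτ => hQ.norm_D_apply_le v hτ)
    fun τ _ => norm_transResidual_le h.weight τ z⟩

lemma IsRegularModel.avg_score (h : IsRegularModel P X κ w S dens θ₀ U M) (v : Vec p) (n : ℕ)
    (x : ℕ → Vec d) :
    avg n (score P X κ w dens θ₀ v) x =
      invForm (freqMeasure dens) (residualVar P X κ w θ₀) (residualPseudoVar P X κ w θ₀)
        (fun τ => meanGrad P X κ w θ₀ τ v) (fun τ => avg n (transResidual κ w θ₀ τ) x) := by
  have := h.markovKernel θ₀ h.mem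
  have := h.density.isProbabilityMeasure
  obtain ⟨c, Dm, hQ⟩ := h.exists_isQuadModel
  unfold avg
  rw [invForm_smul_right, hQ.invForm_sum_right (hQ.aemeasurable_D v)
    (fun τ hτ => hQ.norm_D_apply_le v hτ) _
    (g := fun t τ => transResidual κ w θ₀ τ (x t, x (t + 1)))
    (fun t => ((measurable_transResidual h.weight).comp measurable_prodMk_right).aemeasurable)
    (fun t τ _ => norm_transResidual_le h.weight τ _)]
  rfl

end

/-! ### Coordinates -/

lemma eq_sum_smul_single {p : ℕ} (v : Vec p) :
    v = ∑ j, v j • EuclideanSpace.single j (1 : ℝ) := by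
  ext i
  simp [Finset.sum_apply, Pi.single_apply]

section

variable {T : Type*} [MeasurableSpace T] {p : ℕ} {ν : Measure T} [IsProbabilityMeasure ν]
  {S : Set T} {a : T → ℝ} {b : T → ℂ} {D : T → Vec p →L[ℝ] ℂ} {c Dm : ℝ}

omit [IsProbabilityMeasure ν] in
lemma invForm_comm (f g : T → ℂ) : invForm ν a b f g = invForm ν a b g f := by
  simp only [invForm]
  exact integral_congr_ae (ae_of_all _ fun τ => invCov_symm _ _ _ _)

lemma IsQuadModel.invForm_apply_right (M : IsQuadModel ν S a b D c Dm) {f : T → ℂ}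
    (hf : AEMeasurable f ν) {Bf : ℝ} (hfB : ∀ τ ∈ S, ‖f τ‖ ≤ Bf) (v : Vec p) :
    invForm ν a b f (fun τ => D τ v) =
      ∑ j, v j * invForm ν a b f (fun τ => D τ (EuclideanSpace.single j 1)) := by
  have e : (fun τ => D τ v) = fun τ => ∑ j, v j • D τ (EuclideanSpace.single j 1) := by
    ext τ
    conv_lhs => rw [eq_sum_smul_single v]
    simp only [map_sum, map_smul]
  rw [e, M.invForm_sum_right hf hfB _ (g := fun j τ => v j • D τ (EuclideanSpace.single j 1))
    (fun j => (M.aemeasurable_D (EuclideanSpace.single j 1)).const_smul (v j))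
    (Bg := fun j => |v j| * (Dm * ‖EuclideanSpace.single j (1 : ℝ)‖)) fun j τ hτ => ?_]
  · simp_rw [invForm_smul_right]
  · rw [norm_smul, Real.norm_eq_abs]
    gcongr
    exact M.norm_D_apply_le _ hτ

lemma IsQuadModel.invForm_apply_apply (M : IsQuadModel ν S a b D c Dm) (u v : Vec p) :
    invForm ν a b (fun τ => D τ u) (fun τ => D τ v) =
      u.ofLp ⬝ᵥ (Matrix.of fun j k => invForm ν a b (fun τ => D τ (EuclideanSpace.single j 1))
        (fun τ => D τ (EuclideanSpace.single k 1))).mulVec v.ofLp := by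
  rw [M.invForm_apply_right (M.aemeasurable_D u) (fun τ hτ => M.norm_D_apply_le u hτ)]
  simp_rw [fun k => invForm_comm (ν := ν) (a := a) (b := b) (fun τ => D τ u)
    (fun τ => D τ (EuclideanSpace.single k 1)), fun k => M.invForm_apply_right
      (M.aemeasurable_D (EuclideanSpace.single k 1)) (fun τ hτ => M.norm_D_apply_le _ hτ) u]
  simp only [dotProduct, Matrix.mulVec, Matrix.of_apply, Finset.mul_sum]
  rw [Finset.sum_comm]
  refine Finset.sum_congr rfl fun j _ => Finset.sum_congr rfl fun k _ => ?_
  rw [invForm_comm]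
  ring

end

end CCFEL
end

noncomputable section

namespace CCFEL

/-! ### Identification of the limit matrices -/

section

variable {Ω : Type*} [mΩ : MeasurableSpace Ω] {P : Measure Ω} [IsProbabilityMeasure P] {d p : ℕ}
  {X : ℕ → Ω → Vec d} {κ : Vec p → Kernel (Vec d) (Vec d)} {w : Freq d → Vec d → ℂ}
  {S : Set (Freq d)} {dens : Freq d → ℝ} {θ₀ : Vec p} {U : Set (Vec p)} {M : Vec d → ℝ}

omit [IsProbabilityMeasure P] in
lemma IsRegularModel.gradPair_apply (h : IsRegularModel P X κ w S dens θ₀ U M) {τ : Freq d}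
    (hτ : τ ∈ S) (j : Fin p) :
    gradPair P X κ w θ₀ τ 0 j = meanGrad P X κ w θ₀ τ (EuclideanSpace.single j 1) ∧
    gradPair P X κ w θ₀ τ 1 j = conj (meanGrad P X κ w θ₀ τ (EuclideanSpace.single j 1)) := by
  have := h.markovKernel θ₀ h.mem
  have hi := integrable_transGrad h.process h.weight h.isOpen h.markovKernel h.integrable h.smooth
    hτ h.mem
  have key : ∫ ω, transGrad κ w θ₀ τ (X 0 ω, X 1 ω) (EuclideanSpace.single j 1) ∂P =
      meanGrad P X κ w θ₀ τ (EuclideanSpace.single j 1) := by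
    rw [meanGrad, ContinuousLinearMap.integral_apply hi]
    exact (integral_map (h.process.measurable_pair 0).aemeasurable
      (hi.apply_continuousLinearMap (EuclideanSpace.single j (1 : ℝ))).aestronglyMeasurable).symm
  constructor
  · exact key
  · rw [← key, ← integral_conj]
    refine integral_congr_ae (ae_of_all _ fun ω => ?_)
    have e : (fun η : Vec p => residualPair κ w τ η (X 0 ω) (X 1 ω) 1) =
        Complex.conjCLE ∘ fun η => transResidual κ w η τ (X 0 ω, X 1 ω) := by
      ext η
      rw [residualPair_eq (κ := κ) (θ := η) h.weight τ (X 0 ω, X 1 ω)]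
      rfl
    simp only [e]
    rw [Complex.conjCLE.comp_fderiv]
    rfl

/-- The columns of `D(τ)` have the form `(f, f̄)`, so each entry of the integrand is a real inner
product by `conj_inv_mul_eq_inner`. Frequencies outside `S` contribute nothing because the density
vanishes. -/
lemma IsRegularModel.gam_eq (h : IsRegularModel P X κ w S dens θ₀ U M) :
    Gam P X κ w dens θ₀ = (infoMatrix P X κ w dens θ₀).map (fun r : ℝ => (r : ℂ)) := by
  have := h.markovKernel θ₀ h.mem
  obtain ⟨c, Dm, hQ⟩ := h.exists_isQuadModel
  ext j k
  simp only [Gam, infoMatrix, Matrix.of_apply, Matrix.map_apply, invForm]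
  rw [← integral_complex_ofReal, h.density.integral_eq]
  refine integral_congr_ae (ae_of_all _ fun τ => ?_)
  simp only [Complex.real_smul]
  by_cases hτ : τ ∈ S
  · rw [mul_comm]
    congr 1
    obtain ⟨e0j, e1j⟩ := h.gradPair_apply hτ j
    obtain ⟨e0k, e1k⟩ := h.gradPair_apply hτ k
    rw [← conj_inv_mul_eq_inner hQ.c_pos (hQ.gap τ hτ) _ _ rfl, ← h.covPair_self]
    simp only [Matrix.mul_apply, Fin.sum_univ_two, Matrix.conjTranspose_apply, e0j, e1j, e0k, e1k,
      RCLike.star_def, Complex.conj_conj]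
    ring
  · rw [h.density.support τ hτ]
    simp

/-- Fubini's theorem writes the covariance of two scores as a double frequency integral of an
expected product. Each factor is linear in the residual and its conjugate, so the expectation of the
product is assembled from the entries of `A(τ₁, τ₂)`. -/
lemma IsRegularModel.vmat_eq (h : IsRegularModel P X κ w S dens θ₀ U M) :
    Vmat P X κ w dens θ₀ = (scoreCov P X κ w dens θ₀).map (fun r : ℝ => (r : ℂ)) := by
  have := h.markovKernel θ₀ h.mem
  have := h.density.isProbabilityMeasure
  have := isProbabilityMeasure_pairLaw h.process
  obtain ⟨c, Dm, hQ⟩ := h.exists_isQuadModel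
  have hmr : ∀ τ, Measurable (transResidual κ w θ₀ τ) := measurable_transResidual_right h.weight
  ext j k
  have hV : scoreCov P X κ w dens θ₀ j k = ∫ τ₁, ∫ τ₂, ∫ z,
      (inner ℝ (meanGrad P X κ w θ₀ τ₁ (EuclideanSpace.single j 1)) (invCov
        (residualVar P X κ w θ₀ τ₁) (residualPseudoVar P X κ w θ₀ τ₁)
        (transResidual κ w θ₀ τ₁ z)) : ℝ) *
      inner ℝ (meanGrad P X κ w θ₀ τ₂ (EuclideanSpace.single k 1)) (invCov
        (residualVar P X κ w θ₀ τ₂) (residualPseudoVar P X κ w θ₀ τ₂)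
        (transResidual κ w θ₀ τ₂ z)) ∂(pairLaw P X) ∂(freqMeasure dens) ∂(freqMeasure dens) :=
    hQ.integral_invForm_mul_invForm (pairLaw P X) (hQ.aemeasurable_D _) (hQ.aemeasurable_D _)
      (fun τ hτ => hQ.norm_D_apply_le _ hτ) (fun τ hτ => hQ.norm_D_apply_le _ hτ)
      (h := fun τ z => transResidual κ w θ₀ τ z) (measurable_transResidual h.weight)
      (fun τ _ => norm_transResidual_le h.weight τ) (h.measurable_score _)
  rw [Matrix.map_apply, hV, ← integral_complex_ofReal, h.density.integral_eq]
  simp only [Vmat, Matrix.of_apply]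
  refine integral_congr_ae (ae_of_all _ fun τ₁ => ?_)
  simp only [Complex.real_smul]
  by_cases hτ₁ : τ₁ ∈ S
  swap
  · rw [h.density.support τ₁ hτ₁]
    simp
  rw [← integral_complex_ofReal, h.density.integral_eq, ← integral_const_mul]
  refine integral_congr_ae (ae_of_all _ fun τ₂ => ?_)
  simp only [Complex.real_smul]
  by_cases hτ₂ : τ₂ ∈ S
  swap
  · rw [h.density.support τ₂ hτ₂]
    simp
  rw [← mul_assoc]
  refine (mul_assoc _ _ _).trans ((mul_comm _ _).trans (congrArg _ ?_))
  obtain ⟨e0j, e1j⟩ := h.gradPair_apply hτ₁ j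
  obtain ⟨e0k, e1k⟩ := h.gradPair_apply hτ₂ k
  set N₁ := (covPair P X κ w θ₀ τ₁ τ₁)⁻¹ with hN₁
  set N₂ := (covPair P X κ w θ₀ τ₂ τ₂)⁻¹ with hN₂
  have hH : (covPair P X κ w θ₀ τ₂ τ₂).conjTranspose = covPair P X κ w θ₀ τ₂ τ₂ :=
    (h.posDef τ₂ hτ₂).isHermitian
  rw [hH, ← hN₂, ← integral_complex_ofReal]
  set f := meanGrad P X κ w θ₀ τ₁ (EuclideanSpace.single j 1)
  set g := meanGrad P X κ w θ₀ τ₂ (EuclideanSpace.single k 1)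
  have h1 : ∀ y z, conj y * (N₁ 0 0 * z + N₁ 0 1 * conj z) +
      y * (N₁ 1 0 * z + N₁ 1 1 * conj z) = _ := fun y z =>
    conj_inv_mul_eq_inner hQ.c_pos (hQ.gap τ₁ hτ₁) y z (by rw [hN₁, h.covPair_self])
  have h2 : ∀ y z, conj y * (N₂ 0 0 * z + N₂ 0 1 * conj z) +
      y * (N₂ 1 0 * z + N₂ 1 1 * conj z) = _ := fun y z =>
    conj_inv_mul_eq_inner hQ.c_pos (hQ.gap τ₂ hτ₂) y z (by rw [hN₂, h.covPair_self])
  have hint : ∀ i l : Fin 2, Integrable (fun z =>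
      ![transResidual κ w θ₀ τ₁ z, conj (transResidual κ w θ₀ τ₁ z)] i *
        conj (![transResidual κ w θ₀ τ₂ z, conj (transResidual κ w θ₀ τ₂ z)] l))
      (pairLaw P X) := fun i l => by
    have hm : ∀ τ (i : Fin 2), Measurable fun z : Vec d × Vec d =>
        ![transResidual κ w θ₀ τ z, conj (transResidual κ w θ₀ τ z)] i := fun τ i => by
      fin_cases i
      · exact hmr τ
      · exact Complex.continuous_conj.measurable.comp (hmr τ)
    have hb : ∀ τ (i : Fin 2) z,
        ‖![transResidual κ w θ₀ τ z, conj (transResidual κ w θ₀ τ z)] i‖ ≤ 2 := fun τ i z => by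
      fin_cases i
      · exact norm_transResidual_le h.weight τ z
      · exact (RCLike.norm_conj _).trans_le (norm_transResidual_le h.weight τ z)
    refine Integrable.of_bound ((hm τ₁ i).mul (Complex.continuous_conj.measurable.comp
      (hm τ₂ l))).aestronglyMeasurable (2 * 2) (ae_of_all _ fun z => ?_)
    rw [norm_mul, RCLike.norm_conj]
    exact mul_le_mul (hb τ₁ i z) (hb τ₂ l z) (norm_nonneg _) two_pos.le
  -- The vectors `q` and `r` are the row `D(τ₁)⋆ A(τ₁, τ₁)⁻¹` and the column `A(τ₂, τ₂)⁻¹ D(τ₂)`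
  -- that flank `A(τ₁, τ₂)`.
  set q : Fin 2 → ℂ := ![conj f * N₁ 0 0 + f * N₁ 1 0, conj f * N₁ 0 1 + f * N₁ 1 1] with hq
  set r : Fin 2 → ℂ := ![N₂ 0 0 * g + N₂ 0 1 * conj g, N₂ 1 0 * g + N₂ 1 1 * conj g] with hr
  have e1 : ∀ z : Vec d × Vec d, (((inner ℝ f (invCov (residualVar P X κ w θ₀ τ₁)
      (residualPseudoVar P X κ w θ₀ τ₁) (transResidual κ w θ₀ τ₁ z)) : ℝ) *
      inner ℝ g (invCov (residualVar P X κ w θ₀ τ₂)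
        (residualPseudoVar P X κ w θ₀ τ₂) (transResidual κ w θ₀ τ₂ z)) : ℝ) : ℂ) =
      ∑ i, ∑ l, q i * r l *
        (![transResidual κ w θ₀ τ₁ z, conj (transResidual κ w θ₀ τ₁ z)] i *
        conj (![transResidual κ w θ₀ τ₂ z, conj (transResidual κ w θ₀ τ₂ z)] l)) := fun z => by
    rw [invCov_symm _ _ g, Complex.ofReal_mul, ← h1, ← h2]
    simp only [Fin.sum_univ_two, hq, hr, Matrix.cons_val_zero, Matrix.cons_val_one,
      Matrix.cons_val_fin_one, Complex.conj_conj]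
    ring
  simp_rw [e1]
  rw [integral_finsetSum _ fun i _ => integrable_finsetSum _ fun l _ => (hint i l).const_mul _]
  simp_rw [integral_finsetSum Finset.univ fun l _ => (hint _ l).const_mul _, integral_const_mul,
    ← h.covPair_apply]
  simp only [Matrix.mul_apply, Fin.sum_univ_two, Matrix.conjTranspose_apply, e0j, e1j, e0k, e1k,
      RCLike.star_def, Complex.conj_conj, hq, hr, Matrix.cons_val_zero, Matrix.cons_val_one,
      Matrix.cons_val_fin_one]
  ring

/-! ### Positivity -/

lemma exists_pos_mul_norm_sq_le_dotProduct {A : Matrix (Fin p) (Fin p) ℝ} (hA : A.PosDef) :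
    ∃ γ > 0, ∀ v : Vec p, γ * ‖v‖ ^ 2 ≤ v.ofLp ⬝ᵥ A.mulVec v.ofLp := by
  have hcont : Continuous fun v : Vec p => v.ofLp ⬝ᵥ A.mulVec v.ofLp := by
    have : Continuous fun v : Vec p => v.ofLp := PiLp.continuous_ofLp 2 _
    exact this.dotProduct (continuous_const.matrix_mulVec this)
  rcases (Metric.sphere (0 : Vec p) 1).eq_empty_or_nonempty with hs | hs
  -- The unit sphere is empty only in dimension `p = 0`, where every vector is zero.
  · refine ⟨1, one_pos, fun v => ?_⟩
    have hv : v = 0 := by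
      by_contra hne
      have : (‖v‖⁻¹ • v) ∈ Metric.sphere (0 : Vec p) 1 := by
        simp [norm_smul, norm_ne_zero_iff.2 hne]
      rw [hs] at this
      exact this
    simp [hv]
  · obtain ⟨u, hu, hmin⟩ := (isCompact_sphere (0 : Vec p) 1).exists_isMinOn hs hcont.continuousOn
    have hu0 : u.ofLp ≠ 0 := fun h0 => by
      have : u = 0 := (WithLp.ofLp_eq_zero 2).1 h0
      simp [this] at hu
    refine ⟨_, by simpa using hA.dotProduct_mulVec_pos hu0, fun v => ?_⟩
    by_cases hv : v = 0
    · simp [hv]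
    have hn : 0 < ‖v‖ := norm_pos_iff.2 hv
    have := hmin (a := ‖v‖⁻¹ • v) (by simp [norm_smul, hn.ne'])
    simp only [Set.mem_ofPred_eq, WithLp.ofLp_smul, Matrix.mulVec_smul, dotProduct_smul,
      smul_dotProduct, smul_eq_mul] at this
    rw [← le_div_iff₀ (by positivity)]
    refine this.trans (le_of_eq ?_)
    field_simp

/-- The matrix is positive semidefinite because its quadratic form integrates nonnegative inner
products. Semidefinite and invertible means definite, and invertibility passes from the complex
matrix through the determinant. -/
lemma IsRegularModel.posDef_infoMatrix (h : IsRegularModel P X κ w S dens θ₀ U M)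
    (hG : IsUnit (Gam P X κ w dens θ₀)) : (infoMatrix P X κ w dens θ₀).PosDef := by
  have := h.markovKernel θ₀ h.mem
  have := h.density.isProbabilityMeasure
  obtain ⟨c, Dm, hQ⟩ := h.exists_isQuadModel
  have hsd : (infoMatrix P X κ w dens θ₀).PosSemidef := by
    refine Matrix.PosSemidef.of_dotProduct_mulVec_nonneg ?_ fun v => ?_
    · ext j k
      simp only [infoMatrix, Matrix.conjTranspose_apply, Matrix.of_apply, star_trivial]
      exact invForm_comm _ _
    · have := hQ.invForm_apply_apply (WithLp.toLp 2 v) (WithLp.toLp 2 v)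
      rw [star_trivial]
      refine le_of_le_of_eq ?_ this
      exact integral_nonneg_of_ae (hQ.ae_mem.mono fun τ hτ =>
        inner_invCov_self_nonneg hQ.c_pos (hQ.gap τ hτ) _)
  rw [hsd.posDef_iff_isUnit]
  rw [h.gam_eq, Matrix.isUnit_iff_isUnit_det] at hG
  rw [Matrix.isUnit_iff_isUnit_det]
  have e : ((infoMatrix P X κ w dens θ₀).map (fun r : ℝ => (r : ℂ))).det =
      (((infoMatrix P X κ w dens θ₀).det : ℝ) : ℂ) :=
    (RingHom.map_det Complex.ofRealHom (infoMatrix P X κ w dens θ₀)).symm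
  rw [e, isUnit_iff_ne_zero] at hG
  exact isUnit_iff_ne_zero.2 (by exact_mod_cast hG)

lemma IsRegularModel.score_eq_sum (h : IsRegularModel P X κ w S dens θ₀ U M) (v : Vec p)
    (z : Vec d × Vec d) : score P X κ w dens θ₀ v z =
      ∑ j, v j * score P X κ w dens θ₀ (EuclideanSpace.single j 1) z := by
  have := h.markovKernel θ₀ h.mem
  have := h.density.isProbabilityMeasure
  obtain ⟨c, Dm, hQ⟩ := h.exists_isQuadModel
  simp only [score]
  rw [invForm_comm, hQ.invForm_apply_right (f := fun τ => transResidual κ w θ₀ τ z)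
    ((measurable_transResidual h.weight).comp measurable_prodMk_right).aemeasurable
    (fun τ _ => norm_transResidual_le h.weight τ z)]
  simp_rw [fun k => invForm_comm (ν := freqMeasure dens) (a := residualVar P X κ w θ₀)
    (b := residualPseudoVar P X κ w θ₀) (fun τ => transResidual κ w θ₀ τ z)
    (fun τ => meanGrad P X κ w θ₀ τ (EuclideanSpace.single k 1))]

lemma IsRegularModel.integral_score_sq (h : IsRegularModel P X κ w S dens θ₀ U M) (v : Vec p) :
    ∫ z, score P X κ w dens θ₀ v z ^ 2 ∂(pairLaw P X) =
      v.ofLp ⬝ᵥ (scoreCov P X κ w dens θ₀).mulVec v.ofLp := by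
  have := h.markovKernel θ₀ h.mem
  have := isProbabilityMeasure_pairLaw h.process
  have hi : ∀ j k : Fin p, Integrable (fun z =>
      score P X κ w dens θ₀ (EuclideanSpace.single j 1) z *
        score P X κ w dens θ₀ (EuclideanSpace.single k 1) z) (pairLaw P X) := fun j k => by
    obtain ⟨B, hB⟩ := h.exists_abs_score_le (EuclideanSpace.single j 1)
    obtain ⟨B', hB'⟩ := h.exists_abs_score_le (EuclideanSpace.single k 1)
    refine Integrable.of_bound ((h.measurable_score _).mul
      (h.measurable_score _)).aestronglyMeasurable (B * B') (ae_of_all _ fun z => ?_)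
    have h1 := hB z
    rw [norm_mul, Real.norm_eq_abs, Real.norm_eq_abs]
    exact mul_le_mul h1 (hB' z) (abs_nonneg _) ((abs_nonneg _).trans h1)
  have e : ∀ z, score P X κ w dens θ₀ v z ^ 2 = ∑ j, ∑ k, v j * v k *
      (score P X κ w dens θ₀ (EuclideanSpace.single j 1) z *
        score P X κ w dens θ₀ (EuclideanSpace.single k 1) z) := fun z => by
    rw [h.score_eq_sum, pow_two, Finset.sum_mul_sum]
    refine Finset.sum_congr rfl fun j _ => Finset.sum_congr rfl fun k _ => ?_
    ring
  simp_rw [e]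
  rw [integral_finsetSum _ fun j _ => integrable_finsetSum _ fun k _ => (hi j k).const_mul _]
  simp_rw [fun j => integral_finsetSum Finset.univ fun k _ => (hi j k).const_mul (v j * v k),
    integral_const_mul]
  simp only [dotProduct, Matrix.mulVec, scoreCov, Matrix.of_apply, Finset.mul_sum]
  refine Finset.sum_congr rfl fun j _ => Finset.sum_congr rfl fun k _ => ?_
  ring

lemma IsRegularModel.posSemidef_scoreCov (h : IsRegularModel P X κ w S dens θ₀ U M) :
    (scoreCov P X κ w dens θ₀).PosSemidef := by
  refine Matrix.PosSemidef.of_dotProduct_mulVec_nonneg ?_ fun v => ?_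
  · ext j k
    simp only [scoreCov, Matrix.conjTranspose_apply, Matrix.of_apply, star_trivial]
    simp_rw [mul_comm]
  · rw [star_trivial]
    refine le_of_le_of_eq ?_ (h.integral_score_sq (WithLp.toLp 2 v))
    exact integral_nonneg fun z => sq_nonneg _

end

end CCFEL
end

noncomputable section

namespace CCFEL

/-! ### The linearised estimator -/

/-- The solution `-Γ⁻¹ n⁻¹ ∑ ξ_t` of the normal equations, `ξ_t` being the scores. -/
def linearEstimator {Ω : Type*} [MeasurableSpace Ω] {d p : ℕ} (P : Measure Ω) (X : ℕ → Ω → Vec d)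
    (κ : Vec p → Kernel (Vec d) (Vec d)) (w : Freq d → Vec d → ℂ) (dens : Freq d → ℝ)
    (θ : Vec p) (n : ℕ) (x : ℕ → Vec d) : Vec p :=
  -WithLp.toLp 2 ((infoMatrix P X κ w dens θ)⁻¹.mulVec
    fun j => avg n (score P X κ w dens θ (EuclideanSpace.single j 1)) x)

section

variable {Ω : Type*} [mΩ : MeasurableSpace Ω] {P : Measure Ω} [IsProbabilityMeasure P] {d p : ℕ}
  {X : ℕ → Ω → Vec d} {κ : Vec p → Kernel (Vec d) (Vec d)} {w : Freq d → Vec d → ℂ}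
  {S : Set (Freq d)} {dens : Freq d → ℝ} {θ₀ : Vec p} {U : Set (Vec p)} {M : Vec d → ℝ}

lemma IsRegularModel.avg_score_eq_dotProduct (h : IsRegularModel P X κ w S dens θ₀ U M)
    (v : Vec p) (n : ℕ) (x : ℕ → Vec d) :
    avg n (score P X κ w dens θ₀ v) x =
      v.ofLp ⬝ᵥ fun j => avg n (score P X κ w dens θ₀ (EuclideanSpace.single j 1)) x := by
  simp only [avg, dotProduct, h.score_eq_sum v, smul_eq_mul, Finset.mul_sum]
  rw [Finset.sum_comm]
  refine Finset.sum_congr rfl fun j _ => Finset.sum_congr rfl fun t _ => ?_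
  ring

lemma IsRegularModel.normal_equations (h : IsRegularModel P X κ w S dens θ₀ U M)
    (hG : IsUnit (Gam P X κ w dens θ₀)) (n : ℕ) (x : ℕ → Vec d) (v : Vec p) :
    invForm (freqMeasure dens) (residualVar P X κ w θ₀) (residualPseudoVar P X κ w θ₀)
      (fun τ => meanGrad P X κ w θ₀ τ v) (fun τ => avg n (transResidual κ w θ₀ τ) x) +
    invForm (freqMeasure dens) (residualVar P X κ w θ₀) (residualPseudoVar P X κ w θ₀)
      (fun τ => meanGrad P X κ w θ₀ τ v)
      (fun τ => meanGrad P X κ w θ₀ τ (linearEstimator P X κ w dens θ₀ n x)) = 0 := by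
  have := h.markovKernel θ₀ h.mem
  have := h.density.isProbabilityMeasure
  obtain ⟨c, Dm, hQ⟩ := h.exists_isQuadModel
  have hu : IsUnit (infoMatrix P X κ w dens θ₀).det :=
    (Matrix.isUnit_iff_isUnit_det _).1 (h.posDef_infoMatrix hG).isUnit
  rw [← h.avg_score, h.avg_score_eq_dotProduct, hQ.invForm_apply_apply]
  change _ + v.ofLp ⬝ᵥ (infoMatrix P X κ w dens θ₀).mulVec _ = 0
  rw [linearEstimator, WithLp.ofLp_neg, Matrix.mulVec_neg, Matrix.mulVec_mulVec,
    Matrix.mul_nonsing_inv _ hu, Matrix.one_mulVec, dotProduct_neg, add_neg_cancel]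

lemma IsRegularModel.measurable_linearEstimator (h : IsRegularModel P X κ w S dens θ₀ U M)
    (n : ℕ) : Measurable fun ω => linearEstimator P X κ w dens θ₀ n (fun t => X t ω) := by
  have h1 : Measurable fun ω => fun j : Fin p =>
      avg n (score P X κ w dens θ₀ (EuclideanSpace.single j 1)) (fun t => X t ω) := by
    refine measurable_pi_lambda _ fun j => ?_
    have h0 : Measurable fun ω => ∑ t ∈ Finset.range n,
        score P X κ w dens θ₀ (EuclideanSpace.single j 1) (X t ω, X (t + 1) ω) :=
      Finset.measurable_fun_sum _ fun t _ =>
        (h.measurable_score _).comp (h.process.measurable_pair t)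
    exact h0.const_smul (n : ℝ)⁻¹
  have h2 : Continuous fun y : Fin p → ℝ =>
      -WithLp.toLp 2 ((infoMatrix P X κ w dens θ₀)⁻¹.mulVec y) :=
    ((PiLp.continuous_toLp 2 _).comp (continuous_const.matrix_mulVec continuous_id)).neg
  exact h2.measurable.comp h1

/-- The Cramér–Wold device: each linear functional of the estimator is the average of a single
scalar score, in the direction `-Γ⁻¹ v`, so a scalar central limit theorem suffices. -/
lemma IsRegularModel.inner_linearEstimator (h : IsRegularModel P X κ w S dens θ₀ U M)
    (hG : IsUnit (Gam P X κ w dens θ₀)) (n : ℕ) (x : ℕ → Vec d) (v : Vec p) :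
    inner ℝ (linearEstimator P X κ w dens θ₀ n x) v =
      avg n (score P X κ w dens θ₀
        (-WithLp.toLp 2 ((infoMatrix P X κ w dens θ₀)⁻¹.mulVec v.ofLp))) x := by
  have hsymm : ((infoMatrix P X κ w dens θ₀)⁻¹).transpose = (infoMatrix P X κ w dens θ₀)⁻¹ := by
    have := (h.posDef_infoMatrix hG).isHermitian
    rw [Matrix.transpose_nonsing_inv]
    congr 1
  rw [h.avg_score_eq_dotProduct, EuclideanSpace.inner_eq_star_dotProduct, star_trivial,
    linearEstimator, WithLp.ofLp_neg, WithLp.ofLp_neg, dotProduct_neg, neg_dotProduct,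
    Matrix.dotProduct_mulVec, ← Matrix.mulVec_transpose, hsymm]

/-- The central limit theorem for the linearised estimator. -/
theorem IsRegularModel.tendstoInDistribution_linearEstimator
    (h : IsRegularModel P X κ w S dens θ₀ U M) (hG : IsUnit (Gam P X κ w dens θ₀))
    {Sig : Matrix (Fin p) (Fin p) ℝ} (hSig : Sig.PosSemidef)
    (hSig' : Sig = (infoMatrix P X κ w dens θ₀)⁻¹ * scoreCov P X κ w dens θ₀ *
      (infoMatrix P X κ w dens θ₀)⁻¹) :
    TendstoInDistribution (fun (n : ℕ) (ω : Ω) => Real.sqrt n •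
      linearEstimator P X κ w dens θ₀ n (fun t => X t ω)) atTop
      (id : Vec p → Vec p) (fun _ => P) (multivariateGaussian 0 Sig) := by
  have := h.markovKernel θ₀ h.mem
  have hm : ∀ n : ℕ, Measurable fun ω => Real.sqrt n •
      linearEstimator P X κ w dens θ₀ n (fun t => X t ω) := fun n =>
    (h.measurable_linearEstimator n).const_smul (Real.sqrt n)
  refine ⟨fun n => (hm n).aemeasurable, aemeasurable_id, ?_⟩
  refine ProbabilityMeasure.tendsto_iff_tendsto_charFun.2 fun t => ?_
  simp only [ProbabilityMeasure.coe_mk, Measure.map_id]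
  rw [charFun_multivariateGaussian hSig]
  set s : Vec p := -WithLp.toLp 2 ((infoMatrix P X κ w dens θ₀)⁻¹.mulVec t.ofLp) with hs
  obtain ⟨B, hB⟩ := h.exists_abs_score_le s
  have key := tendsto_integral_exp_sum h.process h.mixing (h.measurable_score s) hB
    (h.integral_score s)
  have hsymm : ((infoMatrix P X κ w dens θ₀)⁻¹).transpose = (infoMatrix P X κ w dens θ₀)⁻¹ := by
    have := (h.posDef_infoMatrix hG).isHermitian
    rw [Matrix.transpose_nonsing_inv]
    congr 1
  rw [h.integral_score_sq s] at key
  have e : s.ofLp ⬝ᵥ (scoreCov P X κ w dens θ₀).mulVec s.ofLp = t.ofLp ⬝ᵥ Sig.mulVec t.ofLp := by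
    rw [hs, WithLp.ofLp_neg, Matrix.mulVec_neg, dotProduct_neg, neg_dotProduct, neg_neg, hSig',
      ← Matrix.mulVec_mulVec, ← Matrix.mulVec_mulVec, Matrix.dotProduct_mulVec t.ofLp,
      ← Matrix.mulVec_transpose, hsymm]
  rw [e] at key
  have e2 : Complex.exp (((inner ℝ t (0 : Vec p) : ℝ) : ℂ) * Complex.I -
      ((t.ofLp ⬝ᵥ Sig.mulVec t.ofLp : ℝ) : ℂ) / 2) =
      Complex.exp (-((t.ofLp ⬝ᵥ Sig.mulVec t.ofLp : ℝ) : ℂ) / 2) := by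
    rw [inner_zero_right]
    congr 1
    push_cast
    ring
  rw [e2]
  refine key.congr fun n => ?_
  rw [charFun_apply, integral_map (hm n).aemeasurable
    (Continuous.aestronglyMeasurable (by fun_prop))]
  refine integral_congr_ae (ae_of_all _ fun ω => ?_)
  simp only
  rw [real_inner_smul_left, h.inner_linearEstimator hG, avg, smul_eq_mul, ← mul_assoc]
  have hsq : Real.sqrt n * (n : ℝ)⁻¹ = (Real.sqrt n)⁻¹ := by
    rw [← div_eq_mul_inv, Real.sqrt_div_self]
  rw [hsq]

/-! ### Comparison of the minimiser with the linearised estimator -/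

lemma exists_pos_forall_mul_le {ι : Type*} (s : Finset ι) (A B : ι → ℝ) (hB : ∀ i ∈ s, 0 < B i) :
    ∃ η > 0, ∀ i ∈ s, A i * η < B i := by
  have h1 : ∀ᶠ η in 𝓝[>] (0 : ℝ), ∀ i ∈ s, A i * η < B i := by
    rw [Filter.eventually_all_finset]
    intro i hi
    have h2 : Tendsto (fun η : ℝ => A i * η) (𝓝[>] 0) (𝓝 (A i * 0)) :=
      (tendsto_const_nhds.mul tendsto_id).mono_left nhdsWithin_le_nhds
    rw [mul_zero] at h2
    exact h2.eventually_lt_const (hB i hi)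
  obtain ⟨η, h1, h2⟩ := (h1.and self_mem_nhdsWithin).exists
  exact ⟨η, h2, h1⟩

/-- On typical paths, minimisers are asymptotically equivalent to the linearised estimator. -/
theorem IsRegularModel.exists_forall_norm_sub_lt (h : IsRegularModel P X κ w S dens θ₀ U M)
    (hG : IsUnit (Gam P X κ w dens θ₀)) {K : ℝ} (hK : 0 < K) {ρ : ℝ} (hρ0 : 0 < ρ)
    (hρ : Metric.closedBall θ₀ ρ ⊆ U) {ε : ℝ} (hε : 0 < ε) (L : ℝ) :
    ∃ η > 0, ∀ᶠ n : ℕ in atTop, ∀ x : ℕ → Vec d,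
      IsTypicalPath P X κ w S θ₀ ρ M n η x → (∀ t, IsSmoothAt κ S U M (x t)) →
      n * ∫ τ, ‖avg n (transResidual κ w θ₀ τ) x‖ ^ 2 ∂(freqMeasure dens) < L →
      ∀ θ ∈ Metric.closedBall θ₀ (K * (n : ℝ) ^ (-(1 / 3) : ℝ)),
        IsMinOn (integratedEL κ w dens x n)
          (Metric.closedBall θ₀ (K * (n : ℝ) ^ (-(1 / 3) : ℝ))) θ →
        ‖Real.sqrt n • (θ - θ₀) - Real.sqrt n • linearEstimator P X κ w dens θ₀ n x‖ < ε := by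
  have := h.markovKernel θ₀ h.mem
  have := h.density.isProbabilityMeasure
  have hS := h.density.compact
  obtain ⟨c, Dm, hQ⟩ := h.exists_isQuadModel
  have hc := hQ.c_pos
  have hDm := hQ.Dm_nonneg
  obtain ⟨γ, hγ, hγv⟩ := exists_pos_mul_norm_sq_le_dotProduct (h.posDef_infoMatrix hG)
  have hpos : ∀ v : Vec p, γ * ‖v‖ ^ 2 ≤ invForm (freqMeasure dens) (residualVar P X κ w θ₀)
      (residualPseudoVar P X κ w θ₀) (fun τ => meanGrad P X κ w θ₀ τ v)
      (fun τ => meanGrad P X κ w θ₀ τ v) := fun v => by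
    rw [hQ.invForm_apply_apply]
    exact hγv v
  set C := 12 / c ^ 2 + 16384 / c ^ 3 with hC
  have hC0 : 0 ≤ C := by positivity
  set B := (2 * Dm / (c * γ)) ^ 2 with hBdef
  have hB0 : 0 ≤ B := by positivity
  set Q := 2 / γ * ((32 / c + 16 * C) * (1 + Dm ^ 2)) * (2 + 3 * B) with hQdef
  have hQ0 : 0 ≤ Q := by positivity
  -- The total error is `3 η`, which explains the factors `3`. The first two conditions are those of
  -- the likelihood expansion, the third lets the curvature absorb the error, and the fourth brings
  -- the final bound below `ε²`.
  obtain ⟨η, hη0, hη⟩ := exists_pos_forall_mul_le (Finset.univ : Finset (Fin 4))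
    ![3, 32 * 3, 4 * ((32 / c + 16 * C) * (1 + Dm ^ 2)) * 3, Q * 3 * L] ![1, c, γ, ε ^ 2]
    (by
      intro i _
      fin_cases i
      · exact one_pos
      · exact hc
      · exact hγ
      · exact pow_pos hε 2)
  have hη1 : 3 * η < 1 := hη 0 (Finset.mem_univ _)
  have hη2 : 32 * 3 * η < c := hη 1 (Finset.mem_univ _)
  have hη3 : 4 * ((32 / c + 16 * C) * (1 + Dm ^ 2)) * 3 * η < γ := hη 2 (Finset.mem_univ _)
  have hη4 : Q * 3 * L * η < ε ^ 2 := hη 3 (Finset.mem_univ _)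
  refine ⟨η, hη0, ?_⟩
  obtain ⟨δ, hδ, hmod⟩ := Metric.uniformContinuousOn_iff_le.1
    ((hS.prod (isCompact_closedBall θ₀ ρ)).uniformContinuousOn_of_continuous
      (CCFEL.continuousOn_meanGrad h.process h.mixing h.weight hS h.isOpen h.markovKernel
        h.integrable h.smooth hρ).1) η hη0
  have hr : Tendsto (fun n : ℕ => K * (n : ℝ) ^ (-(1 / 3) : ℝ)) atTop (𝓝 0) := by
    have := ((tendsto_rpow_neg_atTop (y := 1 / 3) (by norm_num)).comp
      tendsto_natCast_atTop_atTop).const_mul K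
    simpa using this
  -- This is `n r²` for the radius `r = K n^{-1/3}`. It diverges, so a vector whose square is of
  -- order `1 / n` eventually fits into the ball.
  have hr2 : Tendsto (fun n : ℕ => K ^ 2 * (n : ℝ) ^ (1 / 3 : ℝ)) atTop atTop :=
    ((tendsto_rpow_atTop (y := 1 / 3) (by norm_num)).comp
      tendsto_natCast_atTop_atTop).const_mul_atTop (by positivity)
  have hlim : ∀ A : ℝ, ∀ᶠ n : ℕ in atTop, A * (K * (n : ℝ) ^ (-(1 / 3) : ℝ)) ≤ η := fun A => by
    have := hr.const_mul A
    rw [mul_zero] at this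
    exact (this.eventually_lt_const hη0).mono fun n hn => hn.le
  filter_upwards [eventually_ge_atTop 1, hr.eventually_lt_const hρ0, hr.eventually_lt_const hδ,
    hlim (8 * (∫ x, M x ∂(P.map (X 0)) + 1)), hlim (Dm + 1), hr2.eventually_ge_atTop (B * L)]
    with n hn hnρ hnδ hnM hnD hnL x hx hsm hW θ hθ hmin
  have hn0 : (0 : ℝ) < n := by exact_mod_cast hn
  set r := K * (n : ℝ) ^ (-(1 / 3) : ℝ) with hrdef
  have hr0 : 0 ≤ r := by positivity
  have hnr : n * r ^ 2 = K ^ 2 * (n : ℝ) ^ (1 / 3 : ℝ) := by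
    rw [hrdef, mul_pow, ← Real.rpow_natCast ((n : ℝ) ^ (-(1 / 3) : ℝ)), ← Real.rpow_mul hn0.le]
    have : (n : ℝ) ^ (1 / 3 : ℝ) = n * (n : ℝ) ^ (-(1 / 3) * ((2 : ℕ) : ℝ) : ℝ) := by
      rw [← Real.rpow_one_add' hn0.le (by norm_num)]
      norm_num
    rw [this]
    ring
  set W := ∫ τ, ‖avg n (transResidual κ w θ₀ τ) x‖ ^ 2 ∂(freqMeasure dens) with hWdef
  have hgm : AEMeasurable (fun τ => avg n (transResidual κ w θ₀ τ) x) (freqMeasure dens) := by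
    unfold avg
    refine (Measurable.const_smul (Finset.measurable_fun_sum _ fun t _ => ?_) _).aemeasurable
    exact (measurable_transResidual h.weight).comp measurable_prodMk_right
  have hgB : ∀ τ ∈ S, ‖avg n (transResidual κ w θ₀ τ) x‖ ≤ η := fun τ hτ => (hx.mean τ hτ).le
  have hne := h.normal_equations hG n x
  set v₀ := linearEstimator P X κ w dens θ₀ n x with hv₀
  -- The linear estimator has to lie in the ball, since the minimiser is compared with it there.
  have hv₀r : θ₀ + v₀ ∈ Metric.closedBall θ₀ r := by
    rw [mem_closedBall_iff_norm, add_sub_cancel_left]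
    refine abs_le_of_sq_le_sq' ?_ hr0 |>.2
    have h1 := hQ.norm_solution_le hγ hpos hgm hgB hne
    have h2 : n * ‖v₀‖ ^ 2 ≤ n * r ^ 2 := by
      calc n * ‖v₀‖ ^ 2 ≤ n * (B * W) := by gcongr
        _ = B * (n * W) := by ring
        _ ≤ B * L := by gcongr
        _ ≤ n * r ^ 2 := by rw [hnr]; exact hnL
    exact le_of_mul_le_mul_left h2 hn0
  have hv₁r : θ₀ + (θ - θ₀) ∈ Metric.closedBall θ₀ r := by rwa [add_sub_cancel]
  have hball : ∀ v ∈ ({v₀, θ - θ₀} : Set (Vec p)), θ₀ + v ∈ Metric.closedBall θ₀ r := by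
    rintro v (rfl | rfl)
    · exact hv₀r
    · exact hv₁r
  have hD : ∀ τ ∈ S, ∀ θ ∈ Metric.closedBall θ₀ r,
      ‖meanGrad P X κ w θ τ - meanGrad P X κ w θ₀ τ‖ ≤ η := fun τ hτ θ hθ => by
    have := hmod (τ, θ) ⟨hτ, Metric.closedBall_subset_closedBall hnρ.le hθ⟩ (τ, θ₀)
      ⟨hτ, Metric.mem_closedBall_self hρ0.le⟩ (by
        rw [Prod.dist_eq, dist_self, max_eq_right dist_nonneg]
        exact (Metric.mem_closedBall.1 hθ).trans hnδ.le)
    rwa [dist_eq_norm] at this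
  have key := hQ.norm_sub_sq_le hγ hpos hC0 (η := 3 * η) (by positivity) hη1.le
    (by linarith) hn hgm hgB (v₁ := θ - θ₀) hne
    (y := fun v τ => avg n (transResidual κ w (θ₀ + v) τ) x)
    (F := fun v τ => elLogRatio (fun t : Fin n => residualVec κ w τ (θ₀ + v) (x t) (x (t + 1))))
    (fun v hv τ hτ => by
      have := hx.norm_avg_transResidual_sub_le hsm hnρ.le hρ hτ (hD τ hτ) (hball v hv)
      rw [add_sub_cancel_left] at this
      refine this.trans ?_
      gcongr
      linarith)
    (fun v hv τ hτ => hx.elLogRatio_expansion hsm hn h.weight h.markovKernel hnρ.le hρ hτ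
      (hD τ hτ) (hQ.norm_D_le τ hτ) hc (hQ.gap τ hτ) hη1.le (by linarith) hnM hnD (hball v hv))
    (by
      rw [h.density.lintegral_eq, h.density.lintegral_eq, add_sub_cancel]
      exact hmin hv₀r)
  rw [← smul_sub, norm_smul, Real.norm_of_nonneg (Real.sqrt_nonneg _)]
  refine abs_lt_of_sq_lt_sq' ?_ hε.le |>.2
  rw [mul_pow, Real.sq_sqrt hn0.le]
  calc n * ‖θ - θ₀ - v₀‖ ^ 2 ≤ n * (Q * (3 * η) * W) := by gcongr
    _ = Q * (3 * η) * (n * W) := by ring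
    _ ≤ Q * (3 * η) * L := by gcongr
    _ = Q * 3 * L * η := by ring
    _ < ε ^ 2 := hη4

end

end CCFEL
end

noncomputable section

namespace CCFEL

/-! ### Asymptotic normality -/

/-- Dominated convergence for the indicators. It accommodates a minimisation property that holds
only from a random index on. -/
lemma tendsto_measure_of_ae_eventually_notMem {Ω : Type*} [MeasurableSpace Ω] {P : Measure Ω}
    [IsFiniteMeasure P] {A : ℕ → Set Ω} (hA : ∀ n, NullMeasurableSet (A n) P)
    (h : ∀ᵐ ω ∂P, ∀ᶠ n in atTop, ω ∉ A n) : Tendsto (fun n => P (A n)) atTop (𝓝 0) := by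
  have h1 := tendsto_lintegral_of_dominated_convergence' (μ := P)
    (F := fun n => (A n).indicator fun _ => (1 : ℝ≥0∞)) (f := fun _ => 0) (fun _ => 1)
    (fun n => aemeasurable_const.indicator₀ (hA n))
    (fun n => ae_of_all _ fun ω => Set.indicator_le_self' (fun _ _ => zero_le) ω)
    (by simp) (h.mono fun ω hω => tendsto_const_nhds.congr' (hω.mono fun n hn =>
      (Set.indicator_of_notMem hn _).symm))
  simpa [lintegral_indicator_const₀ (hA _)] using h1

section

variable {Ω : Type*} [mΩ : MeasurableSpace Ω] {P : Measure Ω} [IsProbabilityMeasure P] {d p : ℕ}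
  {X : ℕ → Ω → Vec d} {κ : Vec p → Kernel (Vec d) (Vec d)} {w : Freq d → Vec d → ℂ}
  {S : Set (Freq d)} {dens : Freq d → ℝ} {θ₀ : Vec p} {U : Set (Vec p)} {M : Vec d → ℝ}

omit [IsProbabilityMeasure P] in
lemma SmoothCCF.exists_isSmoothAt {Θ : Set (Vec p)} (h : SmoothCCF P X κ w S Θ θ₀) :
    ∃ U M, IsOpen U ∧ θ₀ ∈ U ∧ U ⊆ Θ ∧ Integrable M (P.map (X 0)) ∧
      ∀ᵐ x ∂(P.map (X 0)), IsSmoothAt κ S U M x := by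
  obtain ⟨U, hU, hθ, hsub, h1, -, h2, M, hM, h3⟩ := h
  refine ⟨U, M, hU, hθ, hsub, hM, ?_⟩
  filter_upwards [h1, h2, h3] with x h1 h2 h3
  exact ⟨fun τ hτ θ hθ => ((h1 τ hτ).differentiableOn (by norm_num)).differentiableAt
    (hU.mem_nhds hθ), h2, h3⟩

/-- The estimator is asymptotically equivalent to the linearised one. -/
theorem IsRegularModel.tendstoInMeasure_sub (h : IsRegularModel P X κ w S dens θ₀ U M)
    (hG : IsUnit (Gam P X κ w dens θ₀)) {K : ℝ} (hK : 0 < K) {est : ℕ → Ω → Vec p}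
    (hm : ∀ n, AEMeasurable (est n) P) (hest : IsLocalMELE P X κ w dens θ₀ K est) :
    TendstoInMeasure P ((fun (n : ℕ) (ω : Ω) => Real.sqrt n • (est n ω - θ₀)) -
      fun (n : ℕ) (ω : Ω) => Real.sqrt n • linearEstimator P X κ w dens θ₀ n (fun t => X t ω))
      atTop 0 := by
  have := h.markovKernel θ₀ h.mem
  have := h.density.isProbabilityMeasure
  obtain ⟨ρ, hρ0, hρ⟩ := Metric.nhds_basis_closedBall.mem_iff.1 (h.isOpen.mem_nhds h.mem)
  have hae : ∀ᵐ ω ∂P, ∀ t, IsSmoothAt κ S U M (X t ω) := by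
    rw [ae_all_iff]
    intro t
    have := h.smooth
    rw [← h.process.stationary t] at this
    exact ae_of_ae_map (h.process.measurable t).aemeasurable this
  rw [tendstoInMeasure_iff_norm]
  intro ε hε
  rw [ENNReal.tendsto_nhds_zero]
  intro δ hδ
  obtain ⟨L, hL0, hL⟩ : ∃ L : ℝ, 0 < L ∧ ENNReal.ofReal (2 ^ 2 / L) ≤ δ / 3 := by
    have h1 : Tendsto (fun L : ℝ => ENNReal.ofReal (2 ^ 2 / L)) atTop (𝓝 0) := by
      rw [← ENNReal.ofReal_zero]
      exact ENNReal.tendsto_ofReal (tendsto_const_nhds.div_atTop tendsto_id)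
    obtain ⟨L, h2, h3⟩ := ((ENNReal.tendsto_nhds_zero.1 h1 (δ / 3)
      (ENNReal.div_pos hδ.ne' (by simp))).and (eventually_gt_atTop 0)).exists
    exact ⟨L, h3, h2⟩
  obtain ⟨η, hη, hdev⟩ := h.exists_forall_norm_sub_lt hG hK hρ0 hρ hε L
  -- The exceptional sets need not be measurable; measurable hulls have the same measure.
  set T : ℕ → Set Ω := fun n =>
    toMeasurable P {ω | ¬ IsTypicalPath P X κ w S θ₀ ρ M n η (fun t => X t ω)} with hT
  set G : ℕ → Set Ω := fun n => toMeasurable P {ω | L ≤ n * ∫ τ,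
    ‖avg n (transResidual κ w θ₀ τ) (fun t => X t ω)‖ ^ 2 ∂(freqMeasure dens)} with hGdef
  set E : ℕ → Set Ω := fun n => {ω | ε ≤ ‖((fun (n : ℕ) (ω : Ω) => Real.sqrt n • (est n ω - θ₀)) -
      fun (n : ℕ) (ω : Ω) => Real.sqrt n • linearEstimator P X κ w dens θ₀ n (fun t => X t ω)) n ω -
      (0 : ℕ → Ω → Vec p) n ω‖} with hE
  have hEm : ∀ n, NullMeasurableSet (E n) P := fun n => by
    refine nullMeasurableSet_le aemeasurable_const (AEMeasurable.norm ?_)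
    refine AEMeasurable.sub (AEMeasurable.sub ?_ ?_) aemeasurable_const
    · exact ((hm n).sub_const θ₀).const_smul (Real.sqrt n)
    · exact ((h.measurable_linearEstimator n).const_smul (Real.sqrt n)).aemeasurable
  have hTlim : Tendsto (fun n => P (T n)) atTop (𝓝 0) := by
    simp only [hT, measure_toMeasurable]
    exact tendsto_measure_not_isTypicalPath h.process h.mixing h.weight h.density.compact h.isOpen
      h.markovKernel h.integrable h.smooth hρ hη
  have hGle : ∀ n ≥ 1, P (G n) ≤ δ / 3 := fun n hn => by
    have h1 := mul_measureReal_le_integral_norm_sq_avg h.process (freqMeasure dens)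
      (h := transResidual κ w θ₀) (measurable_transResidual h.weight)
      (norm_transResidual_le h.weight) integral_transResidual_eq_zero hn L
    rw [hGdef]
    simp only [measure_toMeasurable]
    refine le_trans ?_ hL
    rw [← ENNReal.ofReal_toReal (measure_ne_top P _)]
    refine ENNReal.ofReal_le_ofReal ?_
    rw [le_div_iff₀ hL0, mul_comm]
    exact h1
  -- Outside `T n` and `G n` the comparison is deterministic for large `n`, so almost surely `E n \
  -- (T n ∪ G n)` is eventually avoided. The three contributions to `E n` are each at most `δ / 3`.
  have hBlim : Tendsto (fun n => P (E n \ (T n ∪ G n))) atTop (𝓝 0) := by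
    refine tendsto_measure_of_ae_eventually_notMem (fun n => (hEm n).diff
      ((measurableSet_toMeasurable _ _).union
        (measurableSet_toMeasurable _ _)).nullMeasurableSet) ?_
    filter_upwards [hest, hae] with ω hω hsm
    filter_upwards [hω, hdev] with n hn hdev hmem
    obtain ⟨hmE, hmTG⟩ := hmem
    rw [Set.mem_union, not_or] at hmTG
    have hT1 : IsTypicalPath P X κ w S θ₀ ρ M n η (fun t => X t ω) := by
      by_contra hcon
      exact hmTG.1 (subset_toMeasurable P _ hcon)
    have hG1 := fun hcon => hmTG.2 (subset_toMeasurable P _ hcon)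
    have h1 := hdev (fun t => X t ω) hT1 hsm (lt_of_not_ge hG1) (est n ω) hn.1 hn.2
    simp only [hE, Set.mem_ofPred_eq, Pi.sub_apply, Pi.zero_apply, sub_zero] at hmE
    exact absurd h1 (not_lt.2 hmE)
  have hδ3 : 0 < δ / 3 := ENNReal.div_pos hδ.ne' (by simp)
  filter_upwards [ENNReal.tendsto_nhds_zero.1 hTlim _ hδ3, ENNReal.tendsto_nhds_zero.1 hBlim _ hδ3,
    eventually_ge_atTop 1] with n h1 h2 h3
  calc P (E n) ≤ P ((E n \ (T n ∪ G n)) ∪ (T n ∪ G n)) :=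
        measure_mono (by rw [Set.sdiff_union_self]; exact Set.subset_union_left)
    _ ≤ δ / 3 + (δ / 3 + δ / 3) := (measure_union_le _ _).trans
        (add_le_add h2 ((measure_union_le _ _).trans (add_le_add h1 (hGle n h3))))
    _ = δ := by rw [← add_assoc, ENNReal.add_thirds]

end

end CCFEL
end

theorem theorem1 {Ω : Type*} [MeasurableSpace Ω] (P : Measure Ω) [IsProbabilityMeasure P]
    {d p : ℕ}
    (Θ : Set (CCFEL.Vec p)) (θ₀ : CCFEL.Vec p)
    (κ : CCFEL.Vec p → Kernel (CCFEL.Vec d) (CCFEL.Vec d))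
    (hκ : ∀ θ ∈ Θ, IsMarkovKernel (κ θ))
    (X : ℕ → Ω → CCFEL.Vec d)
    (w : CCFEL.Freq d → CCFEL.Vec d → ℂ) (S : Set (CCFEL.Freq d)) (dens : CCFEL.Freq d → ℝ)
    (hX : CCFEL.IsStationaryMarkov P X (κ θ₀))
    (hw : CCFEL.IsWeight S w)
    (hdens : CCFEL.IsFreqDensity S dens)
    (hmix : CCFEL.ExpAlphaMixing P X)
    (hsmooth : CCFEL.SmoothCCF P X κ w S Θ θ₀)
    (hident : CCFEL.Identified P X κ w S Θ θ₀)
    (hinv : CCFEL.Invertibility P X κ w S dens θ₀)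
    (K : ℝ) (hK : 0 < K)
    (est : ℕ → Ω → CCFEL.Vec p) (hest_meas : ∀ n, AEMeasurable (est n) P)
    (hest : CCFEL.IsLocalMELE P X κ w dens θ₀ K est) :
    ∃ Sig : Matrix (Fin p) (Fin p) ℝ,
      Sig.map (fun a : ℝ => (a : ℂ)) =
        (CCFEL.Gam P X κ w dens θ₀)⁻¹ * CCFEL.Vmat P X κ w dens θ₀ *
          (CCFEL.Gam P X κ w dens θ₀)⁻¹ ∧
      Sig.PosSemidef ∧
      TendstoInDistribution (fun (n : ℕ) (ω : Ω) => Real.sqrt n • (est n ω - θ₀)) atTop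
        (id : CCFEL.Vec p → CCFEL.Vec p) (fun _ => P) (multivariateGaussian 0 Sig) := by
  obtain ⟨U, M, hU, hθ₀, hUΘ, hM, hsm⟩ := hsmooth.exists_isSmoothAt
  have h : CCFEL.IsRegularModel P X κ w S dens θ₀ U M :=
    ⟨hU, hθ₀, fun θ hθ => hκ θ (hUΘ hθ), hX, hmix, hw, hdens, hM, hsm, hinv.posDef⟩
  have hG := hinv.gam
  have hpd := h.posDef_infoMatrix hG
  set I := CCFEL.infoMatrix P X κ w dens θ₀ with hI
  set V := CCFEL.scoreCov P X κ w dens θ₀ with hV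
  have hu : IsUnit I.det := (Matrix.isUnit_iff_isUnit_det _).1 hpd.isUnit
  have hsd : (I⁻¹ * V * I⁻¹).PosSemidef := by
    have := h.posSemidef_scoreCov.conjTranspose_mul_mul_same I⁻¹
    rwa [Matrix.conjTranspose_nonsing_inv, hpd.isHermitian.eq] at this
  refine ⟨I⁻¹ * V * I⁻¹, ?_, hsd, ?_⟩
  -- The embedding of the reals into the complex numbers is a ring homomorphism, so it commutes with
  -- inverses of matrices that are invertible over the reals.
  · have hinv' : (I.map (fun a : ℝ => (a : ℂ)))⁻¹ = I⁻¹.map (fun a : ℝ => (a : ℂ)) := by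
      refine Matrix.inv_eq_right_inv ?_
      have e := (Matrix.map_mul (f := Complex.ofRealHom) (L := I) (M := I⁻¹)).symm
      rw [Matrix.mul_nonsing_inv _ hu] at e
      refine e.trans ?_
      exact Matrix.map_one _ (map_zero _) (map_one _)
    rw [h.gam_eq, h.vmat_eq, hinv']
    have e1 := Matrix.map_mul (f := Complex.ofRealHom) (L := I⁻¹ * V) (M := I⁻¹)
    have e2 := Matrix.map_mul (f := Complex.ofRealHom) (L := I⁻¹) (M := V)
    rw [e2] at e1
    exact e1
  -- Slutsky's theorem: the estimator inherits the limit law of its linearisation.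
  · refine tendstoInDistribution_of_tendstoInMeasure_sub _ _
      (h.tendstoInDistribution_linearEstimator hG hsd rfl)
      (h.tendstoInMeasure_sub hG hK hest_meas hest) fun n => ?_
    exact ((hest_meas n).sub_const θ₀).const_smul (Real.sqrt n)
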